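/- **Setting.** Fix constants $a_0,a_1,a_2,a_3>0$, a time horizon $T>0$, $c\in\mathbb{R}$, and boundary data $g_0,g_1\in C^4([0,T])$ with $g_i(0)=g_i'(0)=0$ for $i=0,1$. For a function $a$, consider the problem $$\partial_t p+\partial_x u=0,\qquad \partial_t u+\partial_x p+a(u)=0\qquad (0<x<1,\ 0<t<T),$$ $$u(0,t)=g_0(t),\quad u(1,t)=g_1(t),\qquad p(x,0)=c,\quad u(x,0)=0 .$$ A classical solution is a pair $(p,u)\in C^1([0,T];L^2(0,1)^2)\cap C([0,T];H^1(0,1)^2)$ satisfying these equations. For an open interval $\Omega\subseteq\mathbb{R}$ with $0\in\overline\Omega$, say that $a$ satisfies (A1) on $\Omega$ with constants $a_0,\dots,a_3$ if $a$ (identified with its continuous representative on $\overline\Omega$) has weak derivatives up to order three on $\Omega$, $a(0)=0$, and $a_0\le a'\le a_1$, $|a''|\le a_2$, $|a'''|\le a_3$ almost everywhere on $\Omega$. Call $\underline u<\overline u$ with $0\in[\underline u,\overline u]$ *state bounds* if $\underline u\le u(x,t)\le\overline u$ for all $x\in[0,1]$, $t\in[0,T]$ holds for every classical solution $(p,u)$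 and every parameter $a:\mathbb{R}\to\mathbb{R}$ that satisfies (A1) on $(\underline u,\overline u)$ with the constants $a_0,\dots,a_3$ and satisfies (A1) on $\mathbb{R}$ with some positive constants. For state bounds $\underline u,\overline u$ let $$D(F)=\{a\in H^2(\underline u,\overline u): a \text{ satisfies (A1) on } (\underline u,\overline u) \text{ with constants } a_0,\dots,a_3\},$$ and let $F(a)=\triangle p:=p(0,\cdot)-p(1,\cdot)$, where $(p,u)$ is the classical solution for the parameter $a$ with $\underline u\le u\le\overline u$. **Theorem (Lipschitz continuity).** State bounds exist. For all state bounds $\underline u,\overline u$, the map $F:D(F)\subset H^2(\underline u,\overline u)\to L^2(0,T)$ is well-defined (for each $a\in D(F)$ there is exactly one classical solution with values of $u$ in $[\underline u,\overline u]$, and $\triangle p\in L^2(0,T)$), and $F$ is Lipschitz continuous: there is a constant $C_L$, independent of $a$ and $\tilde a$, such that $$\|F(a)-F(\tilde a)\|_{L^2(0,T)}\le C_L\,\|a-\tilde a\|_{H^2(\underline u,\overline u)}\qquad\text{for all } a,\tilde a\in D(F).$$ -/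

import Mathlib

open Set MeasureTheory
open scoped ContDiff NNReal

noncomputable section

/-- `L²(α, β)`. -/
abbrev L2 (α β : ℝ) : Type := Lp ℝ 2 (volume.restrict (Ioo α β))

/-- `f'` is the weak derivative of `f` on the open set `Ω`, both being locally integrable on `Ω`. -/
structure HasWeakDeriv (Ω : Set ℝ) (f f' : ℝ → ℝ) : Prop where
  locInt : LocallyIntegrableOn f Ω
  locInt' : LocallyIntegrableOn f' Ω
  parts : ∀ φ : ℝ → ℝ, ContDiff ℝ ∞ φ → HasCompactSupport φ → tsupport φ ⊆ Ω →
    ∫ x in Ω, f x * deriv φ x = - ∫ x in Ω, f' x * φ x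

theorem integrable_mul_test {Ω : Set ℝ} {f φ : ℝ → ℝ}
    (hf : LocallyIntegrableOn f Ω) (hφ : Continuous φ) (hc : HasCompactSupport φ)
    (hs : tsupport φ ⊆ Ω) : Integrable (fun x => f x * φ x) (volume.restrict Ω) := by
  have h1 : IntegrableOn f (tsupport φ) := hf.integrableOn_compact_subset hs hc
  have h2 : IntegrableOn (fun x => f x * φ x) (tsupport φ) :=
    h1.mul_continuousOn hφ.continuousOn hc
  have h3 : Integrable (fun x => f x * φ x) := by
    rwa [integrableOn_iff_integrable_of_support_subset] at h2
    intro x hx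
    exact subset_tsupport φ (fun h => hx (by simp [h]))
  exact h3.restrict

theorem HasWeakDeriv.add {Ω : Set ℝ} {f f' g g' : ℝ → ℝ}
    (hf : HasWeakDeriv Ω f f') (hg : HasWeakDeriv Ω g g') :
    HasWeakDeriv Ω (f + g) (f' + g') where
  locInt := hf.locInt.add hg.locInt
  locInt' := hf.locInt'.add hg.locInt'
  parts φ h1 h2 h3 := by
    have hd : Continuous (deriv φ) := h1.continuous_deriv (by simp)
    have hds : tsupport (deriv φ) ⊆ Ω := (tsupport_deriv_subset).trans h3
    simp only [Pi.add_apply, add_mul]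
    rw [integral_add (integrable_mul_test hf.locInt hd h2.deriv hds)
      (integrable_mul_test hg.locInt hd h2.deriv hds),
      integral_add (integrable_mul_test hf.locInt' h1.continuous h2 h3)
      (integrable_mul_test hg.locInt' h1.continuous h2 h3),
      hf.parts φ h1 h2 h3, hg.parts φ h1 h2 h3]
    ring

theorem HasWeakDeriv.smul {Ω : Set ℝ} {f f' : ℝ → ℝ} (c : ℝ) (hf : HasWeakDeriv Ω f f') :
    HasWeakDeriv Ω (c • f) (c • f') where
  locInt := hf.locInt.smul c
  locInt' := hf.locInt'.smul c
  parts φ h1 h2 h3 := by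
    simp only [Pi.smul_apply, smul_eq_mul, mul_assoc]
    rw [integral_const_mul, integral_const_mul, hf.parts φ h1 h2 h3]
    ring

theorem HasWeakDeriv.congr_ae {Ω : Set ℝ} (hΩ : IsOpen Ω) {f f' g g' : ℝ → ℝ}
    (hf : HasWeakDeriv Ω f f') (h : f =ᵐ[volume.restrict Ω] g)
    (h' : f' =ᵐ[volume.restrict Ω] g') : HasWeakDeriv Ω g g' where
  locInt := by
    rw [locallyIntegrableOn_iff hΩ.isLocallyClosed]
    intro k hk hkc
    exact (hf.locInt.integrableOn_compact_subset hk hkc).congr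
      (ae_restrict_of_ae_restrict_of_subset hk h)
  locInt' := by
    rw [locallyIntegrableOn_iff hΩ.isLocallyClosed]
    intro k hk hkc
    exact (hf.locInt'.integrableOn_compact_subset hk hkc).congr
      (ae_restrict_of_ae_restrict_of_subset hk h')
  parts φ h1 h2 h3 := by
    rw [← integral_congr_ae (h.mono fun x hx => by simp only [hx] :
        (fun x => f x * deriv φ x) =ᵐ[volume.restrict Ω] fun x => g x * deriv φ x),
      ← integral_congr_ae (h'.mono fun x hx => by simp only [hx] :
        (fun x => f' x * φ x) =ᵐ[volume.restrict Ω] fun x => g' x * φ x)]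
    exact hf.parts φ h1 h2 h3

/-- The Sobolev space `Hᵏ(α, β)`: a function `v 0 ∈ L²(α, β)` together with its weak derivatives
`v 1, …, v k ∈ L²(α, β)`, with the norm `‖v‖² = ∑ i, ‖v i‖²` (sum of squared `L²` norms). -/
def SobolevH (k : ℕ) (α β : ℝ) : Submodule ℝ (PiLp 2 fun _ : Fin (k + 1) => L2 α β) where
  carrier := {v | ∀ i : Fin k, HasWeakDeriv (Ioo α β) (v i.castSucc) (v i.succ)}
  zero_mem' := fun i => by
    have h0 : HasWeakDeriv (Ioo α β) 0 0 :=
      ⟨locallyIntegrableOn_zero, locallyIntegrableOn_zero, fun φ _ _ _ => by simp⟩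
    exact h0.congr_ae isOpen_Ioo (Lp.coeFn_zero _ _ _).symm (Lp.coeFn_zero _ _ _).symm
  add_mem' := fun {v w} hv hw i =>
    ((hv i).add (hw i)).congr_ae isOpen_Ioo
      (Lp.coeFn_add _ _).symm (Lp.coeFn_add _ _).symm
  smul_mem' := fun c v hv i =>
    ((hv i).smul c).congr_ae isOpen_Ioo (Lp.coeFn_smul _ _).symm (Lp.coeFn_smul _ _).symm

/-- The `i`-th weak derivative of an element of `Hᵏ(α, β)`, as an element of `L²(α, β)`. -/
def weakD {k : ℕ} {α β : ℝ} (v : SobolevH k α β) (i : Fin (k + 1)) : L2 α β := v.1 i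

open Classical in
/-- The representative that is continuous on `[α, β]` of an element of `Hᵏ(α, β)`. It gives
meaning to point values and boundary values (for `k ≥ 1` and `α < β` it exists, and it is unique
on `[α, β]`). -/
def pointVal {k : ℕ} {α β : ℝ} (v : SobolevH k α β) : ℝ → ℝ :=
  if h : ∃ f : ℝ → ℝ, ContinuousOn f (Icc α β) ∧ weakD v 0 =ᵐ[volume.restrict (Ioo α β)] f
  then h.choose else 0

/-- The constants `a₀, a₁, a₂, a₃` in the bounds on the damping parameter. -/
structure ParamBounds where
  a₀ : ℝ
  a₁ : ℝ
  a₂ : ℝ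
  a₃ : ℝ
  a₀_pos : 0 < a₀
  a₁_pos : 0 < a₁
  a₂_pos : 0 < a₂
  a₃_pos : 0 < a₃

/-- The parameter `a` is admissible on the open interval `Ω` (on `ℝ` for `Ω = univ`): it has weak derivatives up to
order three with `a₀ ≤ a' ≤ a₁`, `|a''| ≤ a₂`, `|a'''| ≤ a₃` almost everywhere on `Ω`, and
`a(0) = 0`, where `a` is the continuous representative. -/
def AdmissibleOn (B : ParamBounds) (Ω : Set ℝ) (a : ℝ → ℝ) : Prop :=
  ContinuousOn a (closure Ω) ∧ 0 ∈ closure Ω ∧ a 0 = 0 ∧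
  ∃ a' a'' a''' : ℝ → ℝ,
    HasWeakDeriv Ω a a' ∧ HasWeakDeriv Ω a' a'' ∧ HasWeakDeriv Ω a'' a''' ∧
    ∀ᵐ ξ ∂(volume.restrict Ω),
      (B.a₀ ≤ a' ξ ∧ a' ξ ≤ B.a₁) ∧ |a'' ξ| ≤ B.a₂ ∧ |a''' ξ| ≤ B.a₃

/-- Admissible boundary datum: `g ∈ C⁴([0,T])`, `g(0) = 0`, `g'(0) = 0`. -/
structure AdmissibleDatum (T : ℝ) (g : ℝ → ℝ) : Prop where
  smooth : ContDiffOn ℝ 4 g (Icc 0 T)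
  zero : g 0 = 0
  deriv_zero : derivWithin g (Icc 0 T) 0 = 0

/-- `(p, u) ∈ C¹([0,T]; L²(0,1)²) ∩ C([0,T]; H¹(0,1)²)` is a classical solution on `[0, T]` of
`∂ₜp + ∂ₓu = 0`, `∂ₜu + ∂ₓp + a(u) = 0`, `u(0,t) = g₀(t)`, `u(1,t) = g₁(t)`,
`p(x,0) = c`, `u(x,0) = 0`. Time derivatives are taken in `L²(0,1)`. -/
structure IsClassicalSolution (T c : ℝ) (g₀ g₁ a : ℝ → ℝ) (p u : ℝ → SobolevH 1 0 1) : Prop where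
  cont_p : ContinuousOn p (Icc 0 T)
  cont_u : ContinuousOn u (Icc 0 T)
  diff_p : ContDiffOn ℝ 1 (fun t => weakD (p t) 0) (Icc 0 T)
  diff_u : ContDiffOn ℝ 1 (fun t => weakD (u t) 0) (Icc 0 T)
  mass : ∀ t ∈ Icc 0 T, ∀ᵐ x ∂(volume.restrict (Ioo (0 : ℝ) 1)),
    derivWithin (fun s => weakD (p s) 0) (Icc 0 T) t x + weakD (u t) 1 x = 0
  momentum : ∀ t ∈ Icc 0 T, ∀ᵐ x ∂(volume.restrict (Ioo (0 : ℝ) 1)),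
    derivWithin (fun s => weakD (u s) 0) (Icc 0 T) t x + weakD (p t) 1 x
      + a (pointVal (u t) x) = 0
  left : ∀ t ∈ Icc 0 T, pointVal (u t) 0 = g₀ t
  right : ∀ t ∈ Icc 0 T, pointVal (u t) 1 = g₁ t
  init_p : ∀ x ∈ Icc (0 : ℝ) 1, pointVal (p 0) x = c
  init_u : ∀ x ∈ Icc (0 : ℝ) 1, pointVal (u 0) x = 0

/-- `umin ≤ u(x,t) ≤ umax` for all `x ∈ [0,1]`, `t ∈ [0,T]`. -/
def TakesValuesIn (T umin umax : ℝ) (u : ℝ → SobolevH 1 0 1) : Prop :=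
  ∀ t ∈ Icc 0 T, ∀ x ∈ Icc (0 : ℝ) 1, pointVal (u t) x ∈ Icc umin umax

/-- `umin < umax`, with `0` (the initial velocity) between them, are bounds for the velocity, independent of the parameter: every classical
solution `(p, u)` satisfies `umin ≤ u ≤ umax`, for every parameter `a` on `ℝ` that is admissible
on `(umin, umax)` with the constants `B` (and on `ℝ` with some constants `B'`). -/
def AreStateBounds (B : ParamBounds) (T c : ℝ) (g₀ g₁ : ℝ → ℝ) (umin umax : ℝ) : Prop :=
  umin < umax ∧ 0 ∈ Icc umin umax ∧
  ∀ (B' : ParamBounds) (a : ℝ → ℝ), AdmissibleOn B' univ a → AdmissibleOn B (Ioo umin umax) a →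
    ∀ p u : ℝ → SobolevH 1 0 1, IsClassicalSolution T c g₀ g₁ a p u → TakesValuesIn T umin umax u

/-- The domain `D(F) = {a ∈ H²(umin, umax)  : a admissible on (umin, umax)}`. -/
def domF (B : ParamBounds) (umin umax : ℝ) : Set (SobolevH 2 umin umax) :=
  {a | AdmissibleOn B (Ioo umin umax) (pointVal a)}

/-- `(p, u)` is the state for a parameter `a ∈ H²(umin, umax)`. Since `a` is only defined on
`[umin, umax]`, the velocity has to take its values there. -/
def IsState (T c : ℝ) (g₀ g₁ : ℝ → ℝ) {umin umax : ℝ} (a : SobolevH 2 umin umax)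
    (p u : ℝ → SobolevH 1 0 1) : Prop :=
  IsClassicalSolution T c g₀ g₁ (pointVal a) p u ∧ TakesValuesIn T umin umax u

/-- The pressure drop `p(0,t) - p(1,t)`. -/
def pressureDrop (p : ℝ → SobolevH 1 0 1) (t : ℝ) : ℝ := pointVal (p t) 0 - pointVal (p t) 1

open Classical in
/-- The forward operator `F : H²(umin, umax) → L²(0, T)`, which maps `a` to the pressure drop of
its state `(p, u)` (with value `0` if there is no state). -/
def forwardOp (T c : ℝ) (g₀ g₁ : ℝ → ℝ) {umin umax : ℝ} (a : SobolevH 2 umin umax) : L2 0 T :=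
  if h : ∃ y : (ℝ → SobolevH 1 0 1) × (ℝ → SobolevH 1 0 1),
      IsState T c g₀ g₁ a y.1 y.2 ∧
        MemLp (pressureDrop y.1) 2 (volume.restrict (Ioo 0 T))
  then h.choose_spec.2.toLp _ else 0

/-- `F` is well-defined at `a`: a state exists, it is unique on `[0, T]`, its pressure drop is in
`L²(0, T)`, and `F(a)` is this pressure drop. -/
def ForwardOpWellDefinedAt (T c : ℝ) (g₀ g₁ : ℝ → ℝ) {umin umax : ℝ}
    (a : SobolevH 2 umin umax) : Prop :=
  ∃ p u : ℝ → SobolevH 1 0 1, IsState T c g₀ g₁ a p u ∧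
    (∀ q w : ℝ → SobolevH 1 0 1, IsState T c g₀ g₁ a q w →
      EqOn q p (Icc 0 T) ∧ EqOn w u (Icc 0 T)) ∧
    MemLp (pressureDrop p) 2 (volume.restrict (Ioo 0 T)) ∧
    forwardOp T c g₀ g₁ a =ᵐ[volume.restrict (Ioo 0 T)] pressureDrop p

end

/-! ### Weak derivatives on an interval and primitives. -/

noncomputable section

/-! The Riemann invariants `p + u` and `p - u` are transported with speeds `1` and `-1` and with
sources `-a(u)` and `a(u)`. Stability, uniqueness and the state bounds are energy arguments for
these two equations; existence is a fixed point argument along characteristics.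

Stability. Let `R`, `S` be the differences of the invariants of two states with parameters `a`, `b`.
Both velocities have the same boundary values, so `R = S` at `x = 0` and `x = 1`, and the boundary
terms in the derivative of `∫ (R² + S²)` cancel. Since `a` is monotone, the source is dissipative up
to an error governed by `δ = sup |a - b|`, and Gronwall's argument bounds the energy by a multiple
of `δ²` (`diffEnergy_le`); for `δ = 0` this is uniqueness. The energy does not control pressure
traces, but the derivative of `∫ ((1 - x) R² + x S²)` contains `R(0)² + S(1)²`, which are the
squared pressure differences at the two ends. Integration in time therefore bounds the traces in
`L²(0, T)` (`integral_sq_pressureDrop_sub_le`). The Sobolev embedding (`exists_abs_pointVal_le`)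
bounds `δ` by the `H²` distance, which gives the Lipschitz estimate.

State bounds. The squared positive parts of the invariants minus affine barriers have nonincreasing
total integral (`IsClassicalSolution.riemann_le`). This uses that `a` is monotone and bounded on
`[-G, G]`, where `G` bounds the boundary data. The range of `u` does not enter, so the choice of the
interval is not circular.

Existence. The parameter is extended to `ℝ` (`AdmissibleOn.exists_extension`). After subtraction of
`c` and of the linear interpolation of the boundary data, the two invariants on `[0, 1]` unfold by
reflection into one `2`-periodic function `R` on `ℝ` with speed `1`, and both boundary conditions
become periodicity. The source of `R` jumps at the integers but is smooth in time, so the equation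
is solved for `V = ∂ₜR`: its integrals along characteristics are continuous, and a contraction in
exponentially weighted norms gives `V` (`exists_riemann_solution`). Then `R` is recovered as a time
integral and its spatial increments by Fubini (`timePrimitive_sub_eq`). The state bounds hold for
the extension, so the velocity stays where the extension equals `a` (`exists_isState`). -/

theorem HasWeakDeriv.mono {Ω Ω' : Set ℝ} {f f' : ℝ → ℝ} (hf : HasWeakDeriv Ω f f')
    (h : Ω' ⊆ Ω) : HasWeakDeriv Ω' f f' where
  locInt := hf.locInt.mono_set h
  locInt' := hf.locInt'.mono_set h
  parts φ h1 h2 h3 := by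
    have key : ∀ (ψ w : ℝ → ℝ), tsupport ψ ⊆ Ω' → ∫ x in Ω', w x * ψ x = ∫ x in Ω, w x * ψ x := by
      intro ψ w hψ
      rw [setIntegral_eq_integral_of_forall_compl_eq_zero,
        setIntegral_eq_integral_of_forall_compl_eq_zero]
      · intro x hx
        rw [image_eq_zero_of_notMem_tsupport (fun hc => hx (h (hψ hc))), mul_zero]
      · intro x hx
        rw [image_eq_zero_of_notMem_tsupport (fun hc => hx (hψ hc)), mul_zero]
    rw [key _ _ h3, key _ _ (tsupport_deriv_subset.trans h3)]
    exact hf.parts φ h1 h2 (h3.trans h)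

/-- Integration by parts holds for absolutely continuous functions; the boundary terms vanish
because the test function is supported strictly inside some `(-R, R)`. -/
theorem HasWeakDeriv.of_absolutelyContinuous {f f' : ℝ → ℝ}
    (hf : ∀ R : ℝ, AbsolutelyContinuousOnInterval f (-R) R) (hf' : deriv f =ᵐ[volume] f') :
    HasWeakDeriv univ f f' := by
  have exR : ∀ k : Set ℝ, IsCompact k → ∃ R : ℝ, 0 ≤ R ∧ k ⊆ Ioo (-R) R := by
    intro k hk
    obtain ⟨R, hR⟩ := hk.isBounded.subset_closedBall 0
    refine ⟨|R| + 1, by positivity, fun x hx => ?_⟩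
    have := hR hx
    rw [Metric.mem_closedBall, Real.dist_eq, sub_zero] at this
    have h2 := abs_le.1 (this.trans (le_abs_self R))
    exact ⟨by linarith [h2.1], by linarith [h2.2]⟩
  have hli : LocallyIntegrable f' := by
    rw [locallyIntegrable_iff]
    intro k hk
    obtain ⟨R, hR, hkR⟩ := exR k hk
    have := (hf R).intervalIntegrable_deriv
    rw [intervalIntegrable_iff_integrableOn_Ioc_of_le (by linarith)] at this
    exact (this.mono_set (hkR.trans Ioo_subset_Ioc_self)).congr (ae_restrict_of_ae hf')
  have hcont : Continuous f := by
    rw [continuous_iff_continuousAt]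
    intro x
    have := (hf (|x| + 1)).continuousOn
    refine this.continuousAt ?_
    rw [uIcc_of_le (by linarith [abs_nonneg x])]
    exact Icc_mem_nhds (by linarith [neg_abs_le x]) (by linarith [le_abs_self x])
  refine ⟨(hcont.locallyIntegrable).locallyIntegrableOn _, hli.locallyIntegrableOn _, ?_⟩
  intro φ h1 h2 h3
  obtain ⟨R, hR, hkR⟩ := exR _ h2
  have key : ∀ (ψ w : ℝ → ℝ), tsupport ψ ⊆ tsupport φ →
      ∫ x in univ, w x * ψ x = ∫ x in (-R)..R, w x * ψ x := by
    intro ψ w hψ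
    rw [setIntegral_univ, intervalIntegral.integral_eq_integral_of_support_subset]
    intro x hx
    refine Ioo_subset_Ioc_self <| hkR (hψ (subset_tsupport _ ?_))
    intro h
    exact hx (by simp [h])
  have hb : φ R = 0 ∧ φ (-R) = 0 := by
    constructor <;> by_contra h
    · exact lt_irrefl _ (hkR (subset_tsupport _ h)).2
    · exact lt_irrefl _ (hkR (subset_tsupport _ h)).1
  rw [key _ _ tsupport_deriv_subset, key _ _ subset_rfl,
    (hf R).integral_mul_deriv_eq_deriv_mul
      ((h1.of_le (by simp)).contDiffOn.absolutelyContinuousOnInterval), hb.1, hb.2]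
  simp only [mul_zero, sub_zero, zero_sub, neg_inj]
  refine intervalIntegral.integral_congr_ae ?_
  filter_upwards [hf'] with x hx _
  rw [hx]

theorem IsCompact.exists_subset_Icc_of_subset_Ioo {K : Set ℝ} (hK : IsCompact K) {α β : ℝ}
    (h : K ⊆ Ioo α β) (hαβ : α < β) :
    ∃ a b, α < a ∧ a < β ∧ α < b ∧ b < β ∧ K ⊆ Icc a b := by
  rcases K.eq_empty_or_nonempty with rfl | hne
  · exact ⟨(α + β) / 2, (α + β) / 2, by linarith, by linarith, by linarith, by linarith,
      empty_subset _⟩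
  · obtain ⟨a, ha, ha'⟩ := hK.exists_isLeast hne
    obtain ⟨b, hb, hb'⟩ := hK.exists_isGreatest hne
    exact ⟨a, b, (h ha).1, (h ha).2, (h hb).1, (h hb).2, fun x hx => ⟨ha' hx, hb' hx⟩⟩

/-- A test function on an interval with vanishing mean is the derivative of a test function. -/
theorem exists_primitive_testFunction {α β : ℝ} (hαβ : α < β) {η : ℝ → ℝ} (h1 : ContDiff ℝ ∞ η)
    (h2 : HasCompactSupport η) (h3 : tsupport η ⊆ Ioo α β) (h0 : ∫ x, η x = 0) :
    ∃ ζ : ℝ → ℝ, ContDiff ℝ ∞ ζ ∧ HasCompactSupport ζ ∧ tsupport ζ ⊆ Ioo α β ∧ deriv ζ = η := by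
  obtain ⟨a, b, ha, ha2, hb2, hb, hab⟩ := IsCompact.exists_subset_Icc_of_subset_Ioo h2 h3 hαβ
  have hz : ∀ x, x ∉ Icc a b → η x = 0 := fun x hx =>
    image_eq_zero_of_notMem_tsupport fun hc => hx (hab hc)
  have hd : ∀ x, HasDerivAt (fun x => ∫ t in α..x, η t) (η x) x := fun x =>
    intervalIntegral.integral_hasDerivAt_right (h1.continuous.intervalIntegrable _ _)
      (h1.continuous.stronglyMeasurableAtFilter _ _) h1.continuous.continuousAt
  have hde : deriv (fun x => ∫ t in α..x, η t) = η := funext fun x => (hd x).deriv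
  have hs : tsupport (fun x => ∫ t in α..x, η t) ⊆ Icc a b := by
    refine closure_minimal ?_ isClosed_Icc
    intro x hx
    by_contra hc
    apply hx
    rw [mem_Icc, not_and_or, not_le, not_le] at hc
    rcases hc with hc | hc
    · refine (intervalIntegral.integral_congr (g := fun _ => (0:ℝ)) ?_).trans (by simp)
      intro t ht
      refine hz t fun hm => ?_
      have := ht.2
      rcases max_choice α x with h | h <;> rw [h] at this <;> linarith [hm.1]
    · have e : ∫ t in α..x, η t = ∫ t, η t := by
        refine intervalIntegral.integral_eq_integral_of_support_subset ?_
        intro t ht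
        have : t ∈ Icc a b := by
          by_contra h
          exact ht (hz t h)
        exact ⟨by linarith [this.1], by linarith [this.2]⟩
      simp only [e, h0]
  refine ⟨_, ?_, isCompact_Icc.of_isClosed_subset (isClosed_tsupport _) hs,
    hs.trans fun x hx => ⟨ha.trans_le hx.1, hx.2.trans_lt hb⟩, hde⟩
  rw [contDiff_infty_iff_deriv, hde]
  exact ⟨fun x => (hd x).differentiableAt, h1⟩

/-- The du Bois-Reymond lemma: after subtraction of a multiple of a fixed bump of integral one,
every test function has mean zero and is the derivative of a test function. Hence `h` minus its mean
against the bump is orthogonal to all test functions. -/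
theorem HasWeakDeriv.ae_eq_const {α β : ℝ} (hαβ : α < β) {h : ℝ → ℝ}
    (hh : HasWeakDeriv (Ioo α β) h 0) :
    ∃ C : ℝ, ∀ᵐ x ∂(volume.restrict (Ioo α β)), h x = C := by
  let c := (α + β) / 2
  let B : ContDiffBump c := ⟨(β - α) / 8, (β - α) / 4, by linarith, by linarith⟩
  set φ₀ : ℝ → ℝ := B.normed volume with hφ₀
  have b1 : ContDiff ℝ ∞ φ₀ := B.contDiff_normed
  have b2 : HasCompactSupport φ₀ := B.hasCompactSupport_normed
  have b3 : tsupport φ₀ ⊆ Ioo α β := by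
    rw [hφ₀, B.tsupport_normed_eq, Real.closedBall_eq_Icc]
    intro x hx
    simp only [c, B, mem_Icc] at hx
    exact ⟨by linarith [hx.1], by linarith [hx.2]⟩
  have b4 : ∫ x, φ₀ x = 1 := B.integral_normed
  refine ⟨∫ x in Ioo α β, h x * φ₀ x, ?_⟩
  set C := ∫ x in Ioo α β, h x * φ₀ x with hC
  have hli : LocallyIntegrableOn (fun x => h x - C) (Ioo α β) :=
    hh.locInt.sub ((continuous_const.locallyIntegrable).locallyIntegrableOn _)
  have := isOpen_Ioo.ae_eq_zero_of_integral_contDiff_smul_eq_zero hli ?_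
  · rw [ae_restrict_iff' measurableSet_Ioo]
    filter_upwards [this] with x hx hm
    linarith [hx hm]
  intro ψ h1 h2 h3
  set m := ∫ x, ψ x with hm
  have i1 : Integrable ψ := h1.continuous.integrable_of_hasCompactSupport h2
  have i0 : Integrable φ₀ := b1.continuous.integrable_of_hasCompactSupport b2
  have hsup : tsupport (fun x => ψ x - m * φ₀ x) ⊆ tsupport ψ ∪ tsupport φ₀ := by
    refine closure_minimal ?_ ((isClosed_tsupport _).union (isClosed_tsupport _))
    intro x hx
    by_contra hc
    rw [mem_union, not_or] at hc
    exact hx (by simp [image_eq_zero_of_notMem_tsupport hc.1,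
      image_eq_zero_of_notMem_tsupport hc.2])
  obtain ⟨ζ, z1, z2, z3, z4⟩ := exists_primitive_testFunction hαβ
    (η := fun x => ψ x - m * φ₀ x) (h1.sub (contDiff_const.mul b1))
    ((IsCompact.union h2 b2).of_isClosed_subset (isClosed_tsupport _) hsup)
    (hsup.trans (union_subset h3 b3))
    (by rw [integral_sub i1 (i0.const_mul _), integral_const_mul, b4, mul_one, sub_self])
  have hp := hh.parts ζ z1 z2 z3
  rw [z4] at hp
  simp only [Pi.zero_apply, zero_mul, integral_zero, neg_zero] at hp
  have j1 := integrable_mul_test hh.locInt h1.continuous h2 h3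
  have j0 := integrable_mul_test hh.locInt b1.continuous b2 b3
  have e1 : ∫ x in Ioo α β, h x * (ψ x - m * φ₀ x) = (∫ x in Ioo α β, h x * ψ x) - m * C := by
    rw [hC, ← integral_const_mul, ← integral_sub j1 (j0.const_mul _)]
    congr 1; ext x; ring
  have e2 : ∫ x in Ioo α β, ψ x = m := by
    rw [hm]
    refine setIntegral_eq_integral_of_forall_compl_eq_zero fun x hx => ?_
    exact image_eq_zero_of_notMem_tsupport fun hc => hx (h3 hc)
  have e3 : ∫ x, ψ x • (h x - C) = ∫ x in Ioo α β, ψ x • (h x - C) := by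
    refine (setIntegral_eq_integral_of_forall_compl_eq_zero fun x hx => ?_).symm
    rw [image_eq_zero_of_notMem_tsupport fun hc => hx (h3 hc), zero_smul]
  rw [e3]
  have e4 : ∫ x in Ioo α β, ψ x • (h x - C) = (∫ x in Ioo α β, h x * ψ x) - C * m := by
    rw [← e2, ← integral_const_mul, ← integral_sub j1 (i1.restrict.const_mul _)]
    congr 1; ext x; simp only [smul_eq_mul]; ring
  rw [e4]
  linarith

/-- A primitive of an integrable function has this function as its weak derivative. -/
theorem hasWeakDeriv_primitive {α β : ℝ} {f' : ℝ → ℝ}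
    (hf' : IntegrableOn f' (Ioo α β)) (C : ℝ) :
    HasWeakDeriv (Ioo α β) (fun x => C + ∫ t in α..x, f' t) f' := by
  -- Extension by zero makes the primitive absolutely continuous on every bounded interval, so the
  -- statement on the whole line applies and is then restricted.
  set g := (Ioo α β).indicator f' with hg
  have hgi : Integrable g := hf'.integrable_indicator measurableSet_Ioo
  have hw : HasWeakDeriv univ (fun x => C + ∫ t in α..x, g t) g := by
    refine HasWeakDeriv.of_absolutelyContinuous (fun R => ?_) ?_
    · have h1 : AbsolutelyContinuousOnInterval (fun _ : ℝ => C) (-R) R :=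
        contDiff_const.contDiffOn.absolutelyContinuousOnInterval
      have h2 : AbsolutelyContinuousOnInterval (fun x => ∫ t in α..x, g t) (-R) R := by
        have h3 : AbsolutelyContinuousOnInterval (fun x => ∫ t in (-R)..x, g t) (-R) R :=
          hgi.intervalIntegrable.absolutelyContinuousOnInterval_intervalIntegral (by simp)
        have h4 : AbsolutelyContinuousOnInterval (fun _ : ℝ => ∫ t in α..(-R), g t) (-R) R :=
          contDiff_const.contDiffOn.absolutelyContinuousOnInterval
        have e : (fun x => ∫ t in α..x, g t)
            = (fun _ => ∫ t in α..(-R), g t) + fun x => ∫ t in (-R)..x, g t := by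
          ext x
          exact (intervalIntegral.integral_add_adjacent_intervals
            hgi.intervalIntegrable hgi.intervalIntegrable).symm
        rw [e]
        exact h4.add h3
      exact h1.add h2
    · filter_upwards [LocallyIntegrable.ae_hasDerivAt_integral hgi.locallyIntegrable] with x hx
      exact ((hx α).const_add C).deriv
  refine (hw.mono (subset_univ _)).congr_ae isOpen_Ioo ?_ ?_
  · filter_upwards [ae_restrict_mem measurableSet_Ioo] with x hx
    congr 1
    refine intervalIntegral.integral_congr_ae ?_
    filter_upwards [] with t ht
    rw [uIoc_of_le hx.1.le] at ht
    have hm : t ∈ Ioo α β := ⟨ht.1, ht.2.trans_lt hx.2⟩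
    exact indicator_of_mem hm _
  · filter_upwards [ae_restrict_mem measurableSet_Ioo] with x hx
    exact indicator_of_mem hx _

theorem HasWeakDeriv.ae_eq_primitive {α β : ℝ} (hαβ : α < β) {f f' : ℝ → ℝ}
    (hf : HasWeakDeriv (Ioo α β) f f') (hf' : IntegrableOn f' (Ioo α β)) :
    ∃ C : ℝ, f =ᵐ[volume.restrict (Ioo α β)] fun x => C + ∫ t in α..x, f' t := by
  have h1 := hf.add ((hasWeakDeriv_primitive hf' 0).smul (-1))
  have h2 : HasWeakDeriv (Ioo α β) (f + (-1 : ℝ) • fun x => 0 + ∫ t in α..x, f' t) 0 :=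
    h1.congr_ae isOpen_Ioo (ae_eq_refl _) (by
      filter_upwards [] with x
      simp)
  obtain ⟨C, hC⟩ := h2.ae_eq_const hαβ
  refine ⟨C, hC.mono fun x hx => ?_⟩
  simp only [Pi.add_apply, Pi.smul_apply, smul_eq_mul] at hx
  linarith

theorem ae_restrict_Ioo_eq_Icc_of_continuousOn {α β : ℝ} (hαβ : α < β) {f g : ℝ → ℝ}
    (hf : ContinuousOn f (Icc α β)) (hg : ContinuousOn g (Icc α β))
    (h : f =ᵐ[volume.restrict (Ioo α β)] g) : EqOn f g (Icc α β) := by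
  rw [Measure.restrict_congr_set Ioo_ae_eq_Icc] at h
  exact Measure.eqOn_Icc_of_ae_eq volume hαβ.ne h hf hg

theorem continuousOn_primitive_Icc {α β : ℝ} (hαβ : α ≤ β) {f' : ℝ → ℝ}
    (hf' : IntegrableOn f' (Ioo α β)) (C : ℝ) :
    ContinuousOn (fun x => C + ∫ t in α..x, f' t) (Icc α β) := by
  refine continuousOn_const.add ?_
  have : IntegrableOn f' (Icc α β) := by
    rwa [integrableOn_Icc_iff_integrableOn_Ioo]
  have h := intervalIntegral.continuousOn_primitive_interval (a := α) (b := β) (f := f')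
    (μ := volume) (by rwa [uIcc_of_le hαβ])
  rwa [uIcc_of_le hαβ] at h

theorem HasWeakDeriv.eq_primitive {α β : ℝ} (hαβ : α < β) {f f' : ℝ → ℝ}
    (hf : HasWeakDeriv (Ioo α β) f f') (hf' : IntegrableOn f' (Ioo α β))
    (hc : ContinuousOn f (Icc α β)) :
    ∀ x ∈ Icc α β, f x = f α + ∫ t in α..x, f' t := by
  obtain ⟨C, hC⟩ := hf.ae_eq_primitive hαβ hf'
  have := ae_restrict_Ioo_eq_Icc_of_continuousOn hαβ hc
    (continuousOn_primitive_Icc hαβ.le hf' C) hC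
  intro x hx
  rw [this hx, this (left_mem_Icc.2 hαβ.le)]
  simp

end

/-! ### Sobolev functions: continuous representatives, point values, traces. -/

noncomputable section

theorem L2.integrableOn {α β : ℝ} (f : L2 α β) : IntegrableOn f (Ioo α β) :=
  (Lp.memLp f).integrable one_le_two

/-- Cauchy–Schwarz against the constant function `1`. -/
theorem L2.exists_integral_abs_le (α β : ℝ) :
    ∃ K : ℝ, 0 ≤ K ∧ ∀ f : L2 α β, ∫ x in Ioo α β, |f x| ≤ K * ‖f‖ := by
  have h1 : MemLp (fun _ : ℝ => (1 : ℝ)) 2 (volume.restrict (Ioo α β)) := memLp_const 1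
  refine ⟨‖h1.toLp _‖, norm_nonneg _, fun f => ?_⟩
  have e : ∫ x in Ioo α β, |f x| = inner ℝ (h1.toLp _) |f| := by
    rw [MeasureTheory.L2.inner_def]
    refine integral_congr_ae ?_
    filter_upwards [h1.coeFn_toLp, Lp.coeFn_abs f] with x hx hx2
    rw [hx, hx2]
    simp
  rw [e, ← norm_abs_eq_norm f]
  exact real_inner_le_norm _ _

section SobolevH

variable {k : ℕ} {α β : ℝ}

theorem weakD_add (v w : SobolevH k α β) (i : Fin (k + 1)) :
    weakD (v + w) i = weakD v i + weakD w i := rfl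

theorem weakD_sub (v w : SobolevH k α β) (i : Fin (k + 1)) :
    weakD (v - w) i = weakD v i - weakD w i := rfl

theorem weakD_neg (v : SobolevH k α β) (i : Fin (k + 1)) : weakD (-v) i = -weakD v i := rfl

theorem norm_weakD_le (v : SobolevH k α β) (i : Fin (k + 1)) : ‖weakD v i‖ ≤ ‖v‖ :=
  PiLp.norm_apply_le (p := 2) v.1 i

theorem hasWeakDeriv_weakD (v : SobolevH (k + 1) α β) :
    HasWeakDeriv (Ioo α β) (weakD v 0) (weakD v 1) := v.2 0

/-- This shows that `pointVal` never takes its default branch for `H¹` and beyond. -/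
theorem exists_continuousOn_rep (hαβ : α < β) (v : SobolevH (k + 1) α β) :
    ∃ f : ℝ → ℝ, ContinuousOn f (Icc α β) ∧ weakD v 0 =ᵐ[volume.restrict (Ioo α β)] f := by
  obtain ⟨C, hC⟩ := (hasWeakDeriv_weakD v).ae_eq_primitive hαβ (L2.integrableOn _)
  exact ⟨_, continuousOn_primitive_Icc hαβ.le (L2.integrableOn _) C, hC⟩

theorem continuousOn_pointVal (hαβ : α < β) (v : SobolevH (k + 1) α β) :
    ContinuousOn (pointVal v) (Icc α β) := by
  have h := exists_continuousOn_rep hαβ v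
  rw [pointVal, dif_pos h]
  exact h.choose_spec.1

theorem weakD_zero_ae_eq_pointVal (hαβ : α < β) (v : SobolevH (k + 1) α β) :
    weakD v 0 =ᵐ[volume.restrict (Ioo α β)] pointVal v := by
  have h := exists_continuousOn_rep hαβ v
  rw [pointVal, dif_pos h]
  exact h.choose_spec.2

theorem pointVal_eqOn (hαβ : α < β) (v : SobolevH (k + 1) α β) {f : ℝ → ℝ}
    (hf : ContinuousOn f (Icc α β)) (h : weakD v 0 =ᵐ[volume.restrict (Ioo α β)] f) :
    EqOn (pointVal v) f (Icc α β) :=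
  ae_restrict_Ioo_eq_Icc_of_continuousOn hαβ (continuousOn_pointVal hαβ v) hf
    ((weakD_zero_ae_eq_pointVal hαβ v).symm.trans h)

theorem hasWeakDeriv_pointVal (hαβ : α < β) (v : SobolevH (k + 1) α β) :
    HasWeakDeriv (Ioo α β) (pointVal v) (weakD v 1) :=
  (hasWeakDeriv_weakD v).congr_ae isOpen_Ioo (weakD_zero_ae_eq_pointVal hαβ v) (ae_eq_refl _)

theorem pointVal_eq_primitive (hαβ : α < β) (v : SobolevH (k + 1) α β) :
    ∀ x ∈ Icc α β, pointVal v x = pointVal v α + ∫ t in α..x, weakD v 1 t :=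
  (hasWeakDeriv_pointVal hαβ v).eq_primitive hαβ (L2.integrableOn _)
    (continuousOn_pointVal hαβ v)

theorem pointVal_add (hαβ : α < β) (v w : SobolevH (k + 1) α β) :
    EqOn (pointVal (v + w)) (fun x => pointVal v x + pointVal w x) (Icc α β) := by
  refine pointVal_eqOn hαβ _ ((continuousOn_pointVal hαβ v).add (continuousOn_pointVal hαβ w)) ?_
  rw [weakD_add]
  filter_upwards [Lp.coeFn_add (weakD v 0) (weakD w 0), weakD_zero_ae_eq_pointVal hαβ v,
    weakD_zero_ae_eq_pointVal hαβ w] with x h1 h2 h3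
  rw [h1, Pi.add_apply, h2, h3]

theorem pointVal_sub (hαβ : α < β) (v w : SobolevH (k + 1) α β) :
    EqOn (pointVal (v - w)) (fun x => pointVal v x - pointVal w x) (Icc α β) := by
  refine pointVal_eqOn hαβ _ ((continuousOn_pointVal hαβ v).sub (continuousOn_pointVal hαβ w)) ?_
  rw [weakD_sub]
  filter_upwards [Lp.coeFn_sub (weakD v 0) (weakD w 0), weakD_zero_ae_eq_pointVal hαβ v,
    weakD_zero_ae_eq_pointVal hαβ w] with x h1 h2 h3
  rw [h1, Pi.sub_apply, h2, h3]

theorem pointVal_neg (hαβ : α < β) (v : SobolevH (k + 1) α β) :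
    EqOn (pointVal (-v)) (fun x => -pointVal v x) (Icc α β) := by
  refine pointVal_eqOn hαβ _ (continuousOn_pointVal hαβ v).neg ?_
  rw [weakD_neg]
  filter_upwards [Lp.coeFn_neg (weakD v 0), weakD_zero_ae_eq_pointVal hαβ v] with x h1 h2
  rw [h1, Pi.neg_apply, h2]

/-- The Sobolev embedding into continuous functions: `|v x|` exceeds `|v y|` by at most the integral
of `|v'|`, and averaging over `y` replaces `|v y|` by an `L¹` norm. -/
theorem exists_abs_pointVal_le (k : ℕ) (hαβ : α < β) :
    ∃ K : ℝ, 0 ≤ K ∧ ∀ v : SobolevH (k + 1) α β, ∀ x ∈ Icc α β, |pointVal v x| ≤ K * ‖v‖ := by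
  obtain ⟨K, hK, hKf⟩ := L2.exists_integral_abs_le α β
  have hd : 0 < β - α := by linarith
  refine ⟨(β - α)⁻¹ * K + K, by positivity, fun v x hx => ?_⟩
  have hi1 : IntegrableOn (weakD v 1) (Ioo α β) := L2.integrableOn _
  have key : ∀ y ∈ Ioo α β, |pointVal v x| ≤ |pointVal v y| + ∫ t in Ioo α β, |weakD v 1 t| := by
    intro y hy
    have hy' := Ioo_subset_Icc_self hy
    have ii : ∀ z ∈ Icc α β, IntervalIntegrable (weakD v 1) volume α z := by
      intro z hz
      rw [intervalIntegrable_iff_integrableOn_Ioo_of_le hz.1]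
      exact hi1.mono_set (Ioo_subset_Ioo_right hz.2)
    have e : pointVal v x - pointVal v y = ∫ t in y..x, weakD v 1 t := by
      rw [pointVal_eq_primitive hαβ v x hx, pointVal_eq_primitive hαβ v y hy',
        ← intervalIntegral.integral_interval_sub_left (ii x hx) (ii y hy')]
      ring
    have h2 : |∫ t in y..x, weakD v 1 t| ≤ ∫ t in Ioo α β, |weakD v 1 t| := by
      have h3 := intervalIntegral.norm_integral_le_integral_norm_uIoc
        (f := weakD v 1) (a := y) (b := x) (μ := volume)
      refine h3.trans ?_
      rw [← integral_Icc_eq_integral_Ioo]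
      refine setIntegral_mono_set ?_ ?_ ?_
      · exact ((integrableOn_Icc_iff_integrableOn_Ioo).2 hi1).norm
      · exact Filter.Eventually.of_forall fun _ => abs_nonneg _
      · refine LE.le.eventuallyLE ?_
        exact uIoc_subset_uIcc.trans (uIcc_subset_Icc hy' hx)
    rw [← e] at h2
    have := abs_sub_abs_le_abs_sub (pointVal v x) (pointVal v y)
    linarith
  have hpi : IntegrableOn (fun y => |pointVal v y|) (Ioo α β) := by
    refine ((L2.integrableOn (weakD v 0)).abs).congr ?_
    filter_upwards [weakD_zero_ae_eq_pointVal hαβ v] with y hy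
    rw [hy]
  have h0 : ∫ y in Ioo α β, |pointVal v y| = ∫ y in Ioo α β, |weakD v 0 y| := by
    refine integral_congr_ae ?_
    filter_upwards [weakD_zero_ae_eq_pointVal hαβ v] with y hy
    rw [hy]
  have hm := setIntegral_mono_on (μ := volume) (s := Ioo α β) (f := fun _ => |pointVal v x|)
    (integrableOn_const (by simp)) (hpi.add (integrableOn_const (by simp))) measurableSet_Ioo key
  have hvol : (volume : Measure ℝ).real (Ioo α β) = β - α := by
    simp [Measure.real, hαβ.le]
  simp only [Pi.add_apply] at hm
  rw [integral_add hpi (integrableOn_const (by simp))] at hm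
  simp only [setIntegral_const, hvol, smul_eq_mul] at hm
  have a0 := (hKf (weakD v 0)).trans (mul_le_mul_of_nonneg_left (norm_weakD_le v 0) hK)
  have a1 := (hKf (weakD v 1)).trans (mul_le_mul_of_nonneg_left (norm_weakD_le v 1) hK)
  rw [h0] at hm
  have a2 : (β - α) * |pointVal v x| ≤ K * ‖v‖ + (β - α) * (K * ‖v‖) := by
    have := mul_le_mul_of_nonneg_left a1 hd.le
    linarith
  calc |pointVal v x| = (β - α)⁻¹ * ((β - α) * |pointVal v x|) := by field_simp
    _ ≤ (β - α)⁻¹ * (K * ‖v‖ + (β - α) * (K * ‖v‖)) := by gcongr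
    _ = ((β - α)⁻¹ * K + K) * ‖v‖ := by field_simp

theorem continuousOn_trace (hαβ : α < β) {s : Set ℝ} {p : ℝ → SobolevH (k + 1) α β}
    (hp : ContinuousOn p s) {x : ℝ} (hx : x ∈ Icc α β) :
    ContinuousOn (fun t => pointVal (p t) x) s := by
  obtain ⟨K, hK, h⟩ := exists_abs_pointVal_le (α := α) (β := β) k hαβ
  have hl : LipschitzWith ⟨K, hK⟩ fun v : SobolevH (k + 1) α β => pointVal v x := by
    refine LipschitzWith.of_dist_le_mul fun v w => ?_
    rw [Real.dist_eq, dist_eq_norm]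
    have := h (v - w) x hx
    rwa [pointVal_sub hαβ v w hx] at this
  exact hl.continuous.comp_continuousOn hp

theorem HasWeakDeriv.ae_eq_zero {Ω : Set ℝ} (hΩ : IsOpen Ω) {f' : ℝ → ℝ}
    (h : HasWeakDeriv Ω 0 f') : f' =ᵐ[volume.restrict Ω] 0 := by
  have := hΩ.ae_eq_zero_of_integral_contDiff_smul_eq_zero h.locInt' (μ := volume) ?_
  · rw [Filter.EventuallyEq, ae_restrict_iff' hΩ.measurableSet]
    exact this
  · intro φ h1 h2 h3
    have e := h.parts φ h1 h2 h3
    simp only [Pi.zero_apply, zero_mul, integral_zero] at e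
    have e3 : ∫ x, φ x • f' x = ∫ x in Ω, φ x • f' x := by
      refine (setIntegral_eq_integral_of_forall_compl_eq_zero fun x hx => ?_).symm
      rw [image_eq_zero_of_notMem_tsupport fun hc => hx (h3 hc), zero_smul]
    rw [e3]
    simp only [smul_eq_mul, mul_comm (φ _)]
    linarith

/-- Weak derivatives are unique, so an `L²` identity between states upgrades to an identity in `H¹`.
-/
theorem SobolevH.ext_weakD_zero {v w : SobolevH 1 α β} (h : weakD v 0 = weakD w 0) : v = w := by
  have h0 : weakD (v - w) 0 = 0 := by rw [weakD_sub, h, sub_self]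
  have h1 : weakD (v - w) 1 = 0 := by
    have := hasWeakDeriv_weakD (v - w)
    rw [h0] at this
    have := (this.congr_ae isOpen_Ioo (Lp.coeFn_zero _ _ _) (ae_eq_refl _)).ae_eq_zero isOpen_Ioo
    exact Lp.ext (this.trans (Lp.coeFn_zero _ _ _).symm)
  rw [← sub_eq_zero]
  apply Subtype.ext
  ext1 i
  fin_cases i
  · exact h0
  · exact h1

/-- The element of `H¹(α, β)` with given value and weak derivative. -/
def SobolevH.ofPair (f f' : L2 α β) (h : HasWeakDeriv (Ioo α β) f f') : SobolevH 1 α β :=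
  ⟨WithLp.toLp 2 ![f, f'], fun i => by
    fin_cases i
    exact h⟩

theorem SobolevH.continuous_ofPair {X : Type*} [TopologicalSpace X] {f f' : X → L2 α β}
    (hf : Continuous f) (hf' : Continuous f')
    (h : ∀ t, HasWeakDeriv (Ioo α β) (f t) (f' t)) :
    Continuous fun t => ofPair (f t) (f' t) (h t) := by
  refine Continuous.subtype_mk ((PiLp.continuous_toLp 2 _).comp (continuous_pi fun i => ?_)) _
  fin_cases i
  · exact hf
  · exact hf'

end SobolevH

end

/-! ### Chain rule and weighted energies in `L²`. -/

noncomputable section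

theorem LipschitzOnWith.comp_absolutelyContinuousOnInterval {f φ : ℝ → ℝ} {K : ℝ≥0} {a b : ℝ}
    {s : Set ℝ} (hφ : LipschitzOnWith K φ s) (hf : AbsolutelyContinuousOnInterval f a b)
    (hs : MapsTo f (uIcc a b) s) : AbsolutelyContinuousOnInterval (φ ∘ f) a b := by
  rw [absolutelyContinuousOnInterval_iff] at hf ⊢
  intro ε hε
  -- Dividing by `K + 1` instead of `K` also covers `K = 0`.
  obtain ⟨δ, hδ, h⟩ := hf (ε / (K + 1)) (by positivity)
  refine ⟨δ, hδ, fun E hE hE2 => ?_⟩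
  have h1 := h E hE hE2
  calc ∑ i ∈ Finset.range E.1, dist ((φ ∘ f) (E.2 i).1) ((φ ∘ f) (E.2 i).2)
      ≤ ∑ i ∈ Finset.range E.1, K * dist (f (E.2 i).1) (f (E.2 i).2) := by
        refine Finset.sum_le_sum fun i hi => ?_
        have hm := hE.1 i hi
        exact hφ.dist_le_mul _ (hs hm.1) _ (hs hm.2)
    _ = K * ∑ i ∈ Finset.range E.1, dist (f (E.2 i).1) (f (E.2 i).2) := by
        rw [Finset.mul_sum]
    _ ≤ K * (ε / (K + 1)) := by gcongr
    _ < (K + 1) * (ε / (K + 1)) := by gcongr; linarith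
    _ = ε := by field_simp

theorem ContDiff.comp_absolutelyContinuousOnInterval {f φ : ℝ → ℝ} {a b : ℝ}
    (hφ : ContDiff ℝ 1 φ) (hf : AbsolutelyContinuousOnInterval f a b) :
    AbsolutelyContinuousOnInterval (φ ∘ f) a b := by
  obtain ⟨C, hC⟩ := hf.exists_bound
  obtain ⟨K, hK⟩ := (hφ.contDiffOn (s := Icc (-C) C)).exists_lipschitzOnWith (by decide)
    (convex_Icc _ _) isCompact_Icc
  exact hK.comp_absolutelyContinuousOnInterval hf fun x hx => abs_le.1 (hC x hx)

/-- The product `m * φ(f)` is absolutely continuous, so its derivative integrates to the boundary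
difference. This produces the boundary terms of all energy identities. -/
theorem integral_deriv_weight_mul_comp {α β : ℝ} (hαβ : α ≤ β) {m φ f f' : ℝ → ℝ}
    (hm : ContDiff ℝ 1 m) (hφ : ContDiff ℝ 1 φ) (hf' : IntegrableOn f' (Ioo α β))
    (hf : ∀ x ∈ Icc α β, f x = f α + ∫ t in α..x, f' t) :
    ∫ x in Ioo α β, (deriv m x * φ (f x) + m x * (deriv φ (f x) * f' x)) =
      m β * φ (f β) - m α * φ (f α) := by
  -- The function `f` agrees with this primitive on `[α, β]` only, while derivatives depend on full
  -- neighbourhoods; the calculus is done for the primitive.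
  set g : ℝ → ℝ := fun x => f α + ∫ t in α..x, f' t with hg
  have hi : IntervalIntegrable f' volume α β := by
    rwa [intervalIntegrable_iff_integrableOn_Ioo_of_le hαβ]
  have hac : AbsolutelyContinuousOnInterval g α β :=
    (contDiff_const (c := f α)).contDiffOn.absolutelyContinuousOnInterval.add
      (hi.absolutelyContinuousOnInterval_intervalIntegral (by simp))
  have hφg := hφ.comp_absolutelyContinuousOnInterval hac
  have hmac : AbsolutelyContinuousOnInterval m α β :=
    hm.contDiffOn.absolutelyContinuousOnInterval
  have hgd : ∀ᵐ x, x ∈ uIcc α β → HasDerivAt g (f' x) x := by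
    filter_upwards [hi.ae_hasDerivAt_integral] with x hx hm
    exact (hx hm α (by simp)).const_add _
  rw [hf β (right_mem_Icc.2 hαβ), show f α = g α by simp [hg]]
  have := hmac.integral_deriv_mul_eq_sub hφg
  simp only [Function.comp_apply] at this
  rw [← show g β = g α + ∫ t in α..β, f' t by simp [hg], ← this,
    intervalIntegral.integral_of_le hαβ, ← integral_Ioc_eq_integral_Ioo]
  refine setIntegral_congr_ae measurableSet_Ioc ?_
  filter_upwards [hgd] with x hx hxm
  have hxI : x ∈ Icc α β := Ioc_subset_Icc_self hxm
  have h1 := hx (by rwa [uIcc_of_le hαβ])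
  have h2 : HasDerivAt (φ ∘ g) (deriv φ (g x) * f' x) x :=
    ((hφ.differentiable (by simp)) (g x)).hasDerivAt.comp x h1
  rw [h2.deriv, hf x hxI]

/-- `φ` is `C¹` with `φ'(0) = 0` and its second order Taylor remainder is at most quadratic. -/
structure IsQuadraticLike (φ : ℝ → ℝ) : Prop where
  contDiff : ContDiff ℝ 1 φ
  zero : φ 0 = 0
  deriv_le : ∀ z, |deriv φ z| ≤ 2 * |z|
  taylor : ∀ z k, |φ (z + k) - φ z - deriv φ z * k| ≤ k ^ 2

theorem isQuadraticLike_sq : IsQuadraticLike fun z => z ^ 2 where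
  contDiff := contDiff_id.pow 2
  zero := by simp
  deriv_le z := by simp [abs_mul]
  taylor z k := by
    simp only [differentiableAt_fun_id, deriv_fun_pow, Nat.cast_ofNat, Nat.add_one_sub_one,
      pow_one, deriv_id'', mul_one]
    rw [show (z + k) ^ 2 - z ^ 2 - 2 * z * k = k ^ 2 by ring, abs_of_nonneg (sq_nonneg k)]

/-- Checking the four sign patterns of `z` and `z + k` bounds the Taylor remainder by `k²`, which
also covers the kink of `max z 0` at the origin. -/
theorem hasDerivAt_posPart_sq (z : ℝ) :
    HasDerivAt (fun z : ℝ => (max z 0) ^ 2) (2 * max z 0) z := by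
  have key : ∀ k : ℝ, |(max (z + k) 0) ^ 2 - (max z 0) ^ 2 - 2 * max z 0 * k| ≤ k ^ 2 := by
    intro k
    rw [abs_le]
    rcases max_cases (z + k) 0 with ⟨h1, h2⟩ | ⟨h1, h2⟩ <;>
      rcases max_cases z 0 with ⟨h3, h4⟩ | ⟨h3, h4⟩ <;> rw [h1, h3] <;>
      constructor <;> nlinarith
  rw [hasDerivAt_iff_isLittleO_nhds_zero]
  refine Asymptotics.IsBigO.trans_isLittleO (g := fun k : ℝ => k ^ 2) ?_ ?_
  · refine Asymptotics.IsBigO.of_bound 1 (Filter.Eventually.of_forall fun k => ?_)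
    have := key k
    simp only [smul_eq_mul, Real.norm_eq_abs, one_mul, abs_pow, sq_abs]
    rwa [mul_comm k]
  · simpa using Asymptotics.isLittleO_pow_pow (𝕜 := ℝ) (m := 1) (n := 2) (by norm_num)

theorem deriv_posPart_sq (z : ℝ) : deriv (fun z : ℝ => (max z 0) ^ 2) z = 2 * max z 0 :=
  (hasDerivAt_posPart_sq z).deriv

theorem isQuadraticLike_posPart_sq : IsQuadraticLike fun z => (max z 0) ^ 2 where
  contDiff := by
    rw [contDiff_one_iff_deriv]
    refine ⟨fun z => (hasDerivAt_posPart_sq z).differentiableAt, ?_⟩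
    rw [funext deriv_posPart_sq]
    fun_prop
  zero := by simp
  deriv_le z := by
    rw [deriv_posPart_sq, abs_mul, abs_two]
    have : |max z 0| ≤ |z| := by
      rw [abs_of_nonneg (le_max_right _ _)]
      exact max_le (le_abs_self z) (abs_nonneg z)
    linarith
  taylor z k := by
    rw [deriv_posPart_sq, abs_le]
    rcases max_cases (z + k) 0 with ⟨h1, h2⟩ | ⟨h1, h2⟩ <;>
      rcases max_cases z 0 with ⟨h3, h4⟩ | ⟨h3, h4⟩ <;> rw [h1, h3] <;>
      constructor <;> nlinarith

section Functional

variable {α β : ℝ} {m φ : ℝ → ℝ}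

theorem L2.integrableOn_sq (f : L2 α β) : IntegrableOn (fun x => f x ^ 2) (Ioo α β) :=
  (Lp.memLp f).integrable_sq

theorem L2.integral_sq (f : L2 α β) : ∫ x in Ioo α β, f x ^ 2 = ‖f‖ ^ 2 := by
  rw [← real_inner_self_eq_norm_sq, MeasureTheory.L2.inner_def]
  refine integral_congr_ae (Filter.Eventually.of_forall fun x => ?_)
  simp [sq]

theorem Continuous.exists_abs_le_Ioo (hm : Continuous m) (α β : ℝ) :
    ∃ C : ℝ, 0 ≤ C ∧ ∀ x ∈ Ioo α β, |m x| ≤ C := by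
  obtain ⟨C, hC⟩ := isCompact_Icc.exists_bound_of_continuousOn (s := Icc α β) hm.continuousOn
  exact ⟨|C|, abs_nonneg C, fun x hx => (hC x (Ioo_subset_Icc_self hx)).trans (le_abs_self C)⟩

theorem IsQuadraticLike.abs_le (hφ : IsQuadraticLike φ) (z : ℝ) : |φ z| ≤ z ^ 2 := by
  have h0 : deriv φ 0 = 0 := by
    have := hφ.deriv_le 0
    simpa using this
  have := hφ.taylor 0 z
  simpa [h0, hφ.zero] using this

theorem IsQuadraticLike.integrableOn (hφ : IsQuadraticLike φ) (hm : Continuous m) (f : L2 α β) :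
    IntegrableOn (fun x => m x * φ (f x)) (Ioo α β) := by
  obtain ⟨C, hC, hCm⟩ := hm.exists_abs_le_Ioo α β
  refine Integrable.mono' ((L2.integrableOn_sq f).const_mul C) ?_ ?_
  · exact hm.aestronglyMeasurable.mul
      (hφ.contDiff.continuous.comp_aestronglyMeasurable (Lp.aestronglyMeasurable f))
  · filter_upwards [ae_restrict_mem measurableSet_Ioo] with x hx
    rw [Real.norm_eq_abs, abs_mul]
    exact mul_le_mul (hCm x hx) (hφ.abs_le _) (abs_nonneg _) hC

theorem IsQuadraticLike.memLp_deriv (hφ : IsQuadraticLike φ) (hm : Continuous m) (f : L2 α β) :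
    MemLp (fun x => m x * deriv φ (f x)) 2 (volume.restrict (Ioo α β)) := by
  obtain ⟨C, hC, hCm⟩ := hm.exists_abs_le_Ioo α β
  refine (Lp.memLp f).of_le_mul (c := C * 2) ?_ ?_
  · exact hm.aestronglyMeasurable.mul ((hφ.contDiff.continuous_deriv le_rfl).comp_aestronglyMeasurable
      (Lp.aestronglyMeasurable f))
  · filter_upwards [ae_restrict_mem measurableSet_Ioo] with x hx
    rw [Real.norm_eq_abs, abs_mul, Real.norm_eq_abs, mul_assoc]
    exact mul_le_mul (hCm x hx) (hφ.deriv_le _) (abs_nonneg _) hC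

/-- The pointwise remainder is at most `C k²`, whose integral is `C ‖k‖²`, hence `o(‖k‖)`.
Differentiability on `L²` itself matters because the time derivative of a state exists only as an
`L²` limit. -/
theorem IsQuadraticLike.hasFDerivAt (hφ : IsQuadraticLike φ) (hm : Continuous m) (f : L2 α β) :
    HasFDerivAt (fun g : L2 α β => ∫ x in Ioo α β, m x * φ (g x))
      (innerSL ℝ ((hφ.memLp_deriv hm f).toLp _)) f := by
  obtain ⟨C, hC, hCm⟩ := hm.exists_abs_le_Ioo α β
  rw [hasFDerivAt_iff_isLittleO_nhds_zero]
  refine Asymptotics.IsBigO.trans_isLittleO (g := fun k : L2 α β => ‖k‖ ^ 2) ?_ ?_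
  · refine Asymptotics.IsBigO.of_bound C (Filter.Eventually.of_forall fun k => ?_)
    have i1 := hφ.integrableOn hm (f + k)
    have i2 := hφ.integrableOn hm f
    have i3 := (hφ.memLp_deriv hm f).integrable_mul (Lp.memLp k)
    have e : innerSL ℝ ((hφ.memLp_deriv hm f).toLp _) k =
        ∫ x in Ioo α β, m x * deriv φ (f x) * k x := by
      rw [innerSL_apply_apply, MeasureTheory.L2.inner_def]
      refine integral_congr_ae ?_
      filter_upwards [(hφ.memLp_deriv hm f).coeFn_toLp] with x hx
      rw [hx]
      simp [mul_comm]
    rw [e, ← integral_sub i1 i2]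
    have i4 := i1.sub i2
    rw [← integral_sub (by exact i4) (by exact i3), Real.norm_eq_abs (‖k‖ ^ 2), abs_of_nonneg (sq_nonneg ‖k‖),
      ← L2.integral_sq, ← integral_const_mul]
    refine norm_integral_le_of_norm_le ((L2.integrableOn_sq k).const_mul C) ?_
    filter_upwards [ae_restrict_mem measurableSet_Ioo, Lp.coeFn_add f k] with x hx hfk
    rw [hfk, Pi.add_apply, Real.norm_eq_abs, show m x * φ (f x + k x) - m x * φ (f x) -
      m x * deriv φ (f x) * k x = m x * (φ (f x + k x) - φ (f x) - deriv φ (f x) * k x) by ring,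
      abs_mul]
    exact mul_le_mul (hCm x hx) (hφ.taylor _ _) (abs_nonneg _) hC
  · have := Asymptotics.isLittleO_norm_pow_id (E' := L2 α β) (n := 2) (by norm_num)
    exact this

end Functional

/-- The weighted energy identity for a solution of a transport equation `∂ₜw + ε ∂ₓw = h`. -/
theorem hasDerivWithinAt_weighted_energy {m φ : ℝ → ℝ} (hm : ContDiff ℝ 1 m)
    (hφ : IsQuadraticLike φ) {W : ℝ → SobolevH 1 0 1} {S : Set ℝ} {t : ℝ} {D : L2 0 1}
    (hD : HasDerivWithinAt (fun s => weakD (W s) 0) D S t) {ε : ℝ} {h : ℝ → ℝ}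
    (hh : D =ᵐ[volume.restrict (Ioo 0 1)] fun x => -ε * weakD (W t) 1 x + h x) :
    HasDerivWithinAt (fun s => ∫ x in Ioo 0 1, m x * φ (pointVal (W s) x))
      (-ε * (m 1 * φ (pointVal (W t) 1) - m 0 * φ (pointVal (W t) 0))
        + ε * (∫ x in Ioo 0 1, deriv m x * φ (pointVal (W t) x))
        + ∫ x in Ioo 0 1, m x * (deriv φ (pointVal (W t) x) * h x)) S t := by
  have hmc := hm.continuous
  have h1 := ((hφ.hasFDerivAt hmc (weakD (W t) 0)).comp_hasDerivWithinAt t hD)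
  have e0 : ((fun g : L2 0 1 => ∫ x in Ioo 0 1, m x * φ (g x)) ∘ fun s => weakD (W s) 0)
      = fun s => ∫ x in Ioo 0 1, m x * φ (pointVal (W s) x) := by
    ext s
    refine integral_congr_ae ?_
    filter_upwards [weakD_zero_ae_eq_pointVal zero_lt_one (W s)] with x hx
    rw [hx]
  rw [e0] at h1
  refine h1.congr_deriv ?_
  have hw := weakD_zero_ae_eq_pointVal zero_lt_one (W t)
  have i1 : IntegrableOn (fun x => m x * (deriv φ (pointVal (W t) x) * weakD (W t) 1 x))
      (Ioo 0 1) := by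
    refine ((hφ.memLp_deriv hmc (weakD (W t) 0)).integrable_mul (Lp.memLp (weakD (W t) 1))).congr ?_
    filter_upwards [hw] with x hx
    simp only [Pi.mul_apply, hx]
    ring
  have i2 : IntegrableOn (fun x => m x * (deriv φ (pointVal (W t) x) * D x)) (Ioo 0 1) := by
    refine ((hφ.memLp_deriv hmc (weakD (W t) 0)).integrable_mul (Lp.memLp D)).congr ?_
    filter_upwards [hw] with x hx
    simp only [Pi.mul_apply, hx]
    ring
  have i3 : IntegrableOn (fun x => deriv m x * φ (pointVal (W t) x)) (Ioo 0 1) := by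
    refine (hφ.integrableOn (hm.continuous_deriv le_rfl) (weakD (W t) 0)).congr ?_
    filter_upwards [hw] with x hx
    rw [hx]
  have e1 : innerSL ℝ ((hφ.memLp_deriv hmc (weakD (W t) 0)).toLp _) D =
      ∫ x in Ioo 0 1, m x * (deriv φ (pointVal (W t) x) * D x) := by
    rw [innerSL_apply_apply, MeasureTheory.L2.inner_def]
    refine integral_congr_ae ?_
    filter_upwards [(hφ.memLp_deriv hmc (weakD (W t) 0)).coeFn_toLp, hw] with x hx hx2
    rw [hx, hx2]
    simp only [RCLike.inner_apply, conj_trivial]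
    ring
  have e2 : ∫ x in Ioo 0 1, m x * (deriv φ (pointVal (W t) x) * h x) =
      (∫ x in Ioo 0 1, m x * (deriv φ (pointVal (W t) x) * D x)) +
        ε * ∫ x in Ioo 0 1, m x * (deriv φ (pointVal (W t) x) * weakD (W t) 1 x) := by
    rw [← integral_const_mul, ← integral_add i2 (i1.const_mul ε)]
    refine integral_congr_ae ?_
    filter_upwards [hh] with x hx
    rw [hx]
    ring
  -- Integration by parts in space trades the term with the weak derivative for boundary values and
  -- the derivative of the weight.
  have e3 := integral_deriv_weight_mul_comp zero_le_one hm hφ.contDiff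
    (L2.integrableOn (weakD (W t) 1)) (pointVal_eq_primitive zero_lt_one (W t))
  rw [integral_add i3 i1] at e3
  rw [e1, e2, ← e3]
  ring

end

/-! ### Transport equations for the Riemann invariants. -/

noncomputable section

theorem le_left_of_hasDerivAt_nonpos {T : ℝ} {f f' : ℝ → ℝ}
    (hc : ContinuousOn f (Icc 0 T)) (hd : ∀ t ∈ Ioo 0 T, HasDerivAt f (f' t) t)
    (hf' : ∀ t ∈ Ioo 0 T, f' t ≤ 0) : ∀ t ∈ Icc 0 T, f t ≤ f 0 := by
  intro t ht
  have := antitoneOn_of_deriv_nonpos (convex_Icc 0 T) hc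
    (fun t ht => by
      rw [interior_Icc] at ht
      exact (hd t ht).differentiableAt.differentiableWithinAt)
    (fun t ht => by
      rw [interior_Icc] at ht
      rw [(hd t ht).deriv]
      exact hf' t ht)
  exact this (left_mem_Icc.2 (ht.1.trans ht.2)) ht ht.1

/-- `∂ₜW + ε ∂ₓW = h` at time `t`, the time derivative being taken in `L²(0,1)` along `S`. -/
def SolvesTransportAt (S : Set ℝ) (t ε : ℝ) (W : ℝ → SobolevH 1 0 1) (h : ℝ → ℝ) : Prop :=
  ∃ D : L2 0 1, HasDerivWithinAt (fun s => weakD (W s) 0) D S t ∧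
    D =ᵐ[volume.restrict (Ioo 0 1)] fun x => -ε * weakD (W t) 1 x + h x

section SolvesTransportAt

variable {S : Set ℝ} {t ε : ℝ} {W W' : ℝ → SobolevH 1 0 1} {h h' : ℝ → ℝ}

theorem SolvesTransportAt.sub (hW : SolvesTransportAt S t ε W h)
    (hW' : SolvesTransportAt S t ε W' h') :
    SolvesTransportAt S t ε (fun s => W s - W' s) (fun x => h x - h' x) := by
  obtain ⟨D, h1, h2⟩ := hW
  obtain ⟨D', h1', h2'⟩ := hW'
  refine ⟨D - D', h1.sub h1', ?_⟩
  rw [weakD_sub]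
  filter_upwards [h2, h2', Lp.coeFn_sub D D', Lp.coeFn_sub (weakD (W t) 1) (weakD (W' t) 1)]
    with x e1 e2 e3 e4
  rw [e3, e4, Pi.sub_apply, Pi.sub_apply, e1, e2]
  ring

theorem SolvesTransportAt.memLp (hW : SolvesTransportAt S t ε W h) :
    MemLp h 2 (volume.restrict (Ioo 0 1)) := by
  obtain ⟨D, -, h2⟩ := hW
  refine (memLp_congr_ae ?_).1 ((Lp.memLp D).add ((Lp.memLp (weakD (W t) 1)).const_mul ε))
  filter_upwards [h2] with x hx
  rw [Pi.add_apply, hx]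
  ring

theorem SolvesTransportAt.hasDerivWithinAt (hW : SolvesTransportAt S t ε W h) {m φ : ℝ → ℝ}
    (hm : ContDiff ℝ 1 m) (hφ : IsQuadraticLike φ) :
    HasDerivWithinAt (fun s => ∫ x in Ioo 0 1, m x * φ (pointVal (W s) x))
      (-ε * (m 1 * φ (pointVal (W t) 1) - m 0 * φ (pointVal (W t) 0))
        + ε * (∫ x in Ioo 0 1, deriv m x * φ (pointVal (W t) x))
        + ∫ x in Ioo 0 1, m x * (deriv φ (pointVal (W t) x) * h x)) S t := by
  obtain ⟨D, h1, h2⟩ := hW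
  exact hasDerivWithinAt_weighted_energy hm hφ h1 h2

theorem integrableOn_weight_mul_comp_pointVal {m φ : ℝ → ℝ} (hm : Continuous m)
    (hφ : IsQuadraticLike φ) (v : SobolevH 1 0 1) :
    IntegrableOn (fun x => m x * φ (pointVal v x)) (Ioo 0 1) := by
  refine (hφ.integrableOn hm (weakD v 0)).congr ?_
  filter_upwards [weakD_zero_ae_eq_pointVal zero_lt_one v] with x hx
  rw [hx]

theorem SolvesTransportAt.integrableOn (hW : SolvesTransportAt S t ε W h) {m φ : ℝ → ℝ}
    (hm : Continuous m) (hφ : IsQuadraticLike φ) (v : SobolevH 1 0 1) :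
    IntegrableOn (fun x => m x * (deriv φ (pointVal v x) * h x)) (Ioo 0 1) := by
  refine ((hφ.memLp_deriv hm (weakD v 0)).integrable_mul hW.memLp).congr ?_
  filter_upwards [weakD_zero_ae_eq_pointVal zero_lt_one v] with x hx
  simp only [Pi.mul_apply, hx]
  ring

end SolvesTransportAt

section Solution

variable {T c : ℝ} {g₀ g₁ a : ℝ → ℝ} {p u : ℝ → SobolevH 1 0 1}

theorem IsClassicalSolution.transport_add (h : IsClassicalSolution T c g₀ g₁ a p u) {t : ℝ}
    (ht : t ∈ Icc 0 T) :
    SolvesTransportAt (Icc 0 T) t 1 (fun s => p s + u s) (fun x => -a (pointVal (u t) x)) := by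
  have hp := ((h.diff_p.differentiableOn (by simp)) t ht).hasDerivWithinAt
  have hu := ((h.diff_u.differentiableOn (by simp)) t ht).hasDerivWithinAt
  refine ⟨_, hp.add hu, ?_⟩
  rw [weakD_add]
  filter_upwards [h.mass t ht, h.momentum t ht, Lp.coeFn_add (weakD (p t) 1) (weakD (u t) 1),
    Lp.coeFn_add (derivWithin (fun s => weakD (p s) 0) (Icc 0 T) t)
      (derivWithin (fun s => weakD (u s) 0) (Icc 0 T) t)] with x e1 e2 e3 e4
  rw [e3, e4, Pi.add_apply, Pi.add_apply]
  linarith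

theorem IsClassicalSolution.transport_sub (h : IsClassicalSolution T c g₀ g₁ a p u) {t : ℝ}
    (ht : t ∈ Icc 0 T) :
    SolvesTransportAt (Icc 0 T) t (-1) (fun s => p s - u s) (fun x => a (pointVal (u t) x)) := by
  have hp := ((h.diff_p.differentiableOn (by simp)) t ht).hasDerivWithinAt
  have hu := ((h.diff_u.differentiableOn (by simp)) t ht).hasDerivWithinAt
  refine ⟨_, hp.sub hu, ?_⟩
  rw [weakD_sub]
  filter_upwards [h.mass t ht, h.momentum t ht, Lp.coeFn_sub (weakD (p t) 1) (weakD (u t) 1),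
    Lp.coeFn_sub (derivWithin (fun s => weakD (p s) 0) (Icc 0 T) t)
      (derivWithin (fun s => weakD (u s) 0) (Icc 0 T) t)] with x e1 e2 e3 e4
  rw [e3, e4, Pi.sub_apply, Pi.sub_apply]
  linarith

end Solution

/-! ### Stability and uniqueness of states. -/

section Stability

variable {T c : ℝ} {g₀ g₁ a b : ℝ → ℝ} {p u q v : ℝ → SobolevH 1 0 1}

/-- The difference of the Riemann invariants `p + u` of two states. -/
def riemannAdd (p u q v : ℝ → SobolevH 1 0 1) (t : ℝ) : SobolevH 1 0 1 :=
  p t + u t - (q t + v t)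

/-- The difference of the Riemann invariants `p - u` of two states. -/
def riemannSub (p u q v : ℝ → SobolevH 1 0 1) (t : ℝ) : SobolevH 1 0 1 :=
  p t - u t - (q t - v t)

theorem pointVal_riemannAdd {t x : ℝ} (hx : x ∈ Icc (0 : ℝ) 1) :
    pointVal (riemannAdd p u q v t) x = (pointVal (p t) x - pointVal (q t) x)
      + (pointVal (u t) x - pointVal (v t) x) := by
  rw [riemannAdd, pointVal_sub zero_lt_one _ _ hx]
  simp only [pointVal_add zero_lt_one _ _ hx]
  ring

theorem pointVal_riemannSub {t x : ℝ} (hx : x ∈ Icc (0 : ℝ) 1) :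
    pointVal (riemannSub p u q v t) x = (pointVal (p t) x - pointVal (q t) x)
      - (pointVal (u t) x - pointVal (v t) x) := by
  rw [riemannSub, pointVal_sub zero_lt_one _ _ hx]
  simp only [pointVal_sub zero_lt_one _ _ hx]
  ring

/-- The energy of the difference of two states. -/
def diffEnergy (p u q v : ℝ → SobolevH 1 0 1) (t : ℝ) : ℝ :=
  (∫ x in Ioo 0 1, 1 * (pointVal (riemannAdd p u q v t) x) ^ 2) +
    ∫ x in Ioo 0 1, 1 * (pointVal (riemannSub p u q v t) x) ^ 2

/-- A weighted energy of the difference of two states whose derivative controls the boundary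
values of the pressure. -/
def boundaryEnergy (p u q v : ℝ → SobolevH 1 0 1) (t : ℝ) : ℝ :=
  (∫ x in Ioo 0 1, (1 - x) * (pointVal (riemannAdd p u q v t) x) ^ 2) +
    ∫ x in Ioo 0 1, x * (pointVal (riemannSub p u q v t) x) ^ 2

theorem diffEnergy_zero (h : IsClassicalSolution T c g₀ g₁ a p u)
    (h' : IsClassicalSolution T c g₀ g₁ b q v) : diffEnergy p u q v 0 = 0 := by
  have e1 : ∀ x ∈ Ioo (0:ℝ) 1, 1 * (pointVal (riemannAdd p u q v 0) x) ^ 2 = 0 := by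
    intro x hx
    have hx := Ioo_subset_Icc_self hx
    rw [pointVal_riemannAdd hx, h.init_p x hx, h'.init_p x hx, h.init_u x hx, h'.init_u x hx]
    ring
  have e2 : ∀ x ∈ Ioo (0:ℝ) 1, 1 * (pointVal (riemannSub p u q v 0) x) ^ 2 = 0 := by
    intro x hx
    have hx := Ioo_subset_Icc_self hx
    rw [pointVal_riemannSub hx, h.init_p x hx, h'.init_p x hx, h.init_u x hx, h'.init_u x hx]
    ring
  rw [diffEnergy, setIntegral_congr_fun measurableSet_Ioo e1,
    setIntegral_congr_fun measurableSet_Ioo e2]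
  simp

theorem diffEnergy_eq (t : ℝ) : diffEnergy p u q v t =
    ‖weakD (riemannAdd p u q v t) 0‖ ^ 2 + ‖weakD (riemannSub p u q v t) 0‖ ^ 2 := by
  rw [diffEnergy, ← L2.integral_sq, ← L2.integral_sq]
  congr 1
  all_goals
    refine integral_congr_ae ?_
    filter_upwards [weakD_zero_ae_eq_pointVal zero_lt_one (riemannAdd p u q v t),
      weakD_zero_ae_eq_pointVal zero_lt_one (riemannSub p u q v t)] with x hx hx2
    simp [hx, hx2]

/-- The values of `a` and `b` on the interval `I` satisfy the conditions for a stability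
estimate. -/
structure StabilityCondition (I : Set ℝ) (L δ : ℝ) (a b : ℝ → ℝ) : Prop where
  mono : MonotoneOn a I
  lip : ∀ y ∈ I, ∀ z ∈ I, |a y - a z| ≤ L * |y - z|
  close : ∀ y ∈ I, |a y - b y| ≤ δ

theorem MonotoneOn.mul_sub_nonneg {I : Set ℝ} (h : MonotoneOn a I) {y z : ℝ} (hy : y ∈ I)
    (hz : z ∈ I) : 0 ≤ (a y - a z) * (y - z) := by
  rcases le_total y z with hyz | hyz
  · exact mul_nonneg_of_nonpos_of_nonpos (sub_nonpos.2 (h hy hz hyz)) (sub_nonpos.2 hyz)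
  · exact mul_nonneg (sub_nonneg.2 (h hz hy hyz)) (sub_nonneg.2 hyz)

theorem transport_riemannAdd (h : IsClassicalSolution T c g₀ g₁ a p u)
    (h' : IsClassicalSolution T c g₀ g₁ b q v) {t : ℝ} (ht : t ∈ Icc 0 T) :
    SolvesTransportAt (Icc 0 T) t 1 (riemannAdd p u q v)
      (fun x => -a (pointVal (u t) x) - -b (pointVal (v t) x)) :=
  (h.transport_add ht).sub (h'.transport_add ht)

theorem transport_riemannSub (h : IsClassicalSolution T c g₀ g₁ a p u)
    (h' : IsClassicalSolution T c g₀ g₁ b q v) {t : ℝ} (ht : t ∈ Icc 0 T) :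
    SolvesTransportAt (Icc 0 T) t (-1) (riemannSub p u q v)
      (fun x => a (pointVal (u t) x) - b (pointVal (v t) x)) :=
  (h.transport_sub ht).sub (h'.transport_sub ht)

theorem deriv_sq_eq (z : ℝ) : deriv (fun z : ℝ => z ^ 2) z = 2 * z := by simp

/-- The boundary terms cancel because the velocity differences vanish at both ends. The sources
contribute `-4 (a U - b V) (U - V)`; its part `-4 (a U - a V) (U - V)` is nonpositive by
monotonicity, and only the error `a V - b V` has to be absorbed. -/
theorem exists_hasDerivWithinAt_diffEnergy {umin umax L δ : ℝ}
    (hab : StabilityCondition (Icc umin umax) L δ a b)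
    (h : IsClassicalSolution T c g₀ g₁ a p u) (h' : IsClassicalSolution T c g₀ g₁ b q v)
    (hu : TakesValuesIn T umin umax u) (hv : TakesValuesIn T umin umax v)
    {t : ℝ} (ht : t ∈ Icc 0 T) :
    ∃ E', HasDerivWithinAt (diffEnergy p u q v) E' (Icc 0 T) t ∧
      E' ≤ 2 * δ ^ 2 + diffEnergy p u q v t := by
  have hr := transport_riemannAdd h h' ht
  have hs := transport_riemannSub h h' ht
  have h0 : (0 : ℝ) ∈ Icc (0 : ℝ) 1 := by simp
  have h1 : (1 : ℝ) ∈ Icc (0 : ℝ) 1 := by simp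
  have m1 : ContDiff ℝ 1 fun _ : ℝ => (1 : ℝ) := contDiff_const
  refine ⟨_, (hr.hasDerivWithinAt m1 isQuadraticLike_sq).add
    (hs.hasDerivWithinAt m1 isQuadraticLike_sq), ?_⟩
  simp only [deriv_const, zero_mul, integral_zero, pointVal_riemannAdd h0, pointVal_riemannAdd h1,
    pointVal_riemannSub h0, pointVal_riemannSub h1, h.left t ht, h'.left t ht, h.right t ht,
    h'.right t ht, deriv_sq_eq]
  have i1 := hr.integrableOn m1.continuous isQuadraticLike_sq (riemannAdd p u q v t)
  have i2 := hs.integrableOn m1.continuous isQuadraticLike_sq (riemannSub p u q v t)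
  have j1 := integrableOn_weight_mul_comp_pointVal m1.continuous isQuadraticLike_sq
    (riemannAdd p u q v t)
  have j2 := integrableOn_weight_mul_comp_pointVal m1.continuous isQuadraticLike_sq
    (riemannSub p u q v t)
  simp only [deriv_sq_eq] at i1 i2
  have key := setIntegral_mono_on (i1.add i2)
    ((j1.add j2).add (integrableOn_const (C := 2 * δ ^ 2) (by simp))) measurableSet_Ioo (by
    intro x hx
    have hx' := Ioo_subset_Icc_self hx
    have hux := hu t ht x hx'
    have hvx := hv t ht x hx'
    simp only [Pi.add_apply, pointVal_riemannAdd hx', pointVal_riemannSub hx']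
    set U := pointVal (u t) x
    set V := pointVal (v t) x
    set P := pointVal (p t) x - pointVal (q t) x
    have e1 := hab.mono.mul_sub_nonneg hux hvx
    have e2 := hab.close V hvx
    have e3 : -(δ * |U - V|) ≤ (a V - b V) * (U - V) := by
      have : |(a V - b V) * (U - V)| ≤ δ * |U - V| := by
        rw [abs_mul]
        exact mul_le_mul_of_nonneg_right e2 (abs_nonneg _)
      exact (abs_le.1 this).1
    -- Young's inequality, with weights chosen to fit the energy density `R² + S² = 2 P² + 2 (U -
    -- V)²`.
    have e4 : 4 * (δ * |U - V|) ≤ 2 * δ ^ 2 + 2 * (U - V) ^ 2 := by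
      rw [← sq_abs (U - V)]
      nlinarith [sq_nonneg (δ - |U - V|)]
    nlinarith [sq_nonneg P])
  simp only [Pi.add_apply] at key
  rw [integral_add i1 i2] at key
  have hc : IntegrableOn (fun _ : ℝ => 2 * δ ^ 2) (Ioo 0 1) volume :=
    integrableOn_const (by simp)
  rw [integral_add (by exact j1.add j2) (by exact hc), integral_add j1 j2] at key
  simp only [setIntegral_const, Real.volume_real_Ioo, smul_eq_mul] at key
  rw [diffEnergy]
  norm_num at key ⊢
  linarith

/-- Gronwall's argument: `exp(-t) * (E + 2 δ²)` is nonincreasing, and `E` vanishes initially because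
the initial data coincide. -/
theorem diffEnergy_le {umin umax L δ : ℝ}
    (hab : StabilityCondition (Icc umin umax) L δ a b)
    (h : IsClassicalSolution T c g₀ g₁ a p u) (h' : IsClassicalSolution T c g₀ g₁ b q v)
    (hu : TakesValuesIn T umin umax u) (hv : TakesValuesIn T umin umax v)
    {t : ℝ} (ht : t ∈ Icc 0 T) :
    diffEnergy p u q v t ≤ 2 * δ ^ 2 * (Real.exp t - 1) := by
  choose! E' hE hE' using fun t (ht : t ∈ Icc 0 T) =>
    exists_hasDerivWithinAt_diffEnergy hab h h' hu hv ht
  have hexp : ∀ t : ℝ, HasDerivAt (fun t => Real.exp (-t)) (-Real.exp (-t)) t := fun t => by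
    simpa using (hasDerivAt_neg t).exp
  have := le_left_of_hasDerivAt_nonpos (T := T)
    (f := fun t => Real.exp (-t) * (diffEnergy p u q v t + 2 * δ ^ 2))
    (f' := fun t => -Real.exp (-t) * (diffEnergy p u q v t + 2 * δ ^ 2)
      + Real.exp (-t) * E' t)
    (ContinuousOn.mul (by fun_prop) (ContinuousOn.add
      (fun t ht => (hE t ht).continuousWithinAt) continuousOn_const))
    (fun t ht => (hexp t).mul (((hE t (Ioo_subset_Icc_self ht)).hasDerivAt
      (Icc_mem_nhds ht.1 ht.2)).add_const _))
    (fun t ht => by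
      have h1 := hE' t (Ioo_subset_Icc_self ht)
      have h2 := Real.exp_pos (-t)
      nlinarith) t ht
  simp only [diffEnergy_zero h h', neg_zero, Real.exp_zero, Real.exp_neg] at this
  have hp := Real.exp_pos t
  rw [inv_mul_le_iff₀ hp] at this
  linarith

/-- The weights `1 - x` and `x` remove the outgoing traces `R(1)` and `S(0)` and leave `R(0)²` and
`S(1)²` with a positive sign. These are squared pressure differences, since the velocity differences
vanish at the ends. In `3 + L²`, the `1` comes from the derivatives of the weights and `2 + L²` from
Young's inequality for the source. -/
theorem exists_hasDerivWithinAt_boundaryEnergy {umin umax L δ : ℝ}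
    (hab : StabilityCondition (Icc umin umax) L δ a b) 
    (h : IsClassicalSolution T c g₀ g₁ a p u) (h' : IsClassicalSolution T c g₀ g₁ b q v)
    (hu : TakesValuesIn T umin umax u) (hv : TakesValuesIn T umin umax v)
    {t : ℝ} (ht : t ∈ Icc 0 T) :
    ∃ Q', HasDerivWithinAt (boundaryEnergy p u q v) Q' (Icc 0 T) t ∧
      (pointVal (p t) 0 - pointVal (q t) 0) ^ 2 + (pointVal (p t) 1 - pointVal (q t) 1) ^ 2
        - (3 + L ^ 2) * diffEnergy p u q v t - 2 * δ ^ 2 ≤ Q' := by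
  have hr := transport_riemannAdd h h' ht
  have hs := transport_riemannSub h h' ht
  have h0 : (0 : ℝ) ∈ Icc (0 : ℝ) 1 := by simp
  have h1 : (1 : ℝ) ∈ Icc (0 : ℝ) 1 := by simp
  have m1 : ContDiff ℝ 1 fun x : ℝ => 1 - x := contDiff_const.sub contDiff_id
  have m2 : ContDiff ℝ 1 fun x : ℝ => x := contDiff_id
  have m3 : Continuous fun _ : ℝ => (1 : ℝ) := continuous_const
  refine ⟨_, (hr.hasDerivWithinAt m1 isQuadraticLike_sq).add
    (hs.hasDerivWithinAt m2 isQuadraticLike_sq), ?_⟩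
  have d1 : ∀ x : ℝ, deriv (fun x : ℝ => 1 - x) x = -1 := fun x => by simp
  have d2 : ∀ x : ℝ, deriv (fun x : ℝ => x) x = 1 := fun x => by simp
  have i1 := hr.integrableOn m1.continuous isQuadraticLike_sq (riemannAdd p u q v t)
  have i2 := hs.integrableOn m2.continuous isQuadraticLike_sq (riemannSub p u q v t)
  have j1 := integrableOn_weight_mul_comp_pointVal m3 isQuadraticLike_sq
    (riemannAdd p u q v t)
  have j2 := integrableOn_weight_mul_comp_pointVal m3 isQuadraticLike_sq
    (riemannSub p u q v t)
  simp only [deriv_sq_eq] at i1 i2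
  have hc : IntegrableOn (fun _ : ℝ => 2 * δ ^ 2) (Ioo 0 1) volume :=
    integrableOn_const (by simp)
  have key := setIntegral_mono_on
    ((((j1.add j2).const_mul (2 + L ^ 2)).add hc).neg) (i1.add i2) measurableSet_Ioo (by
    intro x hx
    have hx' := Ioo_subset_Icc_self hx
    have hux := hu t ht x hx'
    have hvx := hv t ht x hx'
    simp only [Pi.add_apply, Pi.neg_apply]
    have hd : pointVal (u t) x - pointVal (v t) x = (pointVal (riemannAdd p u q v t) x -
        pointVal (riemannSub p u q v t) x) / 2 := by
      rw [pointVal_riemannAdd hx', pointVal_riemannSub hx']; ring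
    have e2 := hab.close _ hvx
    have e1 := hab.lip _ hux _ hvx
    rw [hd] at e1
    set R := pointVal (riemannAdd p u q v t) x
    set S := pointVal (riemannSub p u q v t) x
    set U := pointVal (u t) x
    set V := pointVal (v t) x
    set F := a U - b V with hF
    have e3 : F ^ 2 ≤ L ^ 2 * (R ^ 2 + S ^ 2) + 2 * δ ^ 2 := by
      have a1 : (a U - a V) ^ 2 ≤ L ^ 2 * ((R - S) / 2) ^ 2 := by
        have := pow_le_pow_left₀ (abs_nonneg _) e1 2
        rwa [mul_pow, sq_abs, sq_abs] at this
      have a2 : (a V - b V) ^ 2 ≤ δ ^ 2 := by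
        have := pow_le_pow_left₀ (abs_nonneg _) e2 2
        rwa [sq_abs] at this
      have a3 : F = (a U - a V) + (a V - b V) := by rw [hF]; ring
      have a4 : F ^ 2 ≤ 2 * (a U - a V) ^ 2 + 2 * (a V - b V) ^ 2 := by
        rw [a3]; nlinarith [sq_nonneg ((a U - a V) - (a V - b V))]
      have a5 : L ^ 2 * ((R - S) / 2) ^ 2 ≤ L ^ 2 * ((R ^ 2 + S ^ 2) / 2) :=
        mul_le_mul_of_nonneg_left (by nlinarith [sq_nonneg (R + S)]) (sq_nonneg L)
      linarith
    have e4 : (1 - x) * (2 * R * (-a U - -b V)) + x * (2 * S * F) =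
        -(2 * ((1 - x) * R - x * S) * F) := by rw [hF]; ring
    rw [e4]
    have e5 : 2 * ((1 - x) * R - x * S) * F ≤ ((1 - x) * R - x * S) ^ 2 + F ^ 2 := by
      nlinarith [sq_nonneg ((1 - x) * R - x * S - F)]
    have e6 : ((1 - x) * R - x * S) ^ 2 ≤ 2 * (R ^ 2 + S ^ 2) := by
      have b1 : ((1 - x) * R) ^ 2 ≤ R ^ 2 := by
        rw [mul_pow]
        exact mul_le_of_le_one_left (sq_nonneg R) (by nlinarith [hx.1, hx.2])
      have b2 : (x * S) ^ 2 ≤ S ^ 2 := by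
        rw [mul_pow]
        exact mul_le_of_le_one_left (sq_nonneg S) (by nlinarith [hx.1, hx.2])
      nlinarith [sq_nonneg ((1 - x) * R + x * S)]
    linarith)
  simp only [Pi.add_apply, Pi.neg_apply] at key
  rw [integral_add i1 i2, integral_neg, integral_add (by exact (j1.add j2).const_mul _) hc,
    integral_const_mul, integral_add j1 j2] at key
  simp only [d1, d2, deriv_sq_eq]
  simp only [setIntegral_const, Real.volume_real_Ioo, smul_eq_mul] at key
  simp only [pointVal_riemannAdd h0, pointVal_riemannAdd h1,
    pointVal_riemannSub h0, pointVal_riemannSub h1, h.left t ht, h'.left t ht, h.right t ht,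
    h'.right t ht]
  rw [diffEnergy]
  simp only [neg_mul, integral_neg] at key ⊢
  norm_num at key ⊢
  linarith

theorem boundaryEnergy_nonneg (t : ℝ) : 0 ≤ boundaryEnergy p u q v t := by
  refine add_nonneg (setIntegral_nonneg measurableSet_Ioo fun x hx => ?_)
    (setIntegral_nonneg measurableSet_Ioo fun x hx => ?_)
  · exact mul_nonneg (by linarith [hx.2]) (sq_nonneg _)
  · exact mul_nonneg hx.1.le (sq_nonneg _)

theorem boundaryEnergy_le (t : ℝ) : boundaryEnergy p u q v t ≤ diffEnergy p u q v t := by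
  refine add_le_add (setIntegral_mono_on ?_ ?_ measurableSet_Ioo fun x hx => ?_)
    (setIntegral_mono_on ?_ ?_ measurableSet_Ioo fun x hx => ?_)
  · exact integrableOn_weight_mul_comp_pointVal (by fun_prop) isQuadraticLike_sq _
  · exact integrableOn_weight_mul_comp_pointVal (by fun_prop) isQuadraticLike_sq _
  · exact mul_le_mul_of_nonneg_right (by linarith [hx.1]) (sq_nonneg _)
  · exact integrableOn_weight_mul_comp_pointVal (by fun_prop) isQuadraticLike_sq _
  · exact integrableOn_weight_mul_comp_pointVal (by fun_prop) isQuadraticLike_sq _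
  · exact mul_le_mul_of_nonneg_right hx.2.le (sq_nonneg _)

/-- For a single parameter `δ = 0`, so the energy of the difference is zero; `p` and `u` are
recovered from the two invariants. -/
theorem IsClassicalSolution.eqOn (hab : ∃ L umin umax, StabilityCondition (Icc umin umax) L 0 a a ∧
      TakesValuesIn T umin umax u ∧ TakesValuesIn T umin umax v)
    (h : IsClassicalSolution T c g₀ g₁ a p u) (h' : IsClassicalSolution T c g₀ g₁ a q v) :
    EqOn p q (Icc 0 T) ∧ EqOn u v (Icc 0 T) := by
  obtain ⟨L, umin, umax, hab, hu, hv⟩ := hab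
  have key : ∀ t ∈ Icc 0 T, weakD (riemannAdd p u q v t) 0 = 0 ∧
      weakD (riemannSub p u q v t) 0 = 0 := by
    intro t ht
    have := diffEnergy_le hab h h' hu hv ht
    rw [diffEnergy_eq] at this
    simp only [ne_eq, OfNat.ofNat_ne_zero, not_false_eq_true, zero_pow, mul_zero, zero_mul] at this
    have h1 := sq_nonneg ‖weakD (riemannAdd p u q v t) 0‖
    have h2 := sq_nonneg ‖weakD (riemannSub p u q v t) 0‖
    constructor
    · exact norm_eq_zero.1 (pow_eq_zero_iff two_ne_zero |>.1 (by linarith))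
    · exact norm_eq_zero.1 (pow_eq_zero_iff two_ne_zero |>.1 (by linarith))
  have add0 : ∀ t ∈ Icc 0 T, riemannAdd p u q v t = 0 := fun t ht =>
    SobolevH.ext_weakD_zero (key t ht).1
  have sub0 : ∀ t ∈ Icc 0 T, riemannSub p u q v t = 0 := fun t ht =>
    SobolevH.ext_weakD_zero (key t ht).2
  constructor
  · intro t ht
    have e : (2 : ℝ) • (p t - q t) = riemannAdd p u q v t + riemannSub p u q v t := by
      simp only [riemannAdd, riemannSub, two_smul]; abel
    rw [add0 t ht, sub0 t ht, add_zero, smul_eq_zero] at e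
    exact sub_eq_zero.1 (e.resolve_left two_ne_zero)
  · intro t ht
    have e : (2 : ℝ) • (u t - v t) = riemannAdd p u q v t - riemannSub p u q v t := by
      simp only [riemannAdd, riemannSub, two_smul]; abel
    rw [add0 t ht, sub0 t ht, sub_zero, smul_eq_zero] at e
    exact sub_eq_zero.1 (e.resolve_left two_ne_zero)

theorem IsClassicalSolution.continuousOn_pressureDrop (h : IsClassicalSolution T c g₀ g₁ a p u) :
    ContinuousOn (pressureDrop p) (Icc 0 T) :=
  (continuousOn_trace zero_lt_one h.cont_p (by simp)).sub
    (continuousOn_trace zero_lt_one h.cont_p (by simp))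

/-- The constant in the stability estimate for the pressure drop. -/
def stabilityConst (T L : ℝ) : ℝ :=
  2 * (2 * Real.exp T + T * ((3 + L ^ 2) * (2 * Real.exp T) + 2))

/-- Integrating the boundary energy inequality bounds the traces by the final boundary energy plus
the time integral of the interior energy, both of order `δ²`. -/
theorem integral_sq_pressureDrop_sub_le (hT : 0 < T) {umin umax L δ : ℝ}
    (hab : StabilityCondition (Icc umin umax) L δ a b)
    (h : IsClassicalSolution T c g₀ g₁ a p u) (h' : IsClassicalSolution T c g₀ g₁ b q v)
    (hu : TakesValuesIn T umin umax u) (hv : TakesValuesIn T umin umax v) :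
    ∫ t in Ioo 0 T, (pressureDrop p t - pressureDrop q t) ^ 2 ≤ stabilityConst T L * δ ^ 2 := by
  choose! Q' hQ hQ' using fun t (ht : t ∈ Icc 0 T) =>
    exists_hasDerivWithinAt_boundaryEnergy hab h h' hu hv ht
  set bd : ℝ → ℝ := fun t => (pointVal (p t) 0 - pointVal (q t) 0) ^ 2 +
    (pointVal (p t) 1 - pointVal (q t) 1) ^ 2 with hbd
  have h0 : (0 : ℝ) ∈ Icc (0 : ℝ) 1 := by simp
  have h1 : (1 : ℝ) ∈ Icc (0 : ℝ) 1 := by simp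
  have hbc : ContinuousOn bd (Icc 0 T) :=
    (((continuousOn_trace zero_lt_one h.cont_p h0).sub
      (continuousOn_trace zero_lt_one h'.cont_p h0)).pow 2).add
    (((continuousOn_trace zero_lt_one h.cont_p h1).sub
      (continuousOn_trace zero_lt_one h'.cont_p h1)).pow 2)
  -- The constant extension beyond `[0, T]` is continuous, so its time integral is differentiable
  -- everywhere.
  set be : ℝ → ℝ := IccExtend hT.le (domRestrict (Icc 0 T) bd) with hbe
  have hbec : Continuous be := (continuousOn_iff_continuous_domRestrict.1 hbc).Icc_extend'
  have heq : ∀ t ∈ Icc 0 T, be t = bd t := fun t ht => by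
    rw [hbe, IccExtend_of_mem hT.le _ ht]; rfl
  set M := (3 + L ^ 2) * (2 * δ ^ 2 * Real.exp T) + 2 * δ ^ 2 with hM
  have hE : ∀ t ∈ Icc 0 T, diffEnergy p u q v t ≤ 2 * δ ^ 2 * Real.exp T := by
    intro t ht
    refine (diffEnergy_le hab h h' hu hv ht).trans ?_
    refine mul_le_mul_of_nonneg_left ?_ (by positivity)
    linarith [Real.exp_le_exp.2 ht.2]
  -- Its derivative is nonpositive because the squared traces are at most `Q' + M` once the energy
  -- is replaced by its maximal size.
  have hmain := le_left_of_hasDerivAt_nonpos (T := T)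
    (f := fun t => (∫ s in (0:ℝ)..t, be s) - boundaryEnergy p u q v t - M * t)
    (f' := fun t => be t - Q' t - M * 1)
    (ContinuousOn.sub (ContinuousOn.sub
      (continuous_iff_continuousAt.2 fun t =>
        (hbec.integral_hasStrictDerivAt 0 t).hasDerivAt.continuousAt).continuousOn
      (fun t ht => (hQ t ht).continuousWithinAt)) (by fun_prop))
    (fun t ht => (((hbec.integral_hasStrictDerivAt 0 t).hasDerivAt).sub
      ((hQ t (Ioo_subset_Icc_self ht)).hasDerivAt (Icc_mem_nhds ht.1 ht.2))).sub
      ((hasDerivAt_id t).const_mul M))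
    (fun t ht => by
      have ht' := Ioo_subset_Icc_self ht
      have h1 := hQ' t ht'
      have h2 := mul_le_mul_of_nonneg_left (hE t ht') (show 0 ≤ 3 + L ^ 2 by positivity)
      simp only [heq t ht', hbd]
      linarith) T (right_mem_Icc.2 hT.le)
  have hz : 0 ≤ boundaryEnergy p u q v 0 := boundaryEnergy_nonneg 0
  have hQT := (boundaryEnergy_le T).trans (hE T (right_mem_Icc.2 hT.le))
  simp only [intervalIntegral.integral_same, mul_zero] at hmain
  have e1 : ∫ s in (0:ℝ)..T, be s = ∫ s in Ioo 0 T, be s := by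
    rw [intervalIntegral.integral_of_le hT.le, integral_Ioc_eq_integral_Ioo]
  have hfin : ∫ t in Ioo 0 T, (pressureDrop p t - pressureDrop q t) ^ 2 ≤
      ∫ t in Ioo 0 T, 2 * be t := by
    refine setIntegral_mono_on ?_ ?_ measurableSet_Ioo ?_
    · exact ((h.continuousOn_pressureDrop.sub h'.continuousOn_pressureDrop).pow
        2).integrableOn_Icc.mono_set Ioo_subset_Icc_self
    · exact ((hbec.const_mul 2).integrableOn_Icc (a := 0) (b := T)).mono_set Ioo_subset_Icc_self
    · intro t ht
      rw [heq t (Ioo_subset_Icc_self ht)]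
      simp only [pressureDrop, hbd]
      nlinarith [sq_nonneg ((pointVal (p t) 0 - pointVal (q t) 0) +
        (pointVal (p t) 1 - pointVal (q t) 1))]
  rw [integral_const_mul, ← e1] at hfin
  have : ∫ s in (0:ℝ)..T, be s ≤ 2 * δ ^ 2 * Real.exp T + M * T := by linarith
  calc _ ≤ _ := hfin
    _ ≤ 2 * (2 * δ ^ 2 * Real.exp T + M * T) := by linarith
    _ = stabilityConst T L * δ ^ 2 := by rw [hM, stabilityConst]; ring

end Stability

end

/-! ### Monotonicity and Lipschitz bounds of admissible parameters. -/

noncomputable section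

section Admissible

theorem HasWeakDeriv.integrableOn_of_bounded {α β C : ℝ} {f f' : ℝ → ℝ}
    (hf : HasWeakDeriv (Ioo α β) f f')
    (hC : ∀ᵐ x ∂(volume.restrict (Ioo α β)), |f' x| ≤ C) : IntegrableOn f' (Ioo α β) := by
  have h1 : AEStronglyMeasurable f' (volume.restrict (Ioo α β)) :=
    hf.locInt'.aestronglyMeasurable
  exact Integrable.mono' (g := fun _ => C) (integrableOn_const (by simp)) h1 hC

theorem intervalIntegral_bounds {α β A B x y : ℝ} {f' : ℝ → ℝ} (hi : IntegrableOn f' (Ioo α β))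
    (hA : ∀ᵐ ξ ∂(volume.restrict (Ioo α β)), A ≤ f' ξ)
    (hB : ∀ᵐ ξ ∂(volume.restrict (Ioo α β)), f' ξ ≤ B) (hx : α ≤ x) (hxy : x ≤ y) (hy : y ≤ β) :
    A * (y - x) ≤ ∫ t in x..y, f' t ∧ ∫ t in x..y, f' t ≤ B * (y - x) := by
  have hsub : Ioo x y ⊆ Ioo α β := Ioo_subset_Ioo hx hy
  have i1 : IntegrableOn f' (Ioo x y) := hi.mono_set hsub
  have v : (volume : Measure ℝ).real (Ioo x y) = y - x := by
    simp [Measure.real, hxy]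
  rw [intervalIntegral.integral_of_le hxy, integral_Ioc_eq_integral_Ioo]
  constructor
  · have := integral_mono_ae (μ := volume.restrict (Ioo x y)) (f := fun _ => A)
      (integrableOn_const (by simp)) i1 (ae_restrict_of_ae_restrict_of_subset hsub hA)
    simp only [setIntegral_const, v, smul_eq_mul] at this
    linarith
  · have := integral_mono_ae (μ := volume.restrict (Ioo x y)) (g := fun _ => B)
      i1 (integrableOn_const (by simp)) (ae_restrict_of_ae_restrict_of_subset hsub hB)
    simp only [setIntegral_const, v, smul_eq_mul] at this
    linarith

theorem HasWeakDeriv.sub_bounds {α β A B : ℝ} {f f' : ℝ → ℝ} (hαβ : α < β)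
    (hf : HasWeakDeriv (Ioo α β) f f') (hc : ContinuousOn f (Icc α β))
    (hA : ∀ᵐ ξ ∂(volume.restrict (Ioo α β)), A ≤ f' ξ)
    (hB : ∀ᵐ ξ ∂(volume.restrict (Ioo α β)), f' ξ ≤ B) {x y : ℝ} (hx : x ∈ Icc α β)
    (hy : y ∈ Icc α β) (hxy : x ≤ y) :
    A * (y - x) ≤ f y - f x ∧ f y - f x ≤ B * (y - x) := by
  have hi : IntegrableOn f' (Ioo α β) := hf.integrableOn_of_bounded (C := |A| + |B|) (by
    filter_upwards [hA, hB] with ξ h1 h2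
    rw [abs_le]
    constructor
    · linarith [neg_abs_le A, abs_nonneg B]
    · linarith [le_abs_self B, abs_nonneg A])
  have ii : ∀ z ∈ Icc α β, IntervalIntegrable f' volume α z := by
    intro z hz
    rw [intervalIntegrable_iff_integrableOn_Ioo_of_le hz.1]
    exact hi.mono_set (Ioo_subset_Ioo_right hz.2)
  have e : f y - f x = ∫ t in x..y, f' t := by
    rw [hf.eq_primitive hαβ hi hc x hx, hf.eq_primitive hαβ hi hc y hy,
      ← intervalIntegral.integral_interval_sub_left (ii y hy) (ii x hx)]
    ring
  rw [e]
  exact intervalIntegral_bounds hi hA hB hx.1 hxy hy.2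

theorem AdmissibleOn.sub_bounds {B : ParamBounds} {Ω : Set ℝ} {a : ℝ → ℝ}
    (ha : AdmissibleOn B Ω a) {α β : ℝ} (hαβ : α < β) (hΩ : Ioo α β ⊆ Ω) {x y : ℝ}
    (hx : x ∈ Icc α β) (hy : y ∈ Icc α β) (hxy : x ≤ y) :
    B.a₀ * (y - x) ≤ a y - a x ∧ a y - a x ≤ B.a₁ * (y - x) := by
  obtain ⟨hc, -, -, a', a'', a''', h1, -, -, hb⟩ := ha
  have hb' := ae_restrict_of_ae_restrict_of_subset hΩ hb
  refine (h1.mono hΩ).sub_bounds hαβ (hc.mono ?_) (hb'.mono fun ξ h => h.1.1)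
    (hb'.mono fun ξ h => h.1.2) hx hy hxy
  rw [← closure_Ioo hαβ.ne]
  exact closure_mono hΩ

theorem AdmissibleOn.monotoneOn {B : ParamBounds} {α β : ℝ} {a : ℝ → ℝ}
    (ha : AdmissibleOn B (Ioo α β) a) (hαβ : α < β) : MonotoneOn a (Icc α β) := by
  intro x hx y hy hxy
  have := (ha.sub_bounds hαβ subset_rfl hx hy hxy).1
  nlinarith [B.a₀_pos]

theorem AdmissibleOn.lipschitz {B : ParamBounds} {α β : ℝ} {a : ℝ → ℝ}
    (ha : AdmissibleOn B (Ioo α β) a) (hαβ : α < β) :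
    ∀ x ∈ Icc α β, ∀ y ∈ Icc α β, |a x - a y| ≤ B.a₁ * |x - y| := by
  have key : ∀ x ∈ Icc α β, ∀ y ∈ Icc α β, x ≤ y → |a x - a y| ≤ B.a₁ * |x - y| := by
    intro x hx y hy hxy
    have h := ha.sub_bounds hαβ subset_rfl hx hy hxy
    rw [abs_sub_comm, abs_sub_comm x, abs_of_nonneg (sub_nonneg.2 hxy), abs_of_nonneg]
    · exact h.2
    · exact sub_nonneg.2 (ha.monotoneOn hαβ hx hy hxy)
  intro x hx y hy
  rcases le_total x y with h | h
  · exact key x hx y hy h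
  · rw [abs_sub_comm, abs_sub_comm x]
    exact key y hy x hx h

theorem AdmissibleOn.monotone {B : ParamBounds} {a : ℝ → ℝ}
    (ha : AdmissibleOn B univ a) : Monotone a := by
  intro x y hxy
  -- The interval is lengthened to `y + 1` so that it is nondegenerate even for `x = y`.
  have := (ha.sub_bounds (α := x) (β := y + 1) (by linarith) (subset_univ _) (x := x) (y := y)
    ⟨le_rfl, by linarith⟩ ⟨hxy, by linarith⟩ hxy).1
  nlinarith [B.a₀_pos]

end Admissible

/-! ### Comparison with affine barriers and existence of state bounds. -/

theorem weakD_smul {k : ℕ} {α β : ℝ} (r : ℝ) (v : SobolevH k α β) (i : Fin (k + 1)) :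
    weakD (r • v) i = r • weakD v i := rfl

/-- A function `f` with `f x = f α + ∫ f'` and `f' ∈ L²` as an element of `H¹(α, β)`. -/
theorem exists_sobolevH {α β : ℝ} (hαβ : α < β) {f f' : ℝ → ℝ}
    (hf' : MemLp f' 2 (volume.restrict (Ioo α β)))
    (hf : ∀ x ∈ Icc α β, f x = f α + ∫ t in α..x, f' t) :
    ∃ v : SobolevH 1 α β, EqOn (pointVal v) f (Icc α β) ∧
      weakD v 0 =ᵐ[volume.restrict (Ioo α β)] f ∧ weakD v 1 =ᵐ[volume.restrict (Ioo α β)] f' := by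
  have hi : IntegrableOn f' (Ioo α β) := hf'.integrable one_le_two
  have hcon : ContinuousOn f (Icc α β) :=
    (continuousOn_primitive_Icc hαβ.le hi (f α)).congr hf
  have hfL : MemLp f 2 (volume.restrict (Ioo α β)) := by
    obtain ⟨C, hC⟩ := isCompact_Icc.exists_bound_of_continuousOn hcon
    refine MemLp.of_bound ((hcon.mono Ioo_subset_Icc_self).aestronglyMeasurable
      measurableSet_Ioo) C ?_
    filter_upwards [ae_restrict_mem measurableSet_Ioo] with x hx
    exact hC x (Ioo_subset_Icc_self hx)
  have hw : HasWeakDeriv (Ioo α β) (hfL.toLp f) (hf'.toLp f') := by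
    refine (hasWeakDeriv_primitive hi (f α)).congr_ae isOpen_Ioo ?_ hf'.coeFn_toLp.symm
    filter_upwards [hfL.coeFn_toLp, ae_restrict_mem measurableSet_Ioo] with x hx hm
    rw [hx, hf x (Ioo_subset_Icc_self hm)]
  refine ⟨SobolevH.ofPair _ _ hw, pointVal_eqOn hαβ _ hcon ?_, ?_, ?_⟩
  · exact hfL.coeFn_toLp
  · exact hfL.coeFn_toLp
  · exact hf'.coeFn_toLp

theorem exists_affine_sobolevH (G : ℝ) : ∃ e₁ e₂ : SobolevH 1 0 1,
    (weakD e₁ 0 =ᵐ[volume.restrict (Ioo 0 1)] fun _ => 1) ∧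
    (weakD e₁ 1 =ᵐ[volume.restrict (Ioo 0 1)] fun _ => 0) ∧
    (weakD e₂ 0 =ᵐ[volume.restrict (Ioo 0 1)] fun x => G * x) ∧
    (weakD e₂ 1 =ᵐ[volume.restrict (Ioo 0 1)] fun _ => G) := by
  obtain ⟨e₁, -, h1, h2⟩ := exists_sobolevH zero_lt_one (f := fun _ => 1) (f' := fun _ => 0)
    (memLp_const 0) (by simp)
  obtain ⟨e₂, -, h3, h4⟩ := exists_sobolevH zero_lt_one (f := fun x => G * x) (f' := fun _ => G)
    (memLp_const G) (fun x _ => by simp [mul_comm])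
  exact ⟨e₁, e₂, h1, h2, h3, h4⟩

/-- The affine barrier functions as solutions of transport equations. -/
theorem exists_affine_barrier (A K G : ℝ) : ∃ Z : ℝ → SobolevH 1 0 1,
    (∀ t, ∀ x ∈ Icc (0 : ℝ) 1, pointVal (Z t) x = A + K * t + G * x) ∧
    ∀ S t ε, SolvesTransportAt S t ε Z fun _ => K + ε * G := by
  obtain ⟨e₁, e₂, h1, h2, h3, h4⟩ := exists_affine_sobolevH G
  refine ⟨fun t => (A + K * t) • e₁ + e₂, fun t x hx => ?_, fun S t ε => ?_⟩
  · refine pointVal_eqOn zero_lt_one _ (f := fun x => A + K * t + G * x) (by fun_prop) ?_ hx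
    rw [weakD_add, weakD_smul]
    filter_upwards [h1, h3, Lp.coeFn_add ((A + K * t) • weakD e₁ 0) (weakD e₂ 0),
      Lp.coeFn_smul (A + K * t) (weakD e₁ 0)] with x a1 a2 a3 a4
    rw [a3, Pi.add_apply, a4, Pi.smul_apply, a1, a2]
    simp
  · refine ⟨K • weakD e₁ 0, ?_, ?_⟩
    · have hd : HasDerivAt (fun s : ℝ => A + K * s) K t := by
        simpa using ((hasDerivAt_id t).const_mul K).const_add A
      exact ((hd.smul_const (weakD e₁ 0)).add_const (weakD e₂ 0)).hasDerivWithinAt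
    · rw [weakD_add, weakD_smul]
      filter_upwards [h1, h2, h4, Lp.coeFn_add ((A + K * t) • weakD e₁ 1) (weakD e₂ 1),
        Lp.coeFn_smul (A + K * t) (weakD e₁ 1), Lp.coeFn_smul K (weakD e₁ 0)]
        with x a1 a2 a3 a4 a5 a6
      rw [a4, a6, Pi.add_apply, a5, Pi.smul_apply, Pi.smul_apply, a1, a2, a3]
      simp

theorem pointVal_nonpos_of_integral_posPart_sq {v : SobolevH 1 0 1}
    (h : ∫ x in Ioo 0 1, 1 * (max (pointVal v x) 0) ^ 2 ≤ 0) :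
    ∀ x ∈ Icc (0 : ℝ) 1, pointVal v x ≤ 0 := by
  have hi := integrableOn_weight_mul_comp_pointVal (continuous_const (y := (1 : ℝ)))
    isQuadraticLike_posPart_sq v
  have h0 : 0 ≤ᵐ[volume.restrict (Ioo 0 1)] fun x => 1 * (max (pointVal v x) 0) ^ 2 :=
    Filter.Eventually.of_forall fun x => by positivity
  have := (integral_eq_zero_iff_of_nonneg_ae h0 hi).1
    (le_antisymm h (integral_nonneg_of_ae h0))
  have hcv := continuousOn_pointVal zero_lt_one v
  have heq := ae_restrict_Ioo_eq_Icc_of_continuousOn zero_lt_one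
    (f := fun x => 1 * (max (pointVal v x) 0) ^ 2) (g := fun _ => (0 : ℝ))
    (continuousOn_const.mul ((hcv.sup continuousOn_const).pow 2)) continuousOn_const this
  intro x hx
  have := heq hx
  simpa using this

section Bounds

variable {T c : ℝ} {g₀ g₁ a : ℝ → ℝ} {p u : ℝ → SobolevH 1 0 1}

/-- This symmetry of the system turns upper bounds into lower bounds; `-a(-z)` is monotone when `a`
is. -/
theorem IsClassicalSolution.neg (h : IsClassicalSolution T c g₀ g₁ a p u) :
    IsClassicalSolution T (-c) (fun t => -g₀ t) (fun t => -g₁ t) (fun z => -a (-z))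
      (fun t => -p t) (fun t => -u t) where
  cont_p := h.cont_p.neg
  cont_u := h.cont_u.neg
  diff_p := h.diff_p.neg
  diff_u := h.diff_u.neg
  mass t ht := by
    have e : derivWithin (fun s => weakD (-p s) 0) (Icc 0 T) t =
        -derivWithin (fun s => weakD (p s) 0) (Icc 0 T) t := derivWithin.fun_neg
    rw [e, weakD_neg]
    filter_upwards [h.mass t ht, Lp.coeFn_neg (weakD (u t) 1),
      Lp.coeFn_neg (derivWithin (fun s => weakD (p s) 0) (Icc 0 T) t)] with x e1 e2 e3
    rw [e2, e3, Pi.neg_apply, Pi.neg_apply]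
    linarith
  momentum t ht := by
    have e : derivWithin (fun s => weakD (-u s) 0) (Icc 0 T) t =
        -derivWithin (fun s => weakD (u s) 0) (Icc 0 T) t := derivWithin.fun_neg
    rw [e, weakD_neg]
    filter_upwards [h.momentum t ht, Lp.coeFn_neg (weakD (p t) 1),
      Lp.coeFn_neg (derivWithin (fun s => weakD (u s) 0) (Icc 0 T) t),
      ae_restrict_mem measurableSet_Ioo] with x e1 e2 e3 hx
    rw [e2, e3, Pi.neg_apply, Pi.neg_apply,
      pointVal_neg zero_lt_one (u t) (Ioo_subset_Icc_self hx), neg_neg]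
    linarith
  left t ht := by simpa [h.left t ht] using pointVal_neg zero_lt_one (u t) (x := 0) (by simp)
  right t ht := by simpa [h.right t ht] using pointVal_neg zero_lt_one (u t) (x := 1) (by simp)
  init_p x hx := by simpa [h.init_p x hx] using pointVal_neg zero_lt_one (p 0) hx
  init_u x hx := by simpa [h.init_u x hx] using pointVal_neg zero_lt_one (u 0) hx

/-- The barriers subtracted from the two invariants form a supersolution. The integral of the
squared positive parts starts at zero and has nonpositive derivative, hence vanishes. The damping
enters only through monotonicity and its values on `[-G, G]`. -/
theorem IsClassicalSolution.riemann_le (h : IsClassicalSolution T c g₀ g₁ a p u)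
    (ha : Monotone a) {G κ : ℝ} (hG : 0 ≤ G) (hκ : 0 ≤ κ) (h₀ : ∀ t ∈ Icc 0 T, |g₀ t| ≤ G)
    (h₁ : ∀ t ∈ Icc 0 T, |g₁ t| ≤ G) (haκ : ∀ w, |w| ≤ G → |a w| ≤ κ) {t : ℝ} (ht : t ∈ Icc 0 T)
    {x : ℝ} (hx : x ∈ Icc (0 : ℝ) 1) :
    pointVal (p t) x + pointVal (u t) x - c ≤ (2 * G + κ) * T + 2 * G ∧
    pointVal (p t) x - pointVal (u t) x - c ≤ (2 * G + κ) * T + 2 * G := by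
  set K := 2 * G + κ with hK
  -- Half the difference of the barriers is the velocity `w = G - 2 G x`, which is `G` at `x = 0`
  -- and `-G` at `x = 1`. The growth rate `K` leaves both barriers with the source `K - 2 G = κ`,
  -- enough to dominate `|a w|`.
  obtain ⟨Z₁, z1, z1'⟩ := exists_affine_barrier (c + 2 * G) K (-(2 * G))
  obtain ⟨Z₂, z2, z2'⟩ := exists_affine_barrier c K (2 * G)
  set W₁ : ℝ → SobolevH 1 0 1 := fun s => p s + u s - Z₁ s with hW₁
  set W₂ : ℝ → SobolevH 1 0 1 := fun s => p s - u s - Z₂ s with hW₂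
  have v1 : ∀ t, ∀ x ∈ Icc (0 : ℝ) 1, pointVal (W₁ t) x =
      pointVal (p t) x + pointVal (u t) x - (c + 2 * G + K * t + -(2 * G) * x) := by
    intro t x hx
    simp only [hW₁]
    rw [pointVal_sub zero_lt_one _ _ hx]
    simp only [pointVal_add zero_lt_one _ _ hx, z1 t x hx]
  have v2 : ∀ t, ∀ x ∈ Icc (0 : ℝ) 1, pointVal (W₂ t) x =
      pointVal (p t) x - pointVal (u t) x - (c + K * t + 2 * G * x) := by
    intro t x hx
    simp only [hW₂]
    rw [pointVal_sub zero_lt_one _ _ hx]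
    simp only [pointVal_sub zero_lt_one _ _ hx, z2 t x hx]
  have m1 : ContDiff ℝ 1 fun _ : ℝ => (1 : ℝ) := contDiff_const
  have h01 : (0 : ℝ) ∈ Icc (0 : ℝ) 1 := by simp
  have h11 : (1 : ℝ) ∈ Icc (0 : ℝ) 1 := by simp
  set Y : ℝ → ℝ := fun s => (∫ x in Ioo 0 1, 1 * (max (pointVal (W₁ s) x) 0) ^ 2) +
    ∫ x in Ioo 0 1, 1 * (max (pointVal (W₂ s) x) 0) ^ 2 with hY
  have hYd : ∀ t ∈ Icc 0 T, ∃ Y', HasDerivWithinAt Y Y' (Icc 0 T) t ∧ Y' ≤ 0 := by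
    intro t ht
    have t1 := (h.transport_add ht).sub (z1' (Icc 0 T) t 1)
    have t2 := (h.transport_sub ht).sub (z2' (Icc 0 T) t (-1))
    refine ⟨_, (t1.hasDerivWithinAt m1 isQuadraticLike_posPart_sq).add
      (t2.hasDerivWithinAt m1 isQuadraticLike_posPart_sq), ?_⟩
    have i1 := t1.integrableOn m1.continuous isQuadraticLike_posPart_sq (W₁ t)
    have i2 := t2.integrableOn m1.continuous isQuadraticLike_posPart_sq (W₂ t)
    have hpt : ∀ x ∈ Ioo (0 : ℝ) 1,
        1 * (deriv (fun z : ℝ => (max z 0) ^ 2) (pointVal (W₁ t) x) *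
          (-a (pointVal (u t) x) - (K + 1 * -(2 * G)))) +
        1 * (deriv (fun z : ℝ => (max z 0) ^ 2) (pointVal (W₂ t) x) *
          (a (pointVal (u t) x) - (K + -1 * (2 * G)))) ≤ 0 := by
      intro x hx
      have hx' := Ioo_subset_Icc_self hx
      set w := G - 2 * G * x with hw
      have hwG : |w| ≤ G := by
        rw [abs_le]; constructor <;> nlinarith [hx.1, hx.2]
      have haw := abs_le.1 (haκ w hwG)
      have hdiff : pointVal (W₁ t) x - pointVal (W₂ t) x = 2 * (pointVal (u t) x - w) := by
        rw [v1 t x hx', v2 t x hx', hw]; ring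
      rw [deriv_posPart_sq, deriv_posPart_sq]
      set r := pointVal (W₁ t) x
      set s := pointVal (W₂ t) x
      set U := pointVal (u t) x
      have hr := le_max_right r 0
      have hs := le_max_right s 0
      -- Since `r - s = 2 (U - w)`, the factors have opposite signs; this is where the monotonicity
      -- of the damping enters.
      have hcross : (a U - a w) * (max s 0 - max r 0) ≤ 0 := by
        rcases le_total U w with hUw | hUw
        · have h1 : r ≤ s := by linarith
          exact mul_nonpos_of_nonpos_of_nonneg (sub_nonpos.2 (ha hUw))
            (sub_nonneg.2 (max_le_max_right 0 h1))
        · have h1 : s ≤ r := by linarith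
          exact mul_nonpos_of_nonneg_of_nonpos (sub_nonneg.2 (ha hUw))
            (sub_nonpos.2 (max_le_max_right 0 h1))
      rw [hK]
      nlinarith [mul_nonneg hr (show 0 ≤ a w + κ by linarith [haw.1]),
        mul_nonneg hs (show 0 ≤ κ - a w by linarith [haw.2])]
    have hint := setIntegral_nonpos (μ := volume) measurableSet_Ioo hpt
    rw [integral_add i1 i2] at hint
    -- Each end contributes the incoming minus the outgoing squared positive part. At `x = 0`, `g₀ ≤
    -- G = w(0)` puts `W₁` below `W₂`; at `x = 1`, `g₁ ≥ -G = w(1)` gives the reverse order, so both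
    -- contributions are nonpositive.
    have b0 : (max (pointVal (W₁ t) 0) 0) ^ 2 ≤ (max (pointVal (W₂ t) 0) 0) ^ 2 := by
      refine pow_le_pow_left₀ (le_max_right _ _) (max_le_max_right 0 ?_) 2
      rw [v1 t 0 h01, v2 t 0 h01, h.left t ht]
      linarith [(abs_le.1 (h₀ t ht)).2]
    have b1 : (max (pointVal (W₂ t) 1) 0) ^ 2 ≤ (max (pointVal (W₁ t) 1) 0) ^ 2 := by
      refine pow_le_pow_left₀ (le_max_right _ _) (max_le_max_right 0 ?_) 2
      rw [v1 t 1 h11, v2 t 1 h11, h.right t ht]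
      linarith [(abs_le.1 (h₁ t ht)).1]
    simp only [deriv_const, zero_mul, integral_zero]
    linarith
  choose! Y' hY1 hY2 using hYd
  have hYle := le_left_of_hasDerivAt_nonpos (T := T) (f := Y) (f' := Y')
    (fun t ht => (hY1 t ht).continuousWithinAt)
    (fun t ht => (hY1 t (Ioo_subset_Icc_self ht)).hasDerivAt (Icc_mem_nhds ht.1 ht.2))
    (fun t ht => hY2 t (Ioo_subset_Icc_self ht)) t ht
  have hY0 : Y 0 = 0 := by
    have e1 : ∀ x ∈ Ioo (0:ℝ) 1, 1 * (max (pointVal (W₁ 0) x) 0) ^ 2 = 0 := by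
      intro x hx
      rw [v1 0 x (Ioo_subset_Icc_self hx), h.init_p x (Ioo_subset_Icc_self hx),
        h.init_u x (Ioo_subset_Icc_self hx), max_eq_right]
      · ring
      · nlinarith [hx.1, hx.2]
    have e2 : ∀ x ∈ Ioo (0:ℝ) 1, 1 * (max (pointVal (W₂ 0) x) 0) ^ 2 = 0 := by
      intro x hx
      rw [v2 0 x (Ioo_subset_Icc_self hx), h.init_p x (Ioo_subset_Icc_self hx),
        h.init_u x (Ioo_subset_Icc_self hx), max_eq_right]
      · ring
      · nlinarith [hx.1, hx.2]
    simp only [hY]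
    rw [setIntegral_congr_fun measurableSet_Ioo e1, setIntegral_congr_fun measurableSet_Ioo e2]
    simp
  rw [hY0] at hYle
  have n1 : 0 ≤ ∫ x in Ioo 0 1, 1 * (max (pointVal (W₁ t) x) 0) ^ 2 :=
    integral_nonneg fun x => by positivity
  have n2 : 0 ≤ ∫ x in Ioo 0 1, 1 * (max (pointVal (W₂ t) x) 0) ^ 2 :=
    integral_nonneg fun x => by positivity
  simp only [hY] at hYle
  have r1 := pointVal_nonpos_of_integral_posPart_sq (v := W₁ t) (by linarith) x hx
  have r2 := pointVal_nonpos_of_integral_posPart_sq (v := W₂ t) (by linarith) x hx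
  rw [v1 t x hx] at r1
  rw [v2 t x hx] at r2
  have hK0 : 0 ≤ K := by positivity
  have hKt := mul_le_mul_of_nonneg_left ht.2 hK0
  constructor
  · nlinarith [hx.1, hx.2]
  · nlinarith [hx.1, hx.2]

/-- Twice the velocity is `(p + u - c) - (p - u - c)`; one invariant is bounded for the solution and
the other for its negative. -/
theorem IsClassicalSolution.abs_le (h : IsClassicalSolution T c g₀ g₁ a p u)
    (ha : Monotone a) {G κ : ℝ} (hG : 0 ≤ G) (hκ : 0 ≤ κ) (h₀ : ∀ t ∈ Icc 0 T, |g₀ t| ≤ G)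
    (h₁ : ∀ t ∈ Icc 0 T, |g₁ t| ≤ G) (haκ : ∀ w, |w| ≤ G → |a w| ≤ κ) {t : ℝ} (ht : t ∈ Icc 0 T)
    {x : ℝ} (hx : x ∈ Icc (0 : ℝ) 1) :
    |pointVal (u t) x| ≤ (2 * G + κ) * T + 2 * G := by
  have h1 := h.riemann_le ha hG hκ h₀ h₁ haκ ht hx
  have h2 := h.neg.riemann_le (G := G) (κ := κ) (fun y z hyz => neg_le_neg (ha (neg_le_neg hyz))) hG hκ
    (fun t ht => by simpa using h₀ t ht) (fun t ht => by simpa using h₁ t ht)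
    (fun w hw => by simpa using haκ (-w) (by simpa using hw)) ht hx
  rw [pointVal_neg zero_lt_one _ hx, pointVal_neg zero_lt_one _ hx] at h2
  rw [_root_.abs_le]
  constructor <;> linarith [h1.1, h1.2, h2.1, h2.2]

end Bounds

theorem exists_areStateBounds (B : ParamBounds) {T : ℝ} (hT : 0 < T) (c : ℝ) {g₀ g₁ : ℝ → ℝ}
    (hg₀ : ContinuousOn g₀ (Icc 0 T)) (hg₁ : ContinuousOn g₁ (Icc 0 T)) :
    ∃ umin umax : ℝ, AreStateBounds B T c g₀ g₁ umin umax := by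
  obtain ⟨C₀, hC₀⟩ := isCompact_Icc.exists_bound_of_continuousOn hg₀
  obtain ⟨C₁, hC₁⟩ := isCompact_Icc.exists_bound_of_continuousOn hg₁
  set G := |C₀| + |C₁| with hG
  have hG0 : 0 ≤ G := by positivity
  have b0 : ∀ t ∈ Icc 0 T, |g₀ t| ≤ G := fun t ht =>
    (hC₀ t ht).trans (by linarith [le_abs_self C₀, abs_nonneg C₁])
  have b1 : ∀ t ∈ Icc 0 T, |g₁ t| ≤ G := fun t ht =>
    (hC₁ t ht).trans (by linarith [le_abs_self C₁, abs_nonneg C₀])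
  have hκ : 0 ≤ B.a₁ * G := mul_nonneg B.a₁_pos.le hG0
  set N := (2 * G + B.a₁ * G) * T + 2 * G with hN
  have hN0 : 0 ≤ N := by positivity
  have hGN : G ≤ N := by
    have : 0 ≤ (2 * G + B.a₁ * G) * T := by positivity
    linarith
  -- The bound `N` uses `a` on `[-G, G]` only, which lies inside the proposed interval, so the
  -- constant `B.a₁` is available there. The extra `1` keeps the interval nondegenerate when the
  -- data vanish.
  refine ⟨-(N + 1), N + 1, by linarith, ⟨by linarith, by linarith⟩, ?_⟩
  intro B' a ha' ha p u hsol t ht x hx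
  have hlip := ha.lipschitz (by linarith : -(N + 1) < N + 1)
  have hb := hsol.abs_le ha'.monotone hG0 hκ b0 b1 (fun w hw => by
    have hwm := _root_.abs_le.1 hw
    have := hlip w ⟨by linarith, by linarith⟩ 0 ⟨by linarith, by linarith⟩
    rw [ha.2.2.1, sub_zero, sub_zero] at this
    exact this.trans (mul_le_mul_of_nonneg_left hw B.a₁_pos.le)) ht hx
  have := _root_.abs_le.1 hb
  exact ⟨by linarith, by linarith⟩

end

/-! ### Extension of an admissible parameter to the real line. -/

noncomputable section

theorem le_on_Icc_of_ae_le {α β C : ℝ} (hαβ : α < β) {f : ℝ → ℝ} (hf : ContinuousOn f (Icc α β))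
    (h : ∀ᵐ x ∂(volume.restrict (Ioo α β)), f x ≤ C) : ∀ x ∈ Icc α β, f x ≤ C := by
  have := ae_restrict_Ioo_eq_Icc_of_continuousOn hαβ (f := fun x => max (f x) C)
    (g := fun _ => C) (hf.sup continuousOn_const) continuousOn_const
    (h.mono fun x hx => max_eq_right hx)
  intro x hx
  exact max_eq_right_iff.1 (this hx)

theorem le_on_Icc_of_le_ae {α β C : ℝ} (hαβ : α < β) {f : ℝ → ℝ} (hf : ContinuousOn f (Icc α β))
    (h : ∀ᵐ x ∂(volume.restrict (Ioo α β)), C ≤ f x) : ∀ x ∈ Icc α β, C ≤ f x := by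
  intro x hx
  exact neg_le_neg_iff.1 (le_on_Icc_of_ae_le hαβ hf.neg (h.mono fun x hx => neg_le_neg hx) x hx)

theorem abs_exp_sub_exp_le {x y : ℝ} (hx : x ≤ 0) (hy : y ≤ 0) :
    |Real.exp x - Real.exp y| ≤ |x - y| := by
  wlog h : x ≤ y generalizing x y
  · rw [abs_sub_comm, abs_sub_comm x]
    exact this hy hx (le_of_not_ge h)
  rw [abs_sub_comm, abs_sub_comm x, abs_of_nonneg (sub_nonneg.2 (Real.exp_le_exp.2 h)),
    abs_of_nonneg (sub_nonneg.2 h)]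
  have e : Real.exp x = Real.exp y * Real.exp (x - y) := by rw [← Real.exp_add]; ring_nf
  have h1 := Real.add_one_le_exp (x - y)
  have h2 := Real.exp_le_one_iff.2 hy
  have h3 := Real.exp_pos y
  have h4 := Real.exp_le_one_iff.2 (show x - y ≤ 0 by linarith)
  rw [e]
  nlinarith

theorem HasWeakDeriv.of_hasDerivAt {f f' : ℝ → ℝ} (hf : ∀ x, HasDerivAt f (f' x) x)
    (hf' : Continuous f') : HasWeakDeriv univ f f' := by
  have e : deriv f = f' := funext fun x => (hf x).deriv
  have hc : ContDiff ℝ 1 f := by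
    rw [contDiff_one_iff_deriv, e]
    exact ⟨fun x => (hf x).differentiableAt, hf'⟩
  exact HasWeakDeriv.of_absolutelyContinuous
    (fun R => hc.contDiffOn.absolutelyContinuousOnInterval) (by rw [e])

theorem LipschitzWith.hasWeakDeriv {f : ℝ → ℝ} {K : ℝ≥0} (hf : LipschitzWith K f) :
    HasWeakDeriv univ f (deriv f) :=
  HasWeakDeriv.of_absolutelyContinuous
    (fun _ => hf.lipschitzOnWith.absolutelyContinuousOnInterval) (ae_eq_refl _)

theorem Continuous.hasDerivAt_primitive {f : ℝ → ℝ} (hf : Continuous f) (C x₀ x : ℝ) :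
    HasDerivAt (fun x => C + ∫ t in x₀..x, f t) (f x) x :=
  ((hf.integral_hasStrictDerivAt x₀ x).hasDerivAt).const_add C

/-- It limits how far the first derivative of the extended parameter can drift outside the original
interval. -/
theorem abs_integral_le_of_exp_decay_right {f : ℝ → ℝ} {k C β x : ℝ} (hk : 0 < k) (hC : 0 ≤ C)
    (hx : β ≤ x) (hf : ∀ s, β ≤ s → |f s| ≤ C * Real.exp (-k * (s - β))) :
    |∫ s in β..x, f s| ≤ C / k := by
  have hd : ∀ s : ℝ, HasDerivAt (fun s => -(C / k) * Real.exp (-k * (s - β)))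
      (C * Real.exp (-k * (s - β))) s := by
    intro s
    have := (((hasDerivAt_id s).sub_const β).const_mul (-k)).exp.const_mul (-(C / k))
    refine this.congr_deriv ?_
    simp only [id]
    field_simp
  have hi : ∫ s in β..x, C * Real.exp (-k * (s - β)) =
      -(C / k) * Real.exp (-k * (x - β)) - -(C / k) * Real.exp (-k * (β - β)) :=
    intervalIntegral.integral_eq_sub_of_hasDerivAt (fun s _ => hd s)
      (Continuous.intervalIntegrable (by fun_prop) _ _)
  have h1 : |∫ s in β..x, f s| ≤ ∫ s in β..x, C * Real.exp (-k * (s - β)) := by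
    have hg : Continuous fun s : ℝ => C * Real.exp (-k * (s - β)) := by fun_prop
    exact intervalIntegral.norm_integral_le_of_norm_le (f := f) (μ := volume) hx
      (Filter.Eventually.of_forall fun s hs => hf s hs.1.le) (hg.intervalIntegrable _ _)
  rw [hi] at h1
  have : 0 ≤ C / k * Real.exp (-k * (x - β)) := by positivity
  simp only [sub_self, mul_zero, Real.exp_zero] at h1
  linarith

theorem abs_integral_le_of_exp_decay_left {f : ℝ → ℝ} {k C α x : ℝ} (hk : 0 < k) (hC : 0 ≤ C)
    (hx : x ≤ α) (hf : ∀ s, s ≤ α → |f s| ≤ C * Real.exp (-k * (α - s))) :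
    |∫ s in x..α, f s| ≤ C / k := by
  have := abs_integral_le_of_exp_decay_right (f := fun s => f (-s)) (β := -α) (x := -x) hk hC
    (by linarith) (fun s hs => by
      refine (hf (-s) (by linarith)).trans (le_of_eq ?_)
      congr 2; ring)
  rwa [intervalIntegral.integral_comp_neg, neg_neg, neg_neg] at this

/-- An admissible parameter on an interval extends to an admissible parameter on `ℝ`. -/
theorem AdmissibleOn.exists_extension {B : ParamBounds} {α β : ℝ} {a : ℝ → ℝ} (hαβ : α < β)
    (ha : AdmissibleOn B (Ioo α β) a) :
    ∃ b b' : ℝ → ℝ, EqOn b a (Icc α β) ∧ (∀ x, HasDerivAt b (b' x) x) ∧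
      (∃ M : ℝ, 0 ≤ M ∧ ∀ x y, |b' x - b' y| ≤ M * |x - y|) ∧ (∃ L : ℝ, 0 ≤ L ∧ ∀ x, |b' x| ≤ L) ∧
      ∃ B' : ParamBounds, AdmissibleOn B' univ b := by
  obtain ⟨hc, h0, ha0, a', a'', a''', w1, w2, w3, hb⟩ := ha
  rw [closure_Ioo hαβ.ne] at hc h0
  have i3 := w3.integrableOn_of_bounded (hb.mono fun x hx => hx.2.2)
  have i2 := w2.integrableOn_of_bounded (hb.mono fun x hx => hx.2.1)
  have i1 := w1.integrableOn_of_bounded (C := |B.a₀| + |B.a₁|) (hb.mono fun x hx => by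
    rw [abs_le]
    constructor
    · linarith [neg_abs_le B.a₀, abs_nonneg B.a₁, hx.1.1]
    · linarith [le_abs_self B.a₁, abs_nonneg B.a₀, hx.1.2])
  obtain ⟨C₂, hC₂⟩ := w3.ae_eq_primitive hαβ i3
  obtain ⟨C₁, hC₁⟩ := w2.ae_eq_primitive hαβ i2
  set A₂ : ℝ → ℝ := fun x => C₂ + ∫ t in α..x, a''' t with hA₂
  set A₁ : ℝ → ℝ := fun x => C₁ + ∫ t in α..x, a'' t with hA₁
  have cA₂ : ContinuousOn A₂ (Icc α β) := continuousOn_primitive_Icc hαβ.le i3 C₂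
  have cA₁ : ContinuousOn A₁ (Icc α β) := continuousOn_primitive_Icc hαβ.le i2 C₁
  have A₂le : ∀ x ∈ Icc α β, |A₂ x| ≤ B.a₂ :=
    le_on_Icc_of_ae_le hαβ cA₂.abs (by
      filter_upwards [hC₂, hb] with x h1 h2
      rw [← h1]
      exact h2.2.1)
  have A₁le : ∀ x ∈ Icc α β, A₁ x ≤ B.a₁ :=
    le_on_Icc_of_ae_le hαβ cA₁ (by
      filter_upwards [hC₁, hb] with x h1 h2
      rw [← h1]
      exact h2.1.2)
  have leA₁ : ∀ x ∈ Icc α β, B.a₀ ≤ A₁ x :=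
    le_on_Icc_of_le_ae hαβ cA₁ (by
      filter_upwards [hC₁, hb] with x h1 h2
      rw [← h1]
      exact h2.1.1)
  have ii : ∀ z ∈ Icc α β, IntervalIntegrable a''' volume α z := by
    intro z hz
    rw [intervalIntegrable_iff_integrableOn_Ioo_of_le hz.1]
    exact i3.mono_set (Ioo_subset_Ioo_right hz.2)
  have lipA₂ : ∀ x ∈ Icc α β, ∀ y ∈ Icc α β, |A₂ x - A₂ y| ≤ B.a₃ * |x - y| := by
    intro x hx y hy
    wlog h : y ≤ x generalizing x y
    · rw [abs_sub_comm, abs_sub_comm x]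
      exact this y hy x hx (le_of_not_ge h)
    have e : A₂ x - A₂ y = ∫ t in y..x, a''' t := by
      simp only [hA₂]
      rw [← intervalIntegral.integral_interval_sub_left (ii x hx) (ii y hy)]
      ring
    have hbd := intervalIntegral_bounds i3 (hb.mono fun x hx => (abs_le.1 hx.2.2).1)
      (hb.mono fun x hx => (abs_le.1 hx.2.2).2) hy.1 h hx.2
    rw [e, abs_of_nonneg (sub_nonneg.2 h), abs_le]
    exact ⟨by linarith [hbd.1], hbd.2⟩
  -- the extension
  set π : ℝ → ℝ := fun x => (projIcc α β hαβ.le x : ℝ) with hπ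
  have πmem : ∀ x, π x ∈ Icc α β := fun x => (projIcc α β hαβ.le x).2
  have πid : ∀ x ∈ Icc α β, π x = x := fun x hx => by simp [hπ, projIcc_of_mem hαβ.le hx]
  have πlip : ∀ x y, |π x - π y| ≤ |x - y| := fun x y => by
    have := (LipschitzWith.projIcc hαβ.le).dist_le_mul x y
    rwa [NNReal.coe_one, one_mul, Subtype.dist_eq, Real.dist_eq, Real.dist_eq] at this
  have a₀p := B.a₀_pos
  have a₁p := B.a₁_pos
  have a₂p := B.a₂_pos
  have a₃p := B.a₃_pos
  -- This decay rate makes the total drift `B.a₂ / k` of the first derivative equal to `B.a₀ / 2`,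
  -- so the extension remains strictly increasing.
  set k := 2 * B.a₂ / B.a₀ with hk
  have kp : 0 < k := by positivity
  have hak : B.a₂ / k = B.a₀ / 2 := by rw [hk]; field_simp
  -- The second derivative is frozen at its end values and damped exponentially; this keeps it
  -- bounded and Lipschitz while making it integrable at infinity.
  set E₂ : ℝ → ℝ := fun x => A₂ (π x) * Real.exp (-k * |x - π x|) with hE₂
  have expn : ∀ x, -k * |x - π x| ≤ 0 := fun x => by
    have := mul_nonneg kp.le (abs_nonneg (x - π x)); linarith
  have E₂abs : ∀ x, |E₂ x| ≤ B.a₂ * Real.exp (-k * |x - π x|) := fun x => by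
    rw [hE₂, abs_mul, Real.abs_exp]
    exact mul_le_mul_of_nonneg_right (A₂le _ (πmem x)) (Real.exp_pos _).le
  have E₂le : ∀ x, |E₂ x| ≤ B.a₂ := fun x => (E₂abs x).trans
    (mul_le_of_le_one_right a₂p.le (Real.exp_le_one_iff.2 (expn x)))
  -- The first summand comes from `A₂`, the second from the exponential factor, since the distance
  -- `|x - π x|` changes by at most `2 |x - y|`.
  set K := B.a₃ + 2 * (B.a₂ * k) with hK
  have Kp : 0 < K := by positivity
  have E₂lip' : ∀ x y, |E₂ x - E₂ y| ≤ K * |x - y| := by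
    intro x y
    have e1 : E₂ x - E₂ y = (A₂ (π x) - A₂ (π y)) * Real.exp (-k * |x - π x|) +
        A₂ (π y) * (Real.exp (-k * |x - π x|) - Real.exp (-k * |y - π y|)) := by
      simp only [hE₂]; ring
    have e2 : |(A₂ (π x) - A₂ (π y)) * Real.exp (-k * |x - π x|)| ≤ B.a₃ * |x - y| := by
      rw [abs_mul, Real.abs_exp]
      calc _ ≤ |A₂ (π x) - A₂ (π y)| * 1 :=
            mul_le_mul_of_nonneg_left (Real.exp_le_one_iff.2 (expn x)) (abs_nonneg _)
        _ ≤ B.a₃ * |π x - π y| := by rw [mul_one]; exact lipA₂ _ (πmem x) _ (πmem y)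
        _ ≤ _ := mul_le_mul_of_nonneg_left (πlip x y) a₃p.le
    have e3 : |Real.exp (-k * |x - π x|) - Real.exp (-k * |y - π y|)| ≤ k * (2 * |x - y|) := by
      refine (abs_exp_sub_exp_le (expn x) (expn y)).trans ?_
      rw [← mul_sub, abs_mul, abs_neg, abs_of_pos kp]
      refine mul_le_mul_of_nonneg_left ?_ kp.le
      refine (abs_abs_sub_abs_le_abs_sub _ _).trans ?_
      rw [show x - π x - (y - π y) = (x - y) - (π x - π y) by ring]
      exact (abs_sub _ _).trans (by linarith [πlip x y])
    have e4 : |A₂ (π y) * (Real.exp (-k * |x - π x|) - Real.exp (-k * |y - π y|))| ≤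
        B.a₂ * (k * (2 * |x - y|)) := by
      rw [abs_mul]
      exact mul_le_mul (A₂le _ (πmem y)) e3 (abs_nonneg _) a₂p.le
    rw [e1]
    refine (abs_add_le _ _).trans ?_
    rw [hK]
    linarith
  have E₂lip : LipschitzWith ⟨K, Kp.le⟩ E₂ := LipschitzWith.of_dist_le_mul fun x y => by
    rw [Real.dist_eq, Real.dist_eq]
    exact E₂lip' x y
  have cE₂ : Continuous E₂ := E₂lip.continuous
  set E₁ : ℝ → ℝ := fun x => C₁ + ∫ t in α..x, E₂ t with hE₁
  have dE₁ : ∀ x, HasDerivAt E₁ (E₂ x) x := fun x => cE₂.hasDerivAt_primitive C₁ α x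
  have cE₁ : Continuous E₁ := continuous_iff_continuousAt.2 fun x => (dE₁ x).continuousAt
  set E₀ : ℝ → ℝ := fun x => a α + ∫ t in α..x, E₁ t with hE₀
  have dE₀ : ∀ x, HasDerivAt E₀ (E₁ x) x := fun x => cE₁.hasDerivAt_primitive (a α) α x
  have E₂eq : ∀ x ∈ Icc α β, E₂ x = A₂ x := fun x hx => by simp [hE₂, πid x hx]
  have intcongr : ∀ (f g : ℝ → ℝ), f =ᵐ[volume.restrict (Ioo α β)] g → ∀ x ∈ Icc α β,
      ∫ t in α..x, f t = ∫ t in α..x, g t := by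
    intro f g hfg x hx
    rw [intervalIntegral.integral_of_le hx.1, intervalIntegral.integral_of_le hx.1,
      integral_Ioc_eq_integral_Ioo, integral_Ioc_eq_integral_Ioo]
    exact integral_congr_ae
      (ae_restrict_of_ae_restrict_of_subset (Ioo_subset_Ioo_right hx.2) hfg)
  have E₁eq : ∀ x ∈ Icc α β, E₁ x = A₁ x := by
    intro x hx
    simp only [hE₁, hA₁]
    congr 1
    refine intcongr _ _ ?_ x hx
    filter_upwards [hC₂, ae_restrict_mem measurableSet_Ioo] with t h1 h2
    rw [h1, E₂eq t (Ioo_subset_Icc_self h2)]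
  have E₀eq : ∀ x ∈ Icc α β, E₀ x = a x := by
    intro x hx
    rw [w1.eq_primitive hαβ i1 hc x hx]
    simp only [hE₀]
    congr 1
    refine intcongr _ _ ?_ x hx
    filter_upwards [hC₁, ae_restrict_mem measurableSet_Ioo] with t h1 h2
    rw [h1, E₁eq t (Ioo_subset_Icc_self h2)]
  have hE₁b : ∀ x, B.a₀ / 2 ≤ E₁ x ∧ E₁ x ≤ B.a₁ + B.a₀ := by
    intro x
    have hii : ∀ y z : ℝ, IntervalIntegrable E₂ volume y z := fun y z =>
      cE₂.intervalIntegrable _ _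
    rcases lt_or_ge x α with hxα | hxα
    · have e : E₁ x = E₁ α - ∫ t in x..α, E₂ t := by
        simp only [hE₁, intervalIntegral.integral_same]
        rw [intervalIntegral.integral_symm x α]; ring
      have hb2 := abs_integral_le_of_exp_decay_left (f := E₂) kp a₂p.le hxα.le (fun s hs => by
        have hπs : π s = α := by simp [hπ, projIcc_of_le_left hαβ.le hs]
        have := E₂abs s
        rwa [hπs, abs_sub_comm, abs_of_nonneg (sub_nonneg.2 hs)] at this)
      rw [hak] at hb2
      have hm : α ∈ Icc α β := left_mem_Icc.2 hαβ.le
      rw [e, E₁eq α hm]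
      have := abs_le.1 hb2
      constructor <;> linarith [leA₁ α hm, A₁le α hm]
    rcases lt_or_ge β x with hxβ | hxβ
    · have e : E₁ x = E₁ β + ∫ t in β..x, E₂ t := by
        simp only [hE₁]
        rw [add_assoc, intervalIntegral.integral_add_adjacent_intervals (hii _ _) (hii _ _)]
      have hb2 := abs_integral_le_of_exp_decay_right (f := E₂) kp a₂p.le hxβ.le (fun s hs => by
        have hπs : π s = β := by simp [hπ, projIcc_of_right_le hαβ.le hs]
        have := E₂abs s
        rwa [hπs, abs_of_nonneg (sub_nonneg.2 hs)] at this)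
      rw [hak] at hb2
      have hm : β ∈ Icc α β := right_mem_Icc.2 hαβ.le
      rw [e, E₁eq β hm]
      have := abs_le.1 hb2
      constructor <;> linarith [leA₁ β hm, A₁le β hm]
    · have hm : x ∈ Icc α β := ⟨hxα, hxβ⟩
      rw [E₁eq x hm]
      constructor <;> linarith [leA₁ x hm, A₁le x hm]
  have hE₁abs : ∀ x, |E₁ x| ≤ B.a₁ + B.a₀ := fun x => by
    rw [abs_of_nonneg (by linarith [(hE₁b x).1])]
    exact (hE₁b x).2
  refine ⟨E₀, E₁, E₀eq, dE₀, ⟨B.a₂, a₂p.le, ?_⟩, ⟨B.a₁ + B.a₀, by positivity, hE₁abs⟩,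
    ⟨B.a₀ / 2, B.a₁ + B.a₀, B.a₂, K, by positivity, by positivity, a₂p, Kp⟩, ?_, ?_, ?_,
    E₁, E₂, deriv E₂, HasWeakDeriv.of_hasDerivAt dE₀ cE₁, HasWeakDeriv.of_hasDerivAt dE₁ cE₂,
    E₂lip.hasWeakDeriv, ?_⟩
  · intro x y
    have := Convex.norm_image_sub_le_of_norm_hasDerivWithin_le (f := E₁) (s := univ) (C := B.a₂)
      (fun x _ => (dE₁ x).hasDerivWithinAt) (fun x _ => E₂le x) convex_univ (mem_univ y)
      (mem_univ x)
    exact this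
  · exact (continuous_iff_continuousAt.2 fun x => (dE₀ x).continuousAt).continuousOn
  · simp
  · rw [E₀eq 0 h0, ha0]
  · refine Filter.Eventually.of_forall fun x => ⟨hE₁b x, E₂le x, ?_⟩
    have := norm_deriv_le_of_lipschitz E₂lip (x₀ := x)
    exact this

end

/-! ### Fubini along characteristics. -/

noncomputable section

section Fubini

theorem integrable_prod_of_bounded {f : ℝ → ℝ → ℝ} (hf : Measurable (Function.uncurry f)) {C : ℝ}
    (hC : ∀ x y, |f x y| ≤ C) (a b c d : ℝ) :
    Integrable (Function.uncurry f)
      ((volume.restrict (Ioc a b)).prod (volume.restrict (Ioc c d))) :=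
  Integrable.mono' (integrable_const C) hf.aestronglyMeasurable
    (Filter.Eventually.of_forall fun z => hC z.1 z.2)

theorem intervalIntegral_swap {f : ℝ → ℝ → ℝ} (hf : Measurable (Function.uncurry f)) {C : ℝ}
    (hC : ∀ x y, |f x y| ≤ C) {a b c d : ℝ} (hab : a ≤ b) (hcd : c ≤ d) :
    ∫ x in a..b, ∫ y in c..d, f x y = ∫ y in c..d, ∫ x in a..b, f x y := by
  simp only [intervalIntegral.integral_of_le hab, intervalIntegral.integral_of_le hcd]
  exact integral_integral_swap (integrable_prod_of_bounded hf hC a b c d)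

theorem intervalIntegrable_integral {f : ℝ → ℝ → ℝ} (hf : Measurable (Function.uncurry f)) {C : ℝ}
    (hC : ∀ x y, |f x y| ≤ C) {a b c d : ℝ} (hab : a ≤ b) (hcd : c ≤ d) :
    IntervalIntegrable (fun y => ∫ x in a..b, f x y) volume c d := by
  simp only [intervalIntegral.integral_of_le hab]
  rw [intervalIntegrable_iff_integrableOn_Ioc_of_le hcd]
  exact (integrable_prod_of_bounded hf hC a b c d).integral_prod_right

theorem intervalIntegral_indicator_Iic {f : ℝ → ℝ} {s t : ℝ} (h0 : 0 ≤ s) (hst : s ≤ t) :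
    ∫ τ in (0:ℝ)..t, (if τ ≤ s then f τ else 0) = ∫ τ in (0:ℝ)..s, f τ := by
  rw [intervalIntegral.integral_of_le h0, intervalIntegral.integral_of_le (h0.trans hst)]
  have e : (fun τ => if τ ≤ s then f τ else 0) = (Iic s).indicator f := by
    ext τ; simp [indicator_apply]
  rw [e, setIntegral_indicator measurableSet_Iic]
  congr 2
  ext τ
  simp only [mem_inter_iff, mem_Ioc, mem_Iic]
  constructor
  · rintro ⟨⟨h1, -⟩, h2⟩; exact ⟨h1, h2⟩
  · rintro ⟨h1, h2⟩; exact ⟨⟨h1, h2.trans hst⟩, h2⟩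

theorem intervalIntegral_indicator_Ici {f : ℝ → ℝ} {τ t : ℝ} (h0 : 0 ≤ τ) (hτt : τ ≤ t) :
    ∫ s in (0:ℝ)..t, (if τ ≤ s then f s else 0) = ∫ s in τ..t, f s := by
  rw [intervalIntegral.integral_of_le hτt, intervalIntegral.integral_of_le (h0.trans hτt)]
  have e : (fun s => if τ ≤ s then f s else 0) = (Ici τ).indicator f := by
    ext s; simp [indicator_apply]
  rw [e, setIntegral_indicator measurableSet_Ici]
  refine setIntegral_congr_set ?_
  have h1 : (Ioc 0 t ∩ Ioi τ : Set ℝ) = Ioc τ t := by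
    ext s
    simp only [mem_inter_iff, mem_Ioc, mem_Ioi]
    constructor
    · rintro ⟨⟨-, h1⟩, h2⟩; exact ⟨h2, h1⟩
    · rintro ⟨h1, h2⟩; exact ⟨⟨h0.trans_lt h1, h2⟩, h1⟩
  rw [← h1]
  exact (ae_eq_refl _).inter Ioi_ae_eq_Ici.symm

/-- Fubini on a square, applied to the integrand cut off to the triangle `τ ≤ s`. -/
theorem intervalIntegral_triangle_swap {f : ℝ → ℝ → ℝ} (hf : Measurable (Function.uncurry f))
    {C : ℝ} (hC : ∀ x y, |f x y| ≤ C) {t : ℝ} (ht : 0 ≤ t) :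
    (∫ s in (0:ℝ)..t, ∫ τ in (0:ℝ)..s, f s τ = ∫ τ in (0:ℝ)..t, ∫ s in τ..t, f s τ) ∧
      IntervalIntegrable (fun τ => ∫ s in τ..t, f s τ) volume 0 t := by
  set k : ℝ → ℝ → ℝ := fun s τ => if τ ≤ s then f s τ else 0 with hk
  have hkm : Measurable (Function.uncurry k) :=
    Measurable.ite (measurableSet_le measurable_snd measurable_fst) hf measurable_const
  have hC0 : 0 ≤ C := (abs_nonneg _).trans (hC 0 0)
  have hkC : ∀ x y, |k x y| ≤ C := fun x y => by
    simp only [hk]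
    split_ifs
    · exact hC x y
    · simpa using hC0
  have hin : ∀ τ ∈ Icc 0 t, ∫ s in (0:ℝ)..t, k s τ = ∫ s in τ..t, f s τ := fun τ hτ =>
    intervalIntegral_indicator_Ici hτ.1 hτ.2
  constructor
  · have e1 : ∫ s in (0:ℝ)..t, ∫ τ in (0:ℝ)..s, f s τ =
        ∫ s in (0:ℝ)..t, ∫ τ in (0:ℝ)..t, k s τ := by
      refine intervalIntegral.integral_congr fun s hs => ?_
      rw [uIcc_of_le ht] at hs
      exact (intervalIntegral_indicator_Iic (f := f s) hs.1 hs.2).symm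
    rw [e1, intervalIntegral_swap hkm hkC ht ht]
    refine intervalIntegral.integral_congr fun τ hτ => ?_
    rw [uIcc_of_le ht] at hτ
    exact hin τ hτ
  · refine (intervalIntegrable_integral hkm hkC ht ht).congr_ae ?_
    refine (ae_restrict_iff' measurableSet_uIoc).2 (Filter.Eventually.of_forall fun τ hτ => ?_)
    rw [uIoc_of_le ht] at hτ
    exact hin τ (Ioc_subset_Icc_self hτ)

/-- The divergence theorem for the solution `V` of `∂ₜV + ∂ᵧV = G`, `V(·, 0) = 0`. -/
theorem integral_characteristic_identity {G : ℝ → ℝ → ℝ} (hG : Measurable (Function.uncurry G))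
    {C : ℝ} (hC : ∀ y t, |G y t| ≤ C) {t y₁ y₂ : ℝ} (ht : 0 ≤ t) (hy : y₁ ≤ y₂) :
    (∫ z in y₁..y₂, ∫ τ in (0:ℝ)..t, G (z - t + τ) τ) +
      ((∫ s in (0:ℝ)..t, ∫ τ in (0:ℝ)..s, G (y₂ - s + τ) τ) -
        ∫ s in (0:ℝ)..t, ∫ τ in (0:ℝ)..s, G (y₁ - s + τ) τ) =
      ∫ z in y₁..y₂, ∫ τ in (0:ℝ)..t, G z τ := by
  have m1 : Measurable (Function.uncurry fun z τ : ℝ => G (z - t + τ) τ) :=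
    hG.comp (f := fun w : ℝ × ℝ => (w.1 - t + w.2, w.2)) (by fun_prop)
  have m2 : ∀ y : ℝ, Measurable (Function.uncurry fun s τ : ℝ => G (y - s + τ) τ) := fun y =>
    hG.comp (f := fun w : ℝ × ℝ => (y - w.1 + w.2, w.2)) (by fun_prop)
  have b2 := fun y : ℝ => intervalIntegral_triangle_swap (m2 y) (fun _ _ => hC _ _) ht
  rw [intervalIntegral_swap m1 (fun _ _ => hC _ _) hy ht, intervalIntegral_swap hG hC hy ht,
    (b2 y₁).1, (b2 y₂).1, ← intervalIntegral.integral_sub (b2 y₂).2 (b2 y₁).2,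
    ← intervalIntegral.integral_add (intervalIntegrable_integral m1 (fun _ _ => hC _ _) hy ht)
      ((b2 y₂).2.sub (b2 y₁).2)]
  -- For fixed `τ` all terms are integrals of `G(·, τ)`: over `[y₁, y₂]` shifted by `τ - t`, plus
  -- from the shifted `y₂` to `y₂`, minus from the shifted `y₁` to `y₁`. Together they give the
  -- integral over `[y₁, y₂]`.
  refine intervalIntegral.integral_congr fun τ _ => ?_
  have hii : ∀ a b : ℝ, IntervalIntegrable (fun z => G z τ) volume a b := fun a b => by
    rw [intervalIntegrable_iff]
    refine Integrable.mono' (g := fun _ => C) (integrableOn_const (by simp)) ?_ ?_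
    · exact (hG.comp (f := fun z : ℝ => (z, τ)) (by fun_prop)).aestronglyMeasurable
    · exact Filter.Eventually.of_forall fun z => hC z τ
  have e1 : ∫ z in y₁..y₂, G (z - t + τ) τ = ∫ z in (y₁ - t + τ)..(y₂ - t + τ), G z τ := by
    have := intervalIntegral.integral_comp_add_right (a := y₁) (b := y₂) (fun z => G z τ) (-t + τ)
    simp only [← add_assoc, ← sub_eq_add_neg] at this
    exact this
  have e2 : ∀ y : ℝ, ∫ s in τ..t, G (y - s + τ) τ = ∫ z in (y - t + τ)..y, G z τ := fun y => by
    have := intervalIntegral.integral_comp_sub_left (a := τ) (b := t) (fun z => G z τ) (y + τ)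
    rw [show y + τ - t = y - t + τ by ring, show y + τ - τ = y by ring] at this
    rw [← this]
    refine intervalIntegral.integral_congr fun s _ => ?_
    congr 1; ring
  simp only [e1, e2]
  have hsub : ∀ a b : ℝ, ∫ z in a..b, G z τ = (∫ z in (0:ℝ)..b, G z τ) - ∫ z in (0:ℝ)..a, G z τ :=
    fun a b => (intervalIntegral.integral_interval_sub_left (hii 0 b) (hii 0 a)).symm
  rw [hsub (y₁ - t + τ), hsub (y₂ - t + τ), hsub (y₁ - t + τ), hsub y₁]
  ring

end Fubini

end

/-! ### Fixed point argument for semilinear transport. -/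

noncomputable section

section FixedPoint

/-- The time `t` clamped to `[0, T]`. -/
def clampTime (T t : ℝ) : ℝ := max 0 (min T t)

theorem clampTime_mem {T : ℝ} (hT : 0 ≤ T) (t : ℝ) : clampTime T t ∈ Icc 0 T :=
  ⟨le_max_left _ _, max_le hT (min_le_left _ _)⟩

theorem clampTime_of_mem {T t : ℝ} (ht : t ∈ Icc 0 T) : clampTime T t = t := by
  rw [clampTime, min_eq_right ht.2, max_eq_right ht.1]

theorem continuous_clampTime (T : ℝ) : Continuous (clampTime T) := by
  unfold clampTime
  fun_prop

theorem countable_setOf_add_mem_range_intCast (y : ℝ) :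
    {τ : ℝ | y + τ ∈ range ((↑) : ℤ → ℝ)}.Countable := by
  have : {τ : ℝ | y + τ ∈ range ((↑) : ℤ → ℝ)} ⊆ range fun n : ℤ => (n : ℝ) - y := by
    rintro τ ⟨n, hn⟩
    exact ⟨n, by simp only [hn]; ring⟩
  exact (countable_range _).mono this

/-- Integrals along characteristics of a source that is continuous away from integer positions
are continuous. -/
theorem continuous_integral_characteristic {T C : ℝ} (hT : 0 ≤ T) {G : ℝ → ℝ → ℝ}
    (hGm : Measurable (Function.uncurry G))
    (hGc : ∀ y t : ℝ, y ∉ range ((↑) : ℤ → ℝ) → ContinuousAt (Function.uncurry G) (y, t))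
    (hGb : ∀ y, ∀ t ∈ Icc 0 T, |G y t| ≤ C) :
    Continuous fun z : ℝ × ℝ =>
      ∫ τ in (0:ℝ)..clampTime T z.2, G (z.1 - clampTime T z.2 + τ) τ := by
  have hC : 0 ≤ C := (abs_nonneg _).trans (hGb 0 0 ⟨le_rfl, hT⟩)
  have e : (fun z : ℝ × ℝ =>
      ∫ τ in (0:ℝ)..clampTime T z.2, G (z.1 - clampTime T z.2 + τ) τ) = fun z =>
      ∫ τ in Ioc 0 T, if τ ≤ clampTime T z.2 then G (z.1 - clampTime T z.2 + τ) τ else 0 := by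
    ext z
    have hm := clampTime_mem hT z.2
    rw [← intervalIntegral.integral_of_le hT, intervalIntegral_indicator_Iic hm.1 hm.2]
  rw [e, continuous_iff_continuousAt]
  intro z₀
  refine continuousAt_of_dominated (bound := fun _ => C) ?_ ?_ (integrable_const C) ?_
  · refine Filter.Eventually.of_forall fun z => Measurable.aestronglyMeasurable ?_
    refine Measurable.ite (measurableSet_le measurable_id measurable_const) ?_ measurable_const
    exact hGm.comp (f := fun τ : ℝ => (z.1 - clampTime T z.2 + τ, τ)) (by fun_prop)
  · refine Filter.Eventually.of_forall fun z => ?_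
    filter_upwards [ae_restrict_mem measurableSet_Ioc] with τ hτ
    split_ifs
    · exact hGb _ _ (Ioc_subset_Icc_self hτ)
    · simpa using hC
  -- The integrand is continuous in `z` at `z₀` except for the final time and the countably many `τ`
  -- at which the characteristic meets an integer; dominated convergence ignores them.
  · have h1 : ∀ᵐ τ ∂(volume.restrict (Ioc 0 T)), τ ≠ clampTime T z₀.2 :=
      ae_restrict_of_ae (by simp [ae_iff, measure_singleton])
    have h2 : ∀ᵐ τ ∂(volume.restrict (Ioc 0 T)),
        τ ∉ {τ : ℝ | z₀.1 - clampTime T z₀.2 + τ ∈ range ((↑) : ℤ → ℝ)} :=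
      ae_restrict_of_ae ((countable_setOf_add_mem_range_intCast _).ae_notMem volume)
    filter_upwards [h1, h2] with τ hτ1 hτ2
    have hcl : Continuous fun z : ℝ × ℝ => clampTime T z.2 :=
      (continuous_clampTime T).comp continuous_snd
    rcases lt_or_gt_of_ne hτ1 with h | h
    · have hev : ∀ᶠ z in nhds z₀, τ < clampTime T z.2 :=
        hcl.continuousAt.eventually (lt_mem_nhds h)
      have hcont : ContinuousAt (fun z : ℝ × ℝ => G (z.1 - clampTime T z.2 + τ) τ) z₀ :=
        ContinuousAt.comp (g := Function.uncurry G)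
          (f := fun z : ℝ × ℝ => (z.1 - clampTime T z.2 + τ, τ)) (hGc _ _ hτ2)
          (by fun_prop)
      refine hcont.congr ?_
      filter_upwards [hev] with z hz
      rw [if_pos hz.le]
    · have hev : ∀ᶠ z in nhds z₀, clampTime T z.2 < τ :=
        hcl.continuousAt.eventually (gt_mem_nhds h)
      refine (continuousAt_const (y := (0 : ℝ))).congr ?_
      filter_upwards [hev] with z hz
      rw [if_neg (not_le.2 hz)]

/-- Continuous functions on `ℝ × ℝ`, `2`-periodic in space, bounded by `C * exp (μ * t)` at the
times `t ∈ [0, T]`. -/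
structure IsPeriodicBounded (T C μ : ℝ) (V : ℝ → ℝ → ℝ) : Prop where
  cont : Continuous (Function.uncurry V)
  periodic : ∀ y t, V (y + 2) t = V y t
  bound : ∀ y, ∀ t ∈ Icc 0 T, |V y t| ≤ C * Real.exp (μ * t)

theorem integral_exp_mul_le {μ : ℝ} (hμ : 0 < μ) (t : ℝ) :
    ∫ s in (0:ℝ)..t, Real.exp (μ * s) = (Real.exp (μ * t) - 1) / μ := by
  have hd : ∀ s : ℝ, HasDerivAt (fun s => Real.exp (μ * s) / μ) (Real.exp (μ * s)) s := by
    intro s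
    have := ((((hasDerivAt_id s).const_mul μ).exp).div_const μ)
    refine this.congr_deriv ?_
    simp only [id]
    field_simp
  rw [intervalIntegral.integral_eq_sub_of_hasDerivAt (fun s _ => hd s)
    (Continuous.intervalIntegrable (by fun_prop) _ _)]
  simp only [mul_zero, Real.exp_zero]
  ring

theorem abs_integral_le_of_le_exp {f : ℝ → ℝ} {C μ t : ℝ} (hμ : 0 < μ)
    (ht : 0 ≤ t) (hf : ∀ s ∈ Icc 0 t, |f s| ≤ C * Real.exp (μ * s)) :
    |∫ s in (0:ℝ)..t, f s| ≤ C / μ * Real.exp (μ * t) - C / μ := by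
  have hg : Continuous fun s : ℝ => C * Real.exp (μ * s) := by fun_prop
  have h1 := intervalIntegral.norm_integral_le_of_norm_le (f := f) (μ := volume) ht
    (Filter.Eventually.of_forall fun s hs => hf s (Ioc_subset_Icc_self hs))
    (hg.intervalIntegrable _ _)
  rw [intervalIntegral.integral_const_mul, integral_exp_mul_le hμ] at h1
  refine h1.trans (le_of_eq ?_)
  ring

/-- A semilinear transport equation `∂ₜV + ∂ᵧV = N V` with zero initial values, in integrated
form, has a periodic solution. -/
theorem exists_transport_solution {T C μ L lam : ℝ} (hT : 0 ≤ T) (hC : 0 ≤ C) (hμ : 0 < μ)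
    (hL : 0 ≤ L) (hlam : L < lam) {N : (ℝ → ℝ → ℝ) → ℝ → ℝ → ℝ}
    (hm : ∀ V, IsPeriodicBounded T C μ V → Measurable (Function.uncurry (N V)))
    (hc : ∀ V, IsPeriodicBounded T C μ V → ∀ y t : ℝ, y ∉ range ((↑) : ℤ → ℝ) →
      ContinuousAt (Function.uncurry (N V)) (y, t))
    (hp : ∀ V, IsPeriodicBounded T C μ V → ∀ y t, N V (y + 2) t = N V y t)
    (hb : ∀ V, IsPeriodicBounded T C μ V → ∀ y, ∀ t ∈ Icc 0 T,
      |N V y t| ≤ μ * C * Real.exp (μ * t))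
    (hl : ∀ V W, IsPeriodicBounded T C μ V → IsPeriodicBounded T C μ W → ∀ δ, 0 ≤ δ →
      (∀ y, ∀ t ∈ Icc 0 T, |V y t - W y t| ≤ δ * Real.exp (lam * t)) →
      ∀ y, ∀ t ∈ Icc 0 T, |N V y t - N W y t| ≤ L * δ * Real.exp (lam * t)) :
    ∃ V, IsPeriodicBounded T C μ V ∧
      ∀ y, ∀ t ∈ Icc 0 T, V y t = ∫ τ in (0:ℝ)..t, N V (y - t + τ) τ := by
  have hlam0 : 0 < lam := hL.trans_lt hlam
  let X := BoundedContinuousFunction (ℝ × ℝ) ℝ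
  -- The unknown is stored as `Z = exp(-lam t) V`, so the supremum norm of `Z` is the weighted norm
  -- in which the map contracts. Clamping the time makes `Z` bounded on the whole plane.
  let Φ : X → ℝ → ℝ → ℝ := fun Z y t => Real.exp (lam * clampTime T t) * Z (y, t)
  have hΦ : ∀ (Z : X) y, ∀ t ∈ Icc 0 T, Φ Z y t = Real.exp (lam * t) * Z (y, t) :=
    fun Z y t ht => by simp only [Φ, clampTime_of_mem ht]
  let s : Set X := {Z | (∀ y t, Z (y + 2, t) = Z (y, t)) ∧
    ∀ y, ∀ t ∈ Icc 0 T, Real.exp (lam * t) * |Z (y, t)| ≤ C * Real.exp (μ * t)}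
  have hev : ∀ z : ℝ × ℝ, Continuous fun Z : X => Z z :=
    fun z => (BoundedContinuousFunction.lipschitz_eval_const z).continuous
  have hs : IsClosed s := by
    simp only [s, ofPred_and, ofPred_forall]
    refine IsClosed.inter (isClosed_iInter fun y => isClosed_iInter fun t =>
      isClosed_eq (hev _) (hev _)) (isClosed_iInter fun y => isClosed_iInter fun t =>
      isClosed_iInter fun _ => isClosed_le ?_ continuous_const)
    exact continuous_const.mul (hev _).abs
  have hΦs : ∀ Z ∈ s, IsPeriodicBounded T C μ (Φ Z) := by
    intro Z hZ
    refine ⟨?_, fun y t => ?_, fun y t ht => ?_⟩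
    · have h1 : Continuous fun w : ℝ × ℝ => Z (w.1, w.2) := Z.continuous
      have h2 : Continuous fun w : ℝ × ℝ => clampTime T w.2 :=
        (continuous_clampTime T).comp continuous_snd
      exact (Real.continuous_exp.comp (continuous_const.mul h2)).mul h1
    · simp only [Φ, hZ.1 y t]
    · rw [hΦ Z y t ht, abs_mul, Real.abs_exp]
      exact hZ.2 y t ht
  have hex : ∀ Z : s, ∃ Z' : s, ∀ y t, (Z' : X) (y, t) = Real.exp (-lam * clampTime T t) *
      ∫ τ in (0:ℝ)..clampTime T t, N (Φ Z) (y - clampTime T t + τ) τ := by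
    intro Z
    have hZ := hΦs Z Z.2
    have hint : ∀ y t, |∫ τ in (0:ℝ)..clampTime T t, N (Φ Z) (y - clampTime T t + τ) τ| ≤
        C * Real.exp (μ * clampTime T t) := by
      intro y t
      have htm := clampTime_mem hT t
      have := abs_integral_le_of_le_exp (f := fun τ => N (Φ Z) (y - clampTime T t + τ) τ) hμ
        htm.1
        (fun τ hτ => hb _ hZ _ _ ⟨hτ.1, hτ.2.trans htm.2⟩)
      -- The source bound `μ C exp(μ τ)` integrates to at most `C exp(μ t)`, so the growth bound
      -- reproduces itself.
      rw [mul_div_cancel_left₀ C hμ.ne'] at this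
      linarith
    have hcont := continuous_integral_characteristic hT (hm _ hZ) (hc _ hZ)
      (C := μ * C * Real.exp (μ * T)) (fun y t ht => (hb _ hZ y t ht).trans
        (mul_le_mul_of_nonneg_left (Real.exp_le_exp.2 (mul_le_mul_of_nonneg_left ht.2 hμ.le))
          (mul_nonneg hμ.le hC)))
    have hcl : Continuous fun w : ℝ × ℝ => clampTime T w.2 :=
      (continuous_clampTime T).comp continuous_snd
    let Z' : X := BoundedContinuousFunction.ofNormedAddCommGroup
      (fun z : ℝ × ℝ => Real.exp (-lam * clampTime T z.2) *
        ∫ τ in (0:ℝ)..clampTime T z.2, N (Φ Z) (z.1 - clampTime T z.2 + τ) τ)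
      ((Real.continuous_exp.comp (continuous_const.mul hcl)).mul hcont)
      (C * Real.exp (μ * T)) (fun z => by
        have htm := clampTime_mem hT z.2
        rw [Real.norm_eq_abs, abs_mul, Real.abs_exp]
        have h1 : Real.exp (-lam * clampTime T z.2) ≤ 1 :=
          Real.exp_le_one_iff.2 (by nlinarith [htm.1])
        have h2 := hint z.1 z.2
        have h3 : C * Real.exp (μ * clampTime T z.2) ≤ C * Real.exp (μ * T) :=
          mul_le_mul_of_nonneg_left
            (Real.exp_le_exp.2 (mul_le_mul_of_nonneg_left htm.2 hμ.le)) hC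
        calc _ ≤ 1 * (C * Real.exp (μ * T)) :=
              mul_le_mul h1 (h2.trans h3) (abs_nonneg _) zero_le_one
          _ = _ := one_mul _)
    have hZ' : ∀ y t, Z' (y, t) = Real.exp (-lam * clampTime T t) *
        ∫ τ in (0:ℝ)..clampTime T t, N (Φ Z) (y - clampTime T t + τ) τ := fun y t => rfl
    refine ⟨⟨Z', ⟨fun y t => ?_, fun y t ht => ?_⟩⟩, hZ'⟩
    · rw [hZ', hZ']
      congr 1
      refine intervalIntegral.integral_congr fun τ _ => ?_
      have := hp _ hZ (y - clampTime T t + τ) τ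
      rw [← this]
      change N (Φ Z) _ τ = N (Φ Z) _ τ
      congr 1; ring
    · have h1 := hint y t
      rw [hZ', clampTime_of_mem ht, abs_mul, Real.abs_exp, ← mul_assoc, ← Real.exp_add,
        show lam * t + -lam * t = 0 by ring, Real.exp_zero, one_mul]
      rwa [clampTime_of_mem ht] at h1
  choose Ψ hΨ using hex
  have : CompleteSpace s := hs.isComplete.completeSpace_coe
  have : Nonempty s := ⟨⟨0, fun y t => rfl, fun y t ht => by
    change Real.exp (lam * t) * |(0 : ℝ)| ≤ _
    rw [abs_zero, mul_zero]
    positivity⟩⟩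
  obtain ⟨r, hr⟩ : ∃ r : ℝ≥0, (r : ℝ) = L / lam := ⟨⟨L / lam, by positivity⟩, rfl⟩
  have hcontr : ContractingWith r Ψ := by
    refine ⟨?_, LipschitzWith.of_dist_le_mul fun Z W => ?_⟩
    · rw [← NNReal.coe_lt_coe, hr]
      exact (div_lt_one hlam0).2 hlam
    rw [Subtype.dist_eq, hr]
    refine (BoundedContinuousFunction.dist_le (by positivity)).2 ?_
    rintro ⟨y, t⟩
    have htm := clampTime_mem hT t
    set t' := clampTime T t with ht'
    have hd := hl _ _ (hΦs Z Z.2) (hΦs W W.2) (dist Z W) dist_nonneg (fun y t ht => by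
      rw [hΦ _ y t ht, hΦ _ y t ht, ← mul_sub, abs_mul, Real.abs_exp, mul_comm]
      refine mul_le_mul_of_nonneg_right ?_ (Real.exp_pos _).le
      have := BoundedContinuousFunction.dist_coe_le_dist (f := (Z : X)) (g := (W : X)) (y, t)
      rwa [Real.dist_eq] at this)
    have hii : ∀ V, IsPeriodicBounded T C μ V →
        IntervalIntegrable (fun τ => N V (y - t' + τ) τ) volume 0 t' := by
      intro V hV
      rw [intervalIntegrable_iff_integrableOn_Ioc_of_le htm.1]
      refine Integrable.mono' (g := fun _ => μ * C * Real.exp (μ * T))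
        (integrableOn_const (by simp)) ?_ ?_
      · exact ((hm V hV).comp (f := fun τ : ℝ => (y - t' + τ, τ))
          (by fun_prop)).aestronglyMeasurable
      · filter_upwards [ae_restrict_mem measurableSet_Ioc] with τ hτ
        refine (hb V hV _ τ ⟨hτ.1.le, hτ.2.trans htm.2⟩).trans ?_
        exact mul_le_mul_of_nonneg_left (Real.exp_le_exp.2
          (mul_le_mul_of_nonneg_left (hτ.2.trans htm.2) hμ.le)) (mul_nonneg hμ.le hC)
    rw [Real.dist_eq, hΨ, hΨ, ← mul_sub, ← intervalIntegral.integral_sub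
      (hii _ (hΦs Z Z.2)) (hii _ (hΦs W W.2)), abs_mul, Real.abs_exp]
    -- Integrating `exp(lam τ)` gains the factor `1 / lam`, which leads to the contraction ratio `L
    -- / lam < 1` on all of `[0, T]`.
    have h1 := abs_integral_le_of_le_exp
      (f := fun τ => N (Φ Z) (y - t' + τ) τ - N (Φ W) (y - t' + τ) τ) hlam0
      htm.1
      (fun τ hτ => hd _ τ ⟨hτ.1, hτ.2.trans htm.2⟩)
    calc _ ≤ Real.exp (-lam * t') * (L * dist Z W / lam * Real.exp (lam * t') -
          L * dist Z W / lam) := mul_le_mul_of_nonneg_left h1 (Real.exp_pos _).le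
      _ ≤ Real.exp (-lam * t') * (L * dist Z W / lam * Real.exp (lam * t')) := by
          refine mul_le_mul_of_nonneg_left ?_ (Real.exp_pos _).le
          have : 0 ≤ L * dist Z W / lam := by positivity
          linarith
      _ = L * dist Z W / lam * (Real.exp (-lam * t') * Real.exp (lam * t')) := by ring
      _ = L / lam * dist Z W := by
          rw [← Real.exp_add, show -lam * t' + lam * t' = 0 by ring, Real.exp_zero]; ring
  obtain ⟨Z, hZ⟩ : ∃ Z, Ψ Z = Z := ⟨_, hcontr.fixedPoint_isFixedPt⟩
  refine ⟨Φ Z, hΦs Z Z.2, fun y t ht => ?_⟩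
  have h1 := hΨ Z y t
  rw [hZ, clampTime_of_mem ht] at h1
  rw [hΦ _ y t ht, h1, ← mul_assoc, ← Real.exp_add, show lam * t + -lam * t = 0 by ring,
    Real.exp_zero, one_mul]

end FixedPoint

end

/-! ### Reflection: periodic waves, extended data and the source. -/

noncomputable section

section Waves

/-- The square wave of period `2` with value `1` on `(0, 1)` and `-1` on `(-1, 0)`. -/
def squareWave (y : ℝ) : ℝ := Real.sin (Real.pi * y) / |Real.sin (Real.pi * y)|

/-- The triangle wave of period `2` with value `|y|` on `[-1, 1]`. -/
def triangleWave (y : ℝ) : ℝ := Real.arccos (Real.cos (Real.pi * y)) / Real.pi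

theorem measurable_squareWave : Measurable squareWave := by
  unfold squareWave
  have : Continuous fun y => Real.sin (Real.pi * y) := by fun_prop
  exact this.measurable.div this.abs.measurable

theorem continuousAt_squareWave {y : ℝ} (hy : y ∉ range ((↑) : ℤ → ℝ)) :
    ContinuousAt squareWave y := by
  have h0 : Real.sin (Real.pi * y) ≠ 0 := by
    intro h
    obtain ⟨n, hn⟩ := Real.sin_eq_zero_iff.1 h
    refine hy ⟨n, ?_⟩
    have := Real.pi_ne_zero
    have h2 : Real.pi * (n : ℝ) = Real.pi * y := by rw [mul_comm]; exact hn
    exact mul_left_cancel₀ this h2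
  unfold squareWave
  exact ContinuousAt.div (by fun_prop) (by fun_prop) (abs_ne_zero.2 h0)

theorem abs_squareWave_le (y : ℝ) : |squareWave y| ≤ 1 := by
  rw [squareWave, abs_div, abs_abs]
  -- At the integers the quotient is `0 / 0 = 0`, which respects the bound.
  exact div_self_le_one _

theorem squareWave_add_two (y : ℝ) : squareWave (y + 2) = squareWave y := by
  simp only [squareWave, mul_add, mul_comm Real.pi 2, Real.sin_add_two_pi]

theorem squareWave_neg (y : ℝ) : squareWave (-y) = -squareWave y := by
  simp only [squareWave, mul_neg, Real.sin_neg, abs_neg, neg_div]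

theorem squareWave_of_mem {y : ℝ} (hy : y ∈ Ioo (0 : ℝ) 1) : squareWave y = 1 := by
  have h : 0 < Real.sin (Real.pi * y) := by
    refine Real.sin_pos_of_pos_of_lt_pi (mul_pos Real.pi_pos hy.1) ?_
    nlinarith [Real.pi_pos, hy.2]
  rw [squareWave, abs_of_pos h, div_self h.ne']

theorem continuous_triangleWave : Continuous triangleWave := by
  unfold triangleWave
  exact (Real.continuous_arccos.comp (by fun_prop)).div_const _

theorem triangleWave_nonneg (y : ℝ) : 0 ≤ triangleWave y :=
  div_nonneg (Real.arccos_nonneg _) Real.pi_pos.le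

theorem triangleWave_le_one (y : ℝ) : triangleWave y ≤ 1 :=
  (div_le_one Real.pi_pos).2 (Real.arccos_le_pi _)

theorem triangleWave_add_two (y : ℝ) : triangleWave (y + 2) = triangleWave y := by
  simp only [triangleWave, mul_add, mul_comm Real.pi 2, Real.cos_add_two_pi]

theorem triangleWave_neg (y : ℝ) : triangleWave (-y) = triangleWave y := by
  simp only [triangleWave, mul_neg, Real.cos_neg]

theorem triangleWave_of_mem {y : ℝ} (hy : y ∈ Icc (0 : ℝ) 1) : triangleWave y = y := by
  have hp := Real.pi_pos
  rw [triangleWave, Real.arccos_cos (mul_nonneg hp.le hy.1) (by nlinarith [hy.2]),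
    mul_div_cancel_left₀ _ hp.ne']

end Waves

/-- A twice continuously differentiable function with `f 0 = f' 0 = 0` and its derivatives. -/
structure SmoothDatum where
  f : ℝ → ℝ
  f' : ℝ → ℝ
  f'' : ℝ → ℝ
  hasDerivAt : ∀ t, HasDerivAt f (f' t) t
  hasDerivAt' : ∀ t, HasDerivAt f' (f'' t) t
  cont'' : Continuous f''
  zero : f 0 = 0
  zero' : f' 0 = 0

theorem SmoothDatum.cont (g : SmoothDatum) : Continuous g.f :=
  continuous_iff_continuousAt.2 fun t => (g.hasDerivAt t).continuousAt

theorem SmoothDatum.cont' (g : SmoothDatum) : Continuous g.f' :=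
  continuous_iff_continuousAt.2 fun t => (g.hasDerivAt' t).continuousAt

/-- A damping function with bounded Lipschitz continuous derivative. -/
structure SmoothDamping where
  b : ℝ → ℝ
  b' : ℝ → ℝ
  L : ℝ
  M : ℝ
  L_nonneg : 0 ≤ L
  M_nonneg : 0 ≤ M
  hasDerivAt : ∀ x, HasDerivAt b (b' x) x
  abs_le : ∀ x, |b' x| ≤ L
  lip : ∀ x y, |b' x - b' y| ≤ M * |x - y|
  zero : b 0 = 0

theorem SmoothDamping.cont (β : SmoothDamping) : Continuous β.b :=
  continuous_iff_continuousAt.2 fun t => (β.hasDerivAt t).continuousAt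

theorem SmoothDamping.cont' (β : SmoothDamping) : Continuous β.b' := by
  have : LipschitzWith ⟨β.M, β.M_nonneg⟩ β.b' := LipschitzWith.of_dist_le_mul fun x y => by
    rw [Real.dist_eq, Real.dist_eq]
    exact β.lip x y
  exact this.continuous

/-- Piecewise linear interpolation between the values `v₀` (at even integers) and `v₁` (at odd
integers). -/
def boundaryLift (v₀ v₁ : ℝ) (y : ℝ) : ℝ := (1 - triangleWave y) * v₀ + triangleWave y * v₁

theorem abs_boundaryLift_le {v₀ v₁ C : ℝ} (h₀ : |v₀| ≤ C) (h₁ : |v₁| ≤ C) (y : ℝ) :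
    |boundaryLift v₀ v₁ y| ≤ C := by
  have t0 := triangleWave_nonneg y
  have t1 := triangleWave_le_one y
  rw [abs_le] at *
  unfold boundaryLift
  constructor <;> nlinarith

/-- The primitive in time. -/
def timePrimitive (V : ℝ → ℝ → ℝ) (y t : ℝ) : ℝ := ∫ s in (0:ℝ)..t, V y s

theorem continuous_timePrimitive {V : ℝ → ℝ → ℝ} (hV : Continuous (Function.uncurry V)) :
    Continuous (Function.uncurry (timePrimitive V)) := by
  have h : Continuous (Function.uncurry fun (z : ℝ × ℝ) (s : ℝ) => V z.1 s) :=
    hV.comp (f := fun w : (ℝ × ℝ) × ℝ => (w.1.1, w.2)) (by fun_prop)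
  exact intervalIntegral.continuous_parametric_intervalIntegral_of_continuous h continuous_snd

theorem hasDerivAt_timePrimitive {V : ℝ → ℝ → ℝ} (hV : Continuous (Function.uncurry V))
    (y t : ℝ) : HasDerivAt (timePrimitive V y) (V y t) t := by
  have h : Continuous (V y) := hV.comp (f := fun s : ℝ => (y, s)) (by fun_prop)
  exact (h.integral_hasStrictDerivAt 0 t).hasDerivAt

/-! ### The source of the reflected equation and its estimates. -/

section Source

variable (β : SmoothDamping) (g₀ g₁ : SmoothDatum)

/-- The velocity, extended from `[0, 1]` to `ℝ`, in terms of the time derivative `V` of the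
Riemann invariant. -/
def extVelocity (V : ℝ → ℝ → ℝ) (y t : ℝ) : ℝ :=
  squareWave y * ((timePrimitive V y t - timePrimitive V (-y) t) / 2)
    + boundaryLift (g₀.f t) (g₁.f t) y

/-- The time derivative of `extVelocity`. -/
def extAcceleration (V : ℝ → ℝ → ℝ) (y t : ℝ) : ℝ :=
  squareWave y * ((V y t - V (-y) t) / 2) + boundaryLift (g₀.f' t) (g₁.f' t) y

/-- The source term of the transport equation for the Riemann invariant. -/
def riemannSource (V : ℝ → ℝ → ℝ) (y t : ℝ) : ℝ :=
  -(g₁.f t - g₀.f t) - squareWave y * (β.b (extVelocity g₀ g₁ V y t)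
    + boundaryLift (g₀.f' t) (g₁.f' t) y)

/-- The time derivative of `riemannSource`. -/
def riemannSourceDeriv (V : ℝ → ℝ → ℝ) (y t : ℝ) : ℝ :=
  -(g₁.f' t - g₀.f' t) - squareWave y * (β.b' (extVelocity g₀ g₁ V y t) *
    extAcceleration g₀ g₁ V y t + boundaryLift (g₀.f'' t) (g₁.f'' t) y)

variable {β g₀ g₁}

theorem boundaryLift_hasDerivAt {f₀ f₁ : ℝ → ℝ} {d₀ d₁ t : ℝ} (h₀ : HasDerivAt f₀ d₀ t)
    (h₁ : HasDerivAt f₁ d₁ t) (y : ℝ) :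
    HasDerivAt (fun t => boundaryLift (f₀ t) (f₁ t) y) (boundaryLift d₀ d₁ y) t :=
  (h₀.const_mul _).add (h₁.const_mul _)

theorem extVelocity_hasDerivAt {V : ℝ → ℝ → ℝ} (hV : Continuous (Function.uncurry V))
    (y t : ℝ) : HasDerivAt (extVelocity g₀ g₁ V y) (extAcceleration g₀ g₁ V y t) t :=
  ((((hasDerivAt_timePrimitive hV y t).sub (hasDerivAt_timePrimitive hV (-y) t)).div_const
    2).const_mul _).add (boundaryLift_hasDerivAt (g₀.hasDerivAt t) (g₁.hasDerivAt t) y)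

theorem riemannSource_hasDerivAt {V : ℝ → ℝ → ℝ} (hV : Continuous (Function.uncurry V))
    (y t : ℝ) : HasDerivAt (riemannSource β g₀ g₁ V y) (riemannSourceDeriv β g₀ g₁ V y t) t :=
  ((g₁.hasDerivAt t).sub (g₀.hasDerivAt t)).neg.sub
    ((((β.hasDerivAt _).comp t (extVelocity_hasDerivAt hV y t)).add
      (boundaryLift_hasDerivAt (g₀.hasDerivAt' t) (g₁.hasDerivAt' t) y)).const_mul _)

/-- The compatibility conditions on the data and `b(0) = 0` enter here: the source is the time
integral of its derivative, with no initial term. -/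
theorem riemannSource_zero (V : ℝ → ℝ → ℝ) (y : ℝ) : riemannSource β g₀ g₁ V y 0 = 0 := by
  simp [riemannSource, extVelocity, timePrimitive, boundaryLift, g₀.zero, g₁.zero, g₀.zero',
    g₁.zero', β.zero]

theorem continuous_boundaryLift {f₀ f₁ : ℝ → ℝ} (h₀ : Continuous f₀) (h₁ : Continuous f₁) :
    Continuous fun z : ℝ × ℝ => boundaryLift (f₀ z.2) (f₁ z.2) z.1 := by
  have := continuous_triangleWave
  unfold boundaryLift
  fun_prop

theorem measurable_riemannSourceDeriv {V : ℝ → ℝ → ℝ} (hV : Continuous (Function.uncurry V)) :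
    Measurable (Function.uncurry (riemannSourceDeriv β g₀ g₁ V)) := by
  have hR := continuous_timePrimitive hV
  have hσ : Measurable fun z : ℝ × ℝ => squareWave z.1 :=
    measurable_squareWave.comp measurable_fst
  have d1 : Continuous fun z : ℝ × ℝ => (V z.1 z.2 - V (-z.1) z.2) / 2 :=
    (hV.sub (hV.comp (f := fun z : ℝ × ℝ => (-z.1, z.2)) (by fun_prop))).div_const 2
  have d2 : Continuous fun z : ℝ × ℝ =>
      (timePrimitive V z.1 z.2 - timePrimitive V (-z.1) z.2) / 2 :=
    (hR.sub (hR.comp (f := fun z : ℝ × ℝ => (-z.1, z.2)) (by fun_prop))).div_const 2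
  have hd : Continuous fun z : ℝ × ℝ => -(g₁.f' z.2 - g₀.f' z.2) := by
    have := g₁.cont'
    have := g₀.cont'
    fun_prop
  exact hd.measurable.sub (hσ.mul (((β.cont'.measurable.comp
    ((hσ.mul d2.measurable).add (continuous_boundaryLift g₀.cont g₁.cont).measurable)).mul
    ((hσ.mul d1.measurable).add (continuous_boundaryLift g₀.cont' g₁.cont').measurable)).add
    (continuous_boundaryLift g₀.cont'' g₁.cont'').measurable))

theorem continuousAt_riemannSourceDeriv {V : ℝ → ℝ → ℝ} (hV : Continuous (Function.uncurry V))
    {y : ℝ} (t : ℝ) (hy : y ∉ range ((↑) : ℤ → ℝ)) :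
    ContinuousAt (Function.uncurry (riemannSourceDeriv β g₀ g₁ V)) (y, t) := by
  have hR := continuous_timePrimitive hV
  have hσ : ContinuousAt (fun z : ℝ × ℝ => squareWave z.1) (y, t) :=
    ContinuousAt.comp (g := squareWave) (continuousAt_squareWave hy) continuousAt_fst
  have d1 : Continuous fun z : ℝ × ℝ => (V z.1 z.2 - V (-z.1) z.2) / 2 :=
    (hV.sub (hV.comp (f := fun z : ℝ × ℝ => (-z.1, z.2)) (by fun_prop))).div_const 2
  have d2 : Continuous fun z : ℝ × ℝ =>
      (timePrimitive V z.1 z.2 - timePrimitive V (-z.1) z.2) / 2 :=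
    (hR.sub (hR.comp (f := fun z : ℝ × ℝ => (-z.1, z.2)) (by fun_prop))).div_const 2
  have hd : Continuous fun z : ℝ × ℝ => -(g₁.f' z.2 - g₀.f' z.2) := by
    have := g₁.cont'
    have := g₀.cont'
    fun_prop
  have hvel : ContinuousAt (fun z : ℝ × ℝ => extVelocity g₀ g₁ V z.1 z.2) (y, t) :=
    (hσ.mul d2.continuousAt).add (continuous_boundaryLift g₀.cont g₁.cont).continuousAt
  have hb' : ContinuousAt (fun z : ℝ × ℝ => β.b' (extVelocity g₀ g₁ V z.1 z.2)) (y, t) :=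
    ContinuousAt.comp (g := β.b') β.cont'.continuousAt hvel
  exact hd.continuousAt.sub (hσ.mul ((hb'.mul
    ((hσ.mul d1.continuousAt).add (continuous_boundaryLift g₀.cont' g₁.cont').continuousAt)).add
    (continuous_boundaryLift g₀.cont'' g₁.cont'').continuousAt))

theorem continuous_riemannSourceDeriv_time {V : ℝ → ℝ → ℝ}
    (hV : Continuous (Function.uncurry V)) (y : ℝ) :
    Continuous (riemannSourceDeriv β g₀ g₁ V y) := by
  have v1 : ∀ y, Continuous (V y) := fun y => hV.comp (f := fun s : ℝ => (y, s)) (by fun_prop)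
  have hb' := β.cont'
  have c1 := g₁.cont'
  have c0 := g₀.cont'
  have c1' := g₁.cont''
  have c0' := g₀.cont''
  have hvel : Continuous (extVelocity g₀ g₁ V y) :=
    continuous_iff_continuousAt.2 fun t => (extVelocity_hasDerivAt hV y t).continuousAt
  have := v1 y
  have := v1 (-y)
  unfold riemannSourceDeriv extAcceleration boundaryLift
  fun_prop

theorem periodic_neg {V : ℝ → ℝ → ℝ} (hV : ∀ y t, V (y + 2) t = V y t) (y t : ℝ) :
    V (-(y + 2)) t = V (-y) t := by
  rw [← hV (-(y + 2)) t]
  congr 1; ring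

theorem riemannSourceDeriv_add_two {V : ℝ → ℝ → ℝ} (hV : ∀ y t, V (y + 2) t = V y t) (y t : ℝ) :
    riemannSourceDeriv β g₀ g₁ V (y + 2) t = riemannSourceDeriv β g₀ g₁ V y t := by
  simp only [riemannSourceDeriv, extVelocity, extAcceleration, timePrimitive, boundaryLift,
    squareWave_add_two, triangleWave_add_two, hV, periodic_neg hV]

theorem abs_extAcceleration_le {V : ℝ → ℝ → ℝ} {K C t : ℝ} (hV : ∀ y, |V y t| ≤ K)
    (h₀ : |g₀.f' t| ≤ C) (h₁ : |g₁.f' t| ≤ C) (y : ℝ) :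
    |extAcceleration g₀ g₁ V y t| ≤ K + C := by
  refine (abs_add_le _ _).trans (add_le_add ?_ (abs_boundaryLift_le h₀ h₁ y))
  have h1 : |(V y t - V (-y) t) / 2| ≤ K := by
    have a1 := abs_le.1 (hV y)
    have a2 := abs_le.1 (hV (-y))
    rw [abs_le]
    constructor <;> linarith
  rw [abs_mul]
  calc _ ≤ 1 * K := mul_le_mul (abs_squareWave_le y) h1 (abs_nonneg _) zero_le_one
    _ = K := one_mul K

/-- The growth in `V` is only linear, because `b'` is bounded. This gives an invariant set without
restricting the length of the time interval. -/
theorem abs_riemannSourceDeriv_le {V : ℝ → ℝ → ℝ} {K C t : ℝ} (hV : ∀ y, |V y t| ≤ K)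
    (h₀ : |g₀.f' t| ≤ C) (h₁ : |g₁.f' t| ≤ C) (h₀' : |g₀.f'' t| ≤ C) (h₁' : |g₁.f'' t| ≤ C)
    (y : ℝ) : |riemannSourceDeriv β g₀ g₁ V y t| ≤ (3 + β.L) * C + β.L * K := by
  have e1 : |-(g₁.f' t - g₀.f' t)| ≤ 2 * C := by
    have a1 := abs_le.1 h₀
    have a2 := abs_le.1 h₁
    rw [abs_le]
    constructor <;> linarith
  have e2 : |β.b' (extVelocity g₀ g₁ V y t) * extAcceleration g₀ g₁ V y t| ≤ β.L * (K + C) := by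
    rw [abs_mul]
    exact mul_le_mul (β.abs_le _) (abs_extAcceleration_le hV h₀ h₁ y) (abs_nonneg _) β.L_nonneg
  have e3 : |β.b' (extVelocity g₀ g₁ V y t) * extAcceleration g₀ g₁ V y t +
      boundaryLift (g₀.f'' t) (g₁.f'' t) y| ≤ β.L * (K + C) + C :=
    (abs_add_le _ _).trans (add_le_add e2 (abs_boundaryLift_le h₀' h₁' y))
  have e4 : |squareWave y * (β.b' (extVelocity g₀ g₁ V y t) * extAcceleration g₀ g₁ V y t +
      boundaryLift (g₀.f'' t) (g₁.f'' t) y)| ≤ β.L * (K + C) + C := by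
    rw [abs_mul]
    calc _ ≤ 1 * (β.L * (K + C) + C) :=
          mul_le_mul (abs_squareWave_le y) e3 (abs_nonneg _) zero_le_one
      _ = _ := one_mul _
  refine (abs_sub _ _).trans ((add_le_add e1 e4).trans (le_of_eq ?_))
  ring

theorem abs_squareWave_mul_half_sub_le {v₁ v₂ w₁ w₂ d : ℝ} (h₁ : |v₁ - w₁| ≤ d)
    (h₂ : |v₂ - w₂| ≤ d) (y : ℝ) :
    |squareWave y * ((v₁ - v₂) / 2) - squareWave y * ((w₁ - w₂) / 2)| ≤ d := by
  rw [← mul_sub, abs_mul]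
  have : |(v₁ - v₂) / 2 - (w₁ - w₂) / 2| ≤ d := by
    rw [abs_le] at *
    constructor <;> linarith
  calc _ ≤ 1 * d := mul_le_mul (abs_squareWave_le y) this (abs_nonneg _) zero_le_one
    _ = d := one_mul d

/-- The product `b'(velocity) * acceleration` is only locally Lipschitz in `V`, so the constant
contains a bound `K` for one acceleration. That bound is supplied by the invariant set. -/
theorem abs_riemannSourceDeriv_sub_le {V W : ℝ → ℝ → ℝ} {K d t : ℝ}
    (hW : ∀ y, |extAcceleration g₀ g₁ W y t| ≤ K) (hd : ∀ y, |V y t - W y t| ≤ d)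
    (hdR : ∀ y, |timePrimitive V y t - timePrimitive W y t| ≤ d) (y : ℝ) :
    |riemannSourceDeriv β g₀ g₁ V y t - riemannSourceDeriv β g₀ g₁ W y t| ≤
      (β.L + β.M * K) * d := by
  have e1 : |extVelocity g₀ g₁ V y t - extVelocity g₀ g₁ W y t| ≤ d := by
    simp only [extVelocity, add_sub_add_right_eq_sub]
    exact abs_squareWave_mul_half_sub_le (hdR y) (hdR (-y)) y
  have e2 : |extAcceleration g₀ g₁ V y t - extAcceleration g₀ g₁ W y t| ≤ d := by
    simp only [extAcceleration, add_sub_add_right_eq_sub]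
    exact abs_squareWave_mul_half_sub_le (hd y) (hd (-y)) y
  set v := extVelocity g₀ g₁ V y t
  set w := extVelocity g₀ g₁ W y t
  set v' := extAcceleration g₀ g₁ V y t
  set w' := extAcceleration g₀ g₁ W y t
  have e : riemannSourceDeriv β g₀ g₁ V y t - riemannSourceDeriv β g₀ g₁ W y t =
      -(squareWave y * (β.b' v * (v' - w') + (β.b' v - β.b' w) * w')) := by
    simp only [riemannSourceDeriv]
    ring
  rw [e, abs_neg, abs_mul]
  have e3 : |β.b' v * (v' - w')| ≤ β.L * d := by
    rw [abs_mul]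
    exact mul_le_mul (β.abs_le _) e2 (abs_nonneg _) β.L_nonneg
  have e4 : |(β.b' v - β.b' w) * w'| ≤ β.M * d * K := by
    rw [abs_mul]
    refine mul_le_mul ((β.lip v w).trans (mul_le_mul_of_nonneg_left e1 β.M_nonneg)) (hW y)
      (abs_nonneg _) (mul_nonneg β.M_nonneg ((abs_nonneg _).trans e1))
  calc _ ≤ 1 * (β.L * d + β.M * d * K) :=
        mul_le_mul (abs_squareWave_le y) ((abs_add_le _ _).trans (add_le_add e3 e4))
          (abs_nonneg _) zero_le_one
    _ = _ := by ring

end Source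

/-- Two exponential rates decouple the estimates: `μ` gives the a priori bound by linear growth, and
then `lam` is chosen from the Lipschitz constant on the set bounded in this way. -/
theorem exists_riemann_solution (β : SmoothDamping) (g₀ g₁ : SmoothDatum) {T : ℝ} (hT : 0 ≤ T) :
    ∃ (V : ℝ → ℝ → ℝ) (C : ℝ), Continuous (Function.uncurry V) ∧ (∀ y t, V (y + 2) t = V y t) ∧
      (∀ y, ∀ t ∈ Icc 0 T, |riemannSourceDeriv β g₀ g₁ V y t| ≤ C) ∧
      ∀ y, ∀ t ∈ Icc 0 T,
        V y t = ∫ τ in (0:ℝ)..t, riemannSourceDeriv β g₀ g₁ V (y - t + τ) τ := by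
  obtain ⟨Cg, hCg0, hCg⟩ : ∃ Cg : ℝ, 0 ≤ Cg ∧ ∀ t ∈ Icc 0 T, |g₀.f' t| ≤ Cg ∧ |g₁.f' t| ≤ Cg ∧
      |g₀.f'' t| ≤ Cg ∧ |g₁.f'' t| ≤ Cg := by
    obtain ⟨c₁, h₁⟩ := isCompact_Icc.exists_bound_of_continuousOn
      (s := Icc 0 T) g₀.cont'.continuousOn
    obtain ⟨c₂, h₂⟩ := isCompact_Icc.exists_bound_of_continuousOn
      (s := Icc 0 T) g₁.cont'.continuousOn
    obtain ⟨c₃, h₃⟩ := isCompact_Icc.exists_bound_of_continuousOn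
      (s := Icc 0 T) g₀.cont''.continuousOn
    obtain ⟨c₄, h₄⟩ := isCompact_Icc.exists_bound_of_continuousOn
      (s := Icc 0 T) g₁.cont''.continuousOn
    have p1 := abs_nonneg c₁
    have p2 := abs_nonneg c₂
    have p3 := abs_nonneg c₃
    have p4 := abs_nonneg c₄
    refine ⟨|c₁| + |c₂| + |c₃| + |c₄|, by positivity, fun t ht => ⟨?_, ?_, ?_, ?_⟩⟩
    · exact (h₁ t ht).trans (by linarith [le_abs_self c₁])
    · exact (h₂ t ht).trans (by linarith [le_abs_self c₂])
    · exact (h₃ t ht).trans (by linarith [le_abs_self c₃])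
    · exact (h₄ t ht).trans (by linarith [le_abs_self c₄])
  have hL := β.L_nonneg
  have hM := β.M_nonneg
  set C := (3 + β.L) * Cg with hC
  have hC0 : 0 ≤ C := by positivity
  -- Then `C + β.L * (C exp(μ t))` is at most `μ C exp(μ t)`, as the fixed point theorem requires.
  set μ := β.L + 1 with hμ
  have hμ0 : 0 < μ := by positivity
  set K := C * Real.exp (μ * T) + Cg with hK
  have hK0 : 0 ≤ K := by positivity
  set Λ := β.L + β.M * K with hΛ
  have hΛ0 : 0 ≤ Λ := by positivity
  have hbnd : ∀ V, IsPeriodicBounded T C μ V → ∀ y, ∀ t ∈ Icc 0 T,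
      |riemannSourceDeriv β g₀ g₁ V y t| ≤ μ * C * Real.exp (μ * t) := by
    intro V hV y t ht
    obtain ⟨b1, b2, b3, b4⟩ := hCg t ht
    refine (abs_riemannSourceDeriv_le (fun y => hV.bound y t ht) b1 b2 b3 b4 y).trans ?_
    have h1 : 1 ≤ Real.exp (μ * t) := Real.one_le_exp (mul_nonneg hμ0.le ht.1)
    have h2 : C * 1 ≤ C * Real.exp (μ * t) := mul_le_mul_of_nonneg_left h1 hC0
    rw [← hC, hμ]
    rw [hμ] at h2
    linarith
  obtain ⟨V, hV, hVeq⟩ := exists_transport_solution (T := T) (C := C) (μ := μ) (L := Λ)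
    (lam := Λ + 1) hT hC0 hμ0 hΛ0 (by linarith) (N := riemannSourceDeriv β g₀ g₁)
    (fun V hV => measurable_riemannSourceDeriv hV.cont)
    (fun V hV y t hy => continuousAt_riemannSourceDeriv hV.cont t hy)
    (fun V hV => riemannSourceDeriv_add_two hV.periodic) hbnd
    (by
      intro V W hV hW δ hδ hVW y t ht
      obtain ⟨b1, b2, -, -⟩ := hCg t ht
      rw [mul_assoc]
      refine abs_riemannSourceDeriv_sub_le (fun y => ?_) (fun y => hVW y t ht) (fun y => ?_) y
      · refine abs_extAcceleration_le (K := C * Real.exp (μ * T)) (fun y => ?_) b1 b2 y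
        refine (hW.bound y t ht).trans (mul_le_mul_of_nonneg_left ?_ hC0)
        exact Real.exp_le_exp.2 (mul_le_mul_of_nonneg_left ht.2 hμ0.le)
      · have v1 : ∀ {V : ℝ → ℝ → ℝ}, Continuous (Function.uncurry V) →
            IntervalIntegrable (V y) volume 0 t := fun hV =>
          (hV.comp (f := fun s : ℝ => (y, s)) (by fun_prop)).intervalIntegrable _ _
        rw [timePrimitive, timePrimitive, ← intervalIntegral.integral_sub (v1 hV.cont) (v1 hW.cont)]
        have hp : 0 < Λ + 1 := by linarith
        have := abs_integral_le_of_le_exp (f := fun s => V y s - W y s) hp ht.1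
          (fun s hs => hVW y s ⟨hs.1, hs.2.trans ht.2⟩)
        have h1 : 0 ≤ δ / (Λ + 1) := by positivity
        -- The rate is at least `1`, so passing to time primitives does not enlarge weighted
        -- differences.
        have h2 : δ / (Λ + 1) ≤ δ := div_le_self hδ (by linarith)
        have h3 := mul_le_mul_of_nonneg_right h2 (Real.exp_pos ((Λ + 1) * t)).le
        linarith)
  refine ⟨V, μ * C * Real.exp (μ * T), hV.cont, hV.periodic, fun y t ht => ?_, hVeq⟩
  refine (hbnd V hV y t ht).trans (mul_le_mul_of_nonneg_left ?_ (by positivity))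
  exact Real.exp_le_exp.2 (mul_le_mul_of_nonneg_left ht.2 hμ0.le)

/-- The spatial increments of the Riemann invariant. -/
theorem timePrimitive_sub_eq {β : SmoothDamping} {g₀ g₁ : SmoothDatum} {T C : ℝ}
    {V : ℝ → ℝ → ℝ} (hV : Continuous (Function.uncurry V))
    (hb : ∀ y, ∀ t ∈ Icc 0 T, |riemannSourceDeriv β g₀ g₁ V y t| ≤ C)
    (hVeq : ∀ y, ∀ t ∈ Icc 0 T,
      V y t = ∫ τ in (0:ℝ)..t, riemannSourceDeriv β g₀ g₁ V (y - t + τ) τ)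
    {t : ℝ} (ht : t ∈ Icc 0 T) {y₁ y₂ : ℝ} (hy : y₁ ≤ y₂) :
    timePrimitive V y₂ t - timePrimitive V y₁ t =
      (∫ z in y₁..y₂, riemannSource β g₀ g₁ V z t) - ∫ z in y₁..y₂, V z t := by
  have hC : 0 ≤ C := (abs_nonneg _).trans (hb 0 t ht)
  -- The source derivative is controlled on `[0, T]` only; the cutoff makes it bounded for all
  -- times, as the Fubini identity requires.
  set G : ℝ → ℝ → ℝ := fun y τ => if τ ∈ Icc 0 T then riemannSourceDeriv β g₀ g₁ V y τ else 0
    with hG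
  have hGm : Measurable (Function.uncurry G) :=
    Measurable.ite (measurable_snd measurableSet_Icc) (measurable_riemannSourceDeriv hV)
      measurable_const
  have hGC : ∀ y τ, |G y τ| ≤ C := fun y τ => by
    simp only [hG]
    split_ifs with h
    · exact hb y τ h
    · simpa using hC
  have hVG : ∀ y, ∀ s ∈ Icc 0 T, ∫ τ in (0:ℝ)..s, G (y - s + τ) τ = V y s := by
    intro y s hs
    rw [hVeq y s hs]
    refine intervalIntegral.integral_congr fun τ hτ => ?_
    rw [uIcc_of_le hs.1] at hτ
    exact if_pos ⟨hτ.1, hτ.2.trans hs.2⟩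
  have hFG : ∀ z, ∫ τ in (0:ℝ)..t, G z τ = riemannSource β g₀ g₁ V z t := by
    intro z
    have h1 : ∫ τ in (0:ℝ)..t, G z τ = ∫ τ in (0:ℝ)..t, riemannSourceDeriv β g₀ g₁ V z τ := by
      refine intervalIntegral.integral_congr fun τ hτ => ?_
      rw [uIcc_of_le ht.1] at hτ
      exact if_pos ⟨hτ.1, hτ.2.trans ht.2⟩
    rw [h1, intervalIntegral.integral_eq_sub_of_hasDerivAt
      (fun τ _ => riemannSource_hasDerivAt hV z τ)
      ((continuous_riemannSourceDeriv_time hV z).intervalIntegrable _ _), riemannSource_zero,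
      sub_zero]
  have key := integral_characteristic_identity hGm hGC ht.1 hy
  have hR : ∀ y, ∫ s in (0:ℝ)..t, ∫ τ in (0:ℝ)..s, G (y - s + τ) τ = timePrimitive V y t := by
    intro y
    refine intervalIntegral.integral_congr fun s hs => ?_
    rw [uIcc_of_le ht.1] at hs
    exact hVG y s ⟨hs.1, hs.2.trans ht.2⟩
  rw [hR, hR] at key
  simp only [hFG, hVG _ t ht] at key
  linarith

end

/-! ### Smooth solutions built from the reflected Riemann invariant. -/

noncomputable section

/-- A continuously differentiable solution of the damped wave system on `[0, 1] × [0, T]`, with the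
spatial derivatives in integrated form. -/
structure IsSmoothSolution (T c : ℝ) (g₀ g₁ b : ℝ → ℝ) (P U P' U' : ℝ → ℝ → ℝ) : Prop where
  contP : Continuous (Function.uncurry P)
  contU : Continuous (Function.uncurry U)
  contP' : Continuous (Function.uncurry P')
  contU' : Continuous (Function.uncurry U')
  derivP : ∀ x t, HasDerivAt (P x) (P' x t) t
  derivU : ∀ x t, HasDerivAt (U x) (U' x t) t
  mass : ∀ t ∈ Icc 0 T, ∀ x ∈ Icc (0 : ℝ) 1, U x t = U 0 t + ∫ z in (0:ℝ)..x, -P' z t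
  momentum : ∀ t ∈ Icc 0 T, ∀ x ∈ Icc (0 : ℝ) 1,
    P x t = P 0 t + ∫ z in (0:ℝ)..x, -(U' z t + b (U z t))
  left : ∀ t ∈ Icc 0 T, U 0 t = g₀ t
  right : ∀ t ∈ Icc 0 T, U 1 t = g₁ t
  initP : ∀ x ∈ Icc (0 : ℝ) 1, P x 0 = c
  initU : ∀ x ∈ Icc (0 : ℝ) 1, U x 0 = 0

/-- The increments of `R` over `[0, x]` and `[-x, 0]` are known. Their sum isolates the velocity and
gives conservation of mass; their difference isolates the pressure and gives the momentum equation.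
-/
theorem exists_isSmoothSolution (β : SmoothDamping) (g₀ g₁ : SmoothDatum) {T : ℝ} (hT : 0 ≤ T)
    (c : ℝ) : ∃ P U P' U', IsSmoothSolution T c g₀.f g₁.f β.b P U P' U' := by
  obtain ⟨V, C, hV, hVp, hb, hVeq⟩ := exists_riemann_solution β g₀ g₁ hT
  set R := timePrimitive V with hR
  have cR : Continuous (Function.uncurry R) := continuous_timePrimitive hV
  have cneg : ∀ {W : ℝ → ℝ → ℝ}, Continuous (Function.uncurry W) →
      Continuous fun z : ℝ × ℝ => W (-z.1) z.2 := fun hW =>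
    hW.comp (f := fun z : ℝ × ℝ => (-z.1, z.2)) (by fun_prop)
  have cg₀ := g₀.cont
  have cg₁ := g₁.cont
  have cg₀' := g₀.cont'
  have cg₁' := g₁.cont'
  have cV0 : Continuous fun z : ℝ × ℝ => V z.1 z.2 := hV
  have cR0 : Continuous fun z : ℝ × ℝ => R z.1 z.2 := cR
  have cVn := cneg hV
  have cRn := cneg cR
  -- The odd part of `R` is the velocity minus the interpolated boundary data, the even part is the
  -- pressure minus `c`.
  set U : ℝ → ℝ → ℝ := fun x t => (R x t - R (-x) t) / 2 + ((1 - x) * g₀.f t + x * g₁.f t) with hU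
  set U' : ℝ → ℝ → ℝ := fun x t =>
    (V x t - V (-x) t) / 2 + ((1 - x) * g₀.f' t + x * g₁.f' t) with hU'
  set P : ℝ → ℝ → ℝ := fun x t => c + (R x t + R (-x) t) / 2 with hP
  set P' : ℝ → ℝ → ℝ := fun x t => (V x t + V (-x) t) / 2 with hP'
  have cU : Continuous (Function.uncurry U) := by
    have : Continuous fun z : ℝ × ℝ =>
        (R z.1 z.2 - R (-z.1) z.2) / 2 + ((1 - z.1) * g₀.f z.2 + z.1 * g₁.f z.2) := by fun_prop
    exact this
  have cU' : Continuous (Function.uncurry U') := by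
    have : Continuous fun z : ℝ × ℝ =>
        (V z.1 z.2 - V (-z.1) z.2) / 2 + ((1 - z.1) * g₀.f' z.2 + z.1 * g₁.f' z.2) := by fun_prop
    exact this
  have cP : Continuous (Function.uncurry P) := by
    have : Continuous fun z : ℝ × ℝ => c + (R z.1 z.2 + R (-z.1) z.2) / 2 := by fun_prop
    exact this
  have cP' : Continuous (Function.uncurry P') := by
    have : Continuous fun z : ℝ × ℝ => (V z.1 z.2 + V (-z.1) z.2) / 2 := by fun_prop
    exact this
  have slice : ∀ {W : ℝ → ℝ → ℝ}, Continuous (Function.uncurry W) → ∀ t : ℝ,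
      Continuous fun z => W z t := fun hW t =>
    hW.comp (f := fun z : ℝ => (z, t)) (by fun_prop)
  -- the source on `(0, 1)` and on `(-1, 0)`
  have hF₁ : ∀ t, ∀ z ∈ Ioo (0 : ℝ) 1, riemannSource β g₀ g₁ V z t =
      -(g₁.f t - g₀.f t) - (β.b (U z t) + ((1 - z) * g₀.f' t + z * g₁.f' t)) := by
    intro t z hz
    simp only [riemannSource, extVelocity, squareWave_of_mem hz, boundaryLift,
      triangleWave_of_mem (Ioo_subset_Icc_self hz), one_mul, hU, hR]
  have hF₂ : ∀ t, ∀ z ∈ Ioo (0 : ℝ) 1, riemannSource β g₀ g₁ V (-z) t =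
      -(g₁.f t - g₀.f t) + (β.b (U z t) + ((1 - z) * g₀.f' t + z * g₁.f' t)) := by
    intro t z hz
    have e : -1 * ((timePrimitive V (-z) t - timePrimitive V (- -z) t) / 2) =
        (timePrimitive V z t - timePrimitive V (-z) t) / 2 := by rw [neg_neg]; ring
    simp only [riemannSource, extVelocity, squareWave_neg, squareWave_of_mem hz, boundaryLift,
      triangleWave_neg, triangleWave_of_mem (Ioo_subset_Icc_self hz), hU, hR, e]
    ring
  -- The source formulas hold on the open interval; for `x = 1` the endpoint is discarded as a null
  -- set.
  have hae : ∀ᵐ z : ℝ, z ≠ 1 := by simp [ae_iff, measure_singleton]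
  have hincr₁ : ∀ t ∈ Icc 0 T, ∀ x ∈ Icc (0 : ℝ) 1, R x t - R 0 t =
      ∫ z in (0:ℝ)..x, (-(g₁.f t - g₀.f t) - (β.b (U z t) +
        ((1 - z) * g₀.f' t + z * g₁.f' t)) - V z t) := by
    intro t ht x hx
    have cbU : Continuous fun z => β.b (U z t) := β.cont.comp (slice cU t)
    have h1 := timePrimitive_sub_eq hV hb hVeq ht hx.1
    rw [← hR] at h1
    rw [h1, intervalIntegral.integral_sub (Continuous.intervalIntegrable (by fun_prop) _ _)
      ((slice hV t).intervalIntegrable _ _)]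
    congr 1
    refine intervalIntegral.integral_congr_ae ?_
    filter_upwards [hae] with z hz hzx
    rw [uIoc_of_le hx.1] at hzx
    exact hF₁ t z ⟨hzx.1, lt_of_le_of_ne (hzx.2.trans hx.2) hz⟩
  have hincr₂ : ∀ t ∈ Icc 0 T, ∀ x ∈ Icc (0 : ℝ) 1, R 0 t - R (-x) t =
      ∫ z in (0:ℝ)..x, (-(g₁.f t - g₀.f t) + (β.b (U z t) +
        ((1 - z) * g₀.f' t + z * g₁.f' t)) - V (-z) t) := by
    intro t ht x hx
    have cbU : Continuous fun z => β.b (U z t) := β.cont.comp (slice cU t)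
    have cVt : Continuous fun z => V (-z) t := (slice hV t).comp continuous_neg
    have h1 := timePrimitive_sub_eq hV hb hVeq ht (neg_nonpos.2 hx.1)
    rw [← hR] at h1
    rw [h1, intervalIntegral.integral_sub (Continuous.intervalIntegrable (by fun_prop) _ _)
      (cVt.intervalIntegrable _ _),
      intervalIntegral.integral_comp_neg (fun z => V z t), neg_zero]
    congr 1
    have h2 := intervalIntegral.integral_comp_neg (a := 0) (b := x)
      (fun z => riemannSource β g₀ g₁ V z t)
    rw [neg_zero] at h2
    rw [← h2]
    refine intervalIntegral.integral_congr_ae ?_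
    filter_upwards [hae] with z hz hzx
    rw [uIoc_of_le hx.1] at hzx
    exact hF₂ t z ⟨hzx.1, lt_of_le_of_ne (hzx.2.trans hx.2) hz⟩
  refine ⟨P, U, P', U', cP, cU, cP', cU', ?_, ?_, ?_, ?_, ?_, ?_, ?_, ?_⟩
  · intro x t
    exact (((hasDerivAt_timePrimitive hV x t).add
      (hasDerivAt_timePrimitive hV (-x) t)).div_const 2).const_add c
  · intro x t
    exact (((hasDerivAt_timePrimitive hV x t).sub
      (hasDerivAt_timePrimitive hV (-x) t)).div_const 2).add
      (((g₀.hasDerivAt t).const_mul (1 - x)).add ((g₁.hasDerivAt t).const_mul x))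
  · intro t ht x hx
    have cbU : Continuous fun z => β.b (U z t) := β.cont.comp (slice cU t)
    have cVt : Continuous fun z => V (-z) t := (slice hV t).comp continuous_neg
    have cVt' := slice hV t
    have e1 := hincr₁ t ht x hx
    have e2 := hincr₂ t ht x hx
    have e3 : R x t - R (-x) t = (R x t - R 0 t) + (R 0 t - R (-x) t) := by ring
    rw [e1, e2, ← intervalIntegral.integral_add (Continuous.intervalIntegrable (by fun_prop) _ _)
      (Continuous.intervalIntegrable (by fun_prop) _ _)] at e3
    have e4 : ∀ z, (-(g₁.f t - g₀.f t) - (β.b (U z t) +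
        ((1 - z) * g₀.f' t + z * g₁.f' t)) - V z t) + (-(g₁.f t - g₀.f t) + (β.b (U z t) +
        ((1 - z) * g₀.f' t + z * g₁.f' t)) - V (-z) t) =
        2 * (-P' z t) + (-(2 * (g₁.f t - g₀.f t))) := by
      intro z
      simp only [hP']
      ring
    simp only [e4] at e3
    have cP't := slice cP' t
    rw [intervalIntegral.integral_add (Continuous.intervalIntegrable (by fun_prop) _ _)
      (Continuous.intervalIntegrable (by fun_prop) _ _), intervalIntegral.integral_const_mul,
      intervalIntegral.integral_const, smul_eq_mul] at e3
    simp only [hU, e3, neg_zero, sub_self]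
    ring
  · intro t ht x hx
    have cbU : Continuous fun z => β.b (U z t) := β.cont.comp (slice cU t)
    have cVt : Continuous fun z => V (-z) t := (slice hV t).comp continuous_neg
    have cVt' := slice hV t
    have e1 := hincr₁ t ht x hx
    have e2 := hincr₂ t ht x hx
    have e3 : R x t + R (-x) t - 2 * R 0 t = (R x t - R 0 t) - (R 0 t - R (-x) t) := by ring
    rw [e1, e2, ← intervalIntegral.integral_sub (Continuous.intervalIntegrable (by fun_prop) _ _)
      (Continuous.intervalIntegrable (by fun_prop) _ _)] at e3
    have e4 : ∀ z, (-(g₁.f t - g₀.f t) - (β.b (U z t) +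
        ((1 - z) * g₀.f' t + z * g₁.f' t)) - V z t) - (-(g₁.f t - g₀.f t) + (β.b (U z t) +
        ((1 - z) * g₀.f' t + z * g₁.f' t)) - V (-z) t) = 2 * (-(U' z t + β.b (U z t))) := by
      intro z
      simp only [hU']
      ring
    simp only [e4] at e3
    rw [intervalIntegral.integral_const_mul] at e3
    simp only [hP, neg_zero]
    linarith
  · intro t _
    simp [hU]
  · intro t _
    -- Periodicity makes the odd part vanish at `x = 1`, which is the right boundary condition.
    have h1 : R 1 t = R (-1) t := by
      simp only [hR, timePrimitive]
      refine intervalIntegral.integral_congr fun s _ => ?_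
      have := hVp (-1) s
      rw [show (-1 : ℝ) + 2 = 1 by norm_num] at this
      exact this
    simp only [hU, h1]
    ring
  · intro x _
    simp [hP, hR, timePrimitive]
  · intro x _
    simp [hU, hR, timePrimitive, g₀.zero, g₁.zero]

/-! ### From smooth solutions to classical solutions -/

/-- The inclusion of the continuous functions on `[0, 1]` into `L²(0, 1)`. -/
theorem exists_continuousMap_toL2 : ∃ ι : C(Icc (0 : ℝ) 1, ℝ) →L[ℝ] L2 0 1,
    ∀ f : C(Icc (0 : ℝ) 1, ℝ), ι f =ᵐ[volume.restrict (Ioo 0 1)]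
      fun x => f (projIcc 0 1 zero_le_one x) := by
  have hm : ∀ f : C(Icc (0 : ℝ) 1, ℝ), MemLp (fun x => f (projIcc 0 1 zero_le_one x)) 2
      (volume.restrict (Ioo 0 1)) := fun f =>
    MemLp.of_bound ((f.continuous.comp continuous_projIcc).aestronglyMeasurable) ‖f‖
      (Filter.Eventually.of_forall fun x => f.norm_coe_le_norm _)
  let ι₀ : C(Icc (0 : ℝ) 1, ℝ) →ₗ[ℝ] L2 0 1 :=
    { toFun := fun f => (hm f).toLp _
      map_add' := fun f g => by
        rw [← MemLp.toLp_add (hm f) (hm g)]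
        rfl
      map_smul' := fun r f => by
        rw [RingHom.id_apply, ← MemLp.toLp_const_smul r (hm f)]
        rfl }
  refine ⟨ι₀.mkContinuous 1 fun f => ?_, fun f => (hm f).coeFn_toLp⟩
  rw [one_mul]
  have := Lp.norm_le_of_ae_bound (f := ι₀ f) (norm_nonneg f) (by
    filter_upwards [(hm f).coeFn_toLp] with x hx
    have e : (ι₀ f : ℝ → ℝ) x = f (projIcc 0 1 zero_le_one x) := hx
    rw [e]
    exact f.norm_coe_le_norm _)
  refine this.trans (le_of_eq ?_)
  have hv : measureUnivNNReal (volume.restrict (Ioo (0 : ℝ) 1)) = 1 := by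
    simp [measureUnivNNReal]
  rw [hv]
  simp

/-- The slice at time `t` of a continuous function, as a continuous function on `[0, 1]`. -/
def sliceMap (W : ℝ → ℝ → ℝ) (hW : Continuous (Function.uncurry W)) (t : ℝ) :
    C(Icc (0 : ℝ) 1, ℝ) :=
  ⟨fun x => W x t, hW.comp (f := fun x : Icc (0 : ℝ) 1 => ((x : ℝ), t)) (by fun_prop)⟩

theorem continuous_sliceMap (W : ℝ → ℝ → ℝ) (hW : Continuous (Function.uncurry W)) :
    Continuous (sliceMap W hW) :=
  ContinuousMap.continuous_of_continuous_uncurry _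
    (hW.comp (f := fun z : ℝ × Icc (0 : ℝ) 1 => ((z.2 : ℝ), z.1)) (by fun_prop))

/-- A pointwise derivative is upgraded to one in the supremum norm: evaluations commute with the
integral in `C([0, 1])`, so the slice is a primitive of a continuous curve. -/
theorem hasDerivAt_sliceMap {W W' : ℝ → ℝ → ℝ} (hW : Continuous (Function.uncurry W))
    (hW' : Continuous (Function.uncurry W')) (h : ∀ x t, HasDerivAt (W x) (W' x t) t) (t : ℝ) :
    HasDerivAt (sliceMap W hW) (sliceMap W' hW' t) t := by
  have hc := continuous_sliceMap W' hW'
  have e : sliceMap W hW = fun t => sliceMap W hW 0 + ∫ s in (0:ℝ)..t, sliceMap W' hW' s := by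
    ext t x
    have h1 : (∫ s in (0:ℝ)..t, sliceMap W' hW' s) x = ∫ s in (0:ℝ)..t, W' x s := by
      have := (ContinuousMap.evalCLM ℝ x).intervalIntegral_comp_comm
        (hc.intervalIntegrable (μ := volume) 0 t)
      exact this.symm
    rw [ContinuousMap.add_apply, h1, intervalIntegral.integral_eq_sub_of_hasDerivAt
      (fun s _ => h x s) ((hW'.comp (f := fun s : ℝ => ((x : ℝ), s))
        (by fun_prop)).intervalIntegrable _ _)]
    change W x t = W x 0 + (W x t - W x 0)
    ring
  rw [e]
  exact ((hc.integral_hasStrictDerivAt 0 t).hasDerivAt).const_add _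

theorem IsSmoothSolution.exists_isClassicalSolution {T c : ℝ} (hT : 0 < T) {g₀ g₁ b : ℝ → ℝ}
    (hb : Continuous b) {P U P' U' : ℝ → ℝ → ℝ} (h : IsSmoothSolution T c g₀ g₁ b P U P' U') :
    ∃ p u, IsClassicalSolution T c g₀ g₁ b p u := by
  obtain ⟨ι, hι⟩ := exists_continuousMap_toL2
  have hιs : ∀ (W : ℝ → ℝ → ℝ) (hW : Continuous (Function.uncurry W)) (t : ℝ),
      ι (sliceMap W hW t) =ᵐ[volume.restrict (Ioo 0 1)] fun x => W x t := by
    intro W hW t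
    filter_upwards [hι (sliceMap W hW t), ae_restrict_mem measurableSet_Ioo] with x hx hm
    rw [hx, projIcc_of_mem zero_le_one (Ioo_subset_Icc_self hm)]
    rfl
  have hweak : ∀ (W D : ℝ → ℝ → ℝ) (hW : Continuous (Function.uncurry W))
      (hD : Continuous (Function.uncurry D)) (t : ℝ),
      (∀ x ∈ Icc (0 : ℝ) 1, W x t = W 0 t + ∫ z in (0:ℝ)..x, D z t) →
      HasWeakDeriv (Ioo 0 1) (ι (sliceMap W hW t)) (ι (sliceMap D hD t)) := by
    intro W D hW hD t hWD
    have hi : IntegrableOn (fun z => D z t) (Ioo 0 1) :=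
      ((hD.comp (f := fun z : ℝ => (z, t)) (by fun_prop)).integrableOn_Icc
        (a := 0) (b := 1)).mono_set Ioo_subset_Icc_self
    refine (hasWeakDeriv_primitive hi (W 0 t)).congr_ae isOpen_Ioo ?_ (hιs D hD t).symm
    filter_upwards [hιs W hW t, ae_restrict_mem measurableSet_Ioo] with x hx hm
    rw [hx, hWD x (Ioo_subset_Icc_self hm)]
  -- the weak spatial derivatives
  set Ux : ℝ → ℝ → ℝ := fun x t => -P' x t with hUx
  set Px : ℝ → ℝ → ℝ := fun x t => -(U' x t + b (U x t)) with hPx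
  have cUx : Continuous (Function.uncurry Ux) := h.contP'.neg
  have cPx : Continuous (Function.uncurry Px) := (h.contU'.add (hb.comp h.contU)).neg
  have hclm := clampTime_mem hT.le
  -- An element of `H¹` is needed at every real time, but the spatial equations hold on `[0, T]`
  -- only; hence the clamped time.
  let p : ℝ → SobolevH 1 0 1 := fun t => SobolevH.ofPair
    (ι (sliceMap _ h.contP (clampTime T t))) (ι (sliceMap _ cPx (clampTime T t)))
    (hweak P Px h.contP cPx _ (h.momentum _ (hclm t)))
  let u : ℝ → SobolevH 1 0 1 := fun t => SobolevH.ofPair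
    (ι (sliceMap _ h.contU (clampTime T t))) (ι (sliceMap _ cUx (clampTime T t)))
    (hweak U Ux h.contU cUx _ (h.mass _ (hclm t)))
  have hcont : ∀ (W : ℝ → ℝ → ℝ) (hW : Continuous (Function.uncurry W)),
      Continuous fun t => ι (sliceMap W hW (clampTime T t)) := fun W hW =>
    ι.continuous.comp ((continuous_sliceMap W hW).comp (continuous_clampTime T))
  have hderiv : ∀ (W W' : ℝ → ℝ → ℝ) (hW : Continuous (Function.uncurry W))
      (hW' : Continuous (Function.uncurry W')), (∀ x t, HasDerivAt (W x) (W' x t) t) →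
      ∀ t, HasDerivAt (fun t => ι (sliceMap W hW t)) (ι (sliceMap W' hW' t)) t :=
    fun W W' hW hW' hd t => ι.hasFDerivAt.comp_hasDerivAt t (hasDerivAt_sliceMap hW hW' hd t)
  have hC1 : ∀ (W W' : ℝ → ℝ → ℝ) (hW : Continuous (Function.uncurry W))
      (hW' : Continuous (Function.uncurry W')), (∀ x t, HasDerivAt (W x) (W' x t) t) →
      ContDiff ℝ 1 fun t => ι (sliceMap W hW t) := by
    intro W W' hW hW' hd
    rw [contDiff_one_iff_deriv]
    refine ⟨fun t => (hderiv W W' hW hW' hd t).differentiableAt, ?_⟩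
    rw [funext fun t => (hderiv W W' hW hW' hd t).deriv]
    exact ι.continuous.comp (continuous_sliceMap W' hW')
  have hp0 : EqOn (fun t => weakD (p t) 0) (fun t => ι (sliceMap _ h.contP t)) (Icc 0 T) :=
    fun t ht => by
      change ι (sliceMap _ h.contP (clampTime T t)) = _
      rw [clampTime_of_mem ht]
  have hu0 : EqOn (fun t => weakD (u t) 0) (fun t => ι (sliceMap _ h.contU t)) (Icc 0 T) :=
    fun t ht => by
      change ι (sliceMap _ h.contU (clampTime T t)) = _
      rw [clampTime_of_mem ht]
  have hpv : ∀ t ∈ Icc 0 T, EqOn (pointVal (p t)) (fun x => P x t) (Icc 0 1) := fun t ht => by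
    refine pointVal_eqOn zero_lt_one _ ?_ ?_
    · exact (h.contP.comp (f := fun z : ℝ => (z, t)) (by fun_prop)).continuousOn
    · have e : weakD (p t) 0 = ι (sliceMap _ h.contP t) := hp0 ht
      rw [e]
      exact hιs _ _ t
  have huv : ∀ t ∈ Icc 0 T, EqOn (pointVal (u t)) (fun x => U x t) (Icc 0 1) := fun t ht => by
    refine pointVal_eqOn zero_lt_one _ ?_ ?_
    · exact (h.contU.comp (f := fun z : ℝ => (z, t)) (by fun_prop)).continuousOn
    · have e : weakD (u t) 0 = ι (sliceMap _ h.contU t) := hu0 ht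
      rw [e]
      exact hιs _ _ t
  have hun : UniqueDiffOn ℝ (Icc 0 T) := uniqueDiffOn_Icc hT
  have hpd : ∀ t ∈ Icc 0 T, derivWithin (fun s => weakD (p s) 0) (Icc 0 T) t =
      ι (sliceMap _ h.contP' t) := fun t ht => by
    rw [derivWithin_congr hp0 (hp0 ht)]
    exact ((hderiv P P' h.contP h.contP' h.derivP t).hasDerivWithinAt).derivWithin (hun t ht)
  have hud : ∀ t ∈ Icc 0 T, derivWithin (fun s => weakD (u s) 0) (Icc 0 T) t =
      ι (sliceMap _ h.contU' t) := fun t ht => by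
    rw [derivWithin_congr hu0 (hu0 ht)]
    exact ((hderiv U U' h.contU h.contU' h.derivU t).hasDerivWithinAt).derivWithin (hun t ht)
  have h00 : (0 : ℝ) ∈ Icc 0 T := left_mem_Icc.2 hT.le
  refine ⟨p, u, ?_, ?_, ?_, ?_, ?_, ?_, ?_, ?_, ?_, ?_⟩
  · exact (SobolevH.continuous_ofPair (hcont _ _) (hcont _ _) _).continuousOn
  · exact (SobolevH.continuous_ofPair (hcont _ _) (hcont _ _) _).continuousOn
  · exact (hC1 P P' h.contP h.contP' h.derivP).contDiffOn.congr hp0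
  · exact (hC1 U U' h.contU h.contU' h.derivU).contDiffOn.congr hu0
  · intro t ht
    have e : weakD (u t) 1 = ι (sliceMap _ cUx t) := by
      change ι (sliceMap _ cUx (clampTime T t)) = _
      rw [clampTime_of_mem ht]
    rw [hpd t ht, e]
    filter_upwards [hιs P' h.contP' t, hιs Ux cUx t] with x e1 e2
    rw [e1, e2]
    simp [hUx]
  · intro t ht
    have e : weakD (p t) 1 = ι (sliceMap _ cPx t) := by
      change ι (sliceMap _ cPx (clampTime T t)) = _
      rw [clampTime_of_mem ht]
    rw [hud t ht, e]
    filter_upwards [hιs U' h.contU' t, hιs Px cPx t, ae_restrict_mem measurableSet_Ioo]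
      with x e1 e2 hx
    rw [e1, e2, huv t ht (Ioo_subset_Icc_self hx)]
    simp [hPx]
  · intro t ht
    rw [huv t ht (by simp)]
    exact h.left t ht
  · intro t ht
    rw [huv t ht (by simp)]
    exact h.right t ht
  · intro x hx
    rw [hpv 0 h00 hx]
    exact h.initP x hx
  · intro x hx
    rw [huv 0 h00 hx]
    exact h.initU x hx

end

/-! ### Well-posedness and stability of the forward operator. -/

noncomputable section

/-- The second derivative is extended constantly beyond `[0, T]` and integrated twice; `g(0) = g'(0)
= 0` makes this reproduce `g`. -/
theorem AdmissibleDatum.exists_smoothDatum {T : ℝ} (hT : 0 < T) {g : ℝ → ℝ}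
    (hg : AdmissibleDatum T g) : ∃ G : SmoothDatum, EqOn G.f g (Icc 0 T) := by
  have hun : UniqueDiffOn ℝ (Icc 0 T) := uniqueDiffOn_Icc hT
  set g' := derivWithin g (Icc 0 T) with hg'
  have s' : ContDiffOn ℝ 2 g' (Icc 0 T) := hg.smooth.derivWithin hun (by norm_num)
  set g'' := derivWithin g' (Icc 0 T) with hg''
  have s'' : ContDiffOn ℝ 1 g'' (Icc 0 T) := s'.derivWithin hun (by norm_num)
  have ftc : ∀ w : ℝ → ℝ, ContDiffOn ℝ 2 w (Icc 0 T) → w 0 = 0 → ∀ t ∈ Icc 0 T,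
      ∫ s in (0:ℝ)..t, derivWithin w (Icc 0 T) s = w t := by
    intro w hw w0 t ht
    have hc : ContinuousOn (derivWithin w (Icc 0 T)) (Icc 0 T) :=
      hw.continuousOn_derivWithin hun (by norm_num)
    rw [intervalIntegral.integral_eq_sub_of_hasDerivAt_of_le ht.1
      (hw.continuousOn.mono (Icc_subset_Icc_right ht.2)) (fun s hs => ?_)
      ((hc.mono (Icc_subset_Icc_right ht.2)).intervalIntegrable_of_Icc ht.1), w0, sub_zero]
    have hs' : Icc 0 T ∈ nhds s := Icc_mem_nhds hs.1 (hs.2.trans_le ht.2)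
    exact ((hw.differentiableOn (by norm_num) s
      ⟨hs.1.le, hs.2.le.trans ht.2⟩).hasDerivWithinAt).hasDerivAt hs'
  have cf'' : Continuous fun t => g'' (clampTime T t) :=
    s''.continuousOn.comp_continuous (continuous_clampTime T) (clampTime_mem hT.le)
  have df' : ∀ t, HasDerivAt (fun t => ∫ s in (0:ℝ)..t, g'' (clampTime T s))
      (g'' (clampTime T t)) t := fun t => (cf''.integral_hasStrictDerivAt 0 t).hasDerivAt
  have cf' : Continuous fun t => ∫ s in (0:ℝ)..t, g'' (clampTime T s) :=
    continuous_iff_continuousAt.2 fun t => (df' t).continuousAt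
  refine ⟨⟨fun t => ∫ r in (0:ℝ)..t, ∫ s in (0:ℝ)..r, g'' (clampTime T s),
    fun t => ∫ s in (0:ℝ)..t, g'' (clampTime T s), fun t => g'' (clampTime T t),
    fun t => (cf'.integral_hasStrictDerivAt 0 t).hasDerivAt, df', cf'', by simp, by simp⟩, ?_⟩
  have e' : ∀ t ∈ Icc 0 T, ∫ s in (0:ℝ)..t, g'' (clampTime T s) = g' t := by
    intro t ht
    rw [← ftc g' s' hg.deriv_zero t ht]
    refine intervalIntegral.integral_congr fun s hs => ?_
    rw [uIcc_of_le ht.1] at hs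
    simp only [clampTime_of_mem (show s ∈ Icc 0 T from ⟨hs.1, hs.2.trans ht.2⟩)]
    rfl
  intro t ht
  rw [← ftc g (hg.smooth.of_le (by norm_num)) hg.zero t ht]
  refine intervalIntegral.integral_congr fun r hr => ?_
  rw [uIcc_of_le ht.1] at hr
  exact e' r ⟨hr.1, hr.2.trans ht.2⟩

theorem AdmissibleOn.congr {B : ParamBounds} {α β : ℝ} {a b : ℝ → ℝ} (hαβ : α < β)
    (ha : AdmissibleOn B (Ioo α β) a) (h : EqOn b a (Icc α β)) :
    AdmissibleOn B (Ioo α β) b := by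
  have hcl : closure (Ioo α β) = Icc α β := closure_Ioo hαβ.ne
  obtain ⟨hc, h0, ha0, a', a'', a''', w1, w2, w3, hb⟩ := ha
  rw [hcl] at hc h0
  refine ⟨hcl ▸ hc.congr h, hcl ▸ h0, (h h0).trans ha0, a', a'', a''', ?_, w2, w3, hb⟩
  refine w1.congr_ae isOpen_Ioo ?_ (ae_eq_refl _)
  filter_upwards [ae_restrict_mem measurableSet_Ioo] with x hx
  exact (h (Ioo_subset_Icc_self hx)).symm

variable {B : ParamBounds} {T c : ℝ} {g₀ g₁ : ℝ → ℝ} {umin umax : ℝ}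

/-- A solution is constructed for the extended parameter. The state bounds apply to it and confine
the velocity to the interval on which the extension equals `a`, so it also solves the equation for
`a`. -/
theorem exists_isState (hT : 0 < T) (hg₀ : AdmissibleDatum T g₀) (hg₁ : AdmissibleDatum T g₁)
    (hB : AreStateBounds B T c g₀ g₁ umin umax) {a : SobolevH 2 umin umax}
    (ha : a ∈ domF B umin umax) : ∃ p u, IsState T c g₀ g₁ a p u := by
  obtain ⟨hlt, h0, hbd⟩ := hB
  obtain ⟨G₀, hG₀⟩ := hg₀.exists_smoothDatum hT
  obtain ⟨G₁, hG₁⟩ := hg₁.exists_smoothDatum hT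
  have ha' : AdmissibleOn B (Ioo umin umax) (pointVal a) := ha
  obtain ⟨b, b', hba, hd, ⟨M, hM, hlip⟩, ⟨L, hL, hle⟩, B', hB'⟩ := ha'.exists_extension hlt
  let β : SmoothDamping := ⟨b, b', L, M, hL, hM, hd, hle, hlip, hB'.2.2.1⟩
  obtain ⟨P, U, P', U', hs⟩ := exists_isSmoothSolution β G₀ G₁ hT.le c
  obtain ⟨p, u, hpu⟩ := hs.exists_isClassicalSolution hT β.cont
  have hsol : IsClassicalSolution T c g₀ g₁ b p u :=
    { hpu with
      left := fun t ht => (hpu.left t ht).trans (hG₀ ht)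
      right := fun t ht => (hpu.right t ht).trans (hG₁ ht) }
  have hval := hbd B' b hB' (ha'.congr hlt hba) p u hsol
  refine ⟨p, u, { hsol with momentum := fun t ht => ?_ }, hval⟩
  filter_upwards [hsol.momentum t ht, ae_restrict_mem measurableSet_Ioo] with x hx hm
  rw [← hba (hval t ht x (Ioo_subset_Icc_self hm))]
  exact hx

theorem stabilityCondition_pointVal (hlt : umin < umax) {a b : SobolevH 2 umin umax}
    (ha : a ∈ domF B umin umax) {δ : ℝ}
    (h : ∀ y ∈ Icc umin umax, |pointVal a y - pointVal b y| ≤ δ) :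
    StabilityCondition (Icc umin umax) B.a₁ δ (pointVal a) (pointVal b) :=
  have ha' : AdmissibleOn B (Ioo umin umax) (pointVal a) := ha
  ⟨ha'.monotoneOn hlt, ha'.lipschitz hlt, h⟩

theorem IsState.eqOn (hlt : umin < umax) {a : SobolevH 2 umin umax} (ha : a ∈ domF B umin umax)
    {p u q w : ℝ → SobolevH 1 0 1} (h : IsState T c g₀ g₁ a p u) (h' : IsState T c g₀ g₁ a q w) :
    EqOn p q (Icc 0 T) ∧ EqOn u w (Icc 0 T) :=
  IsClassicalSolution.eqOn ⟨B.a₁, umin, umax,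
    stabilityCondition_pointVal hlt ha (by simp), h.2, h'.2⟩ h.1 h'.1

theorem memLp_of_continuousOn_Icc {f : ℝ → ℝ} (hf : ContinuousOn f (Icc 0 T)) :
    MemLp f 2 (volume.restrict (Ioo 0 T)) := by
  obtain ⟨C, hC⟩ := isCompact_Icc.exists_bound_of_continuousOn hf
  refine MemLp.of_bound
    ((hf.mono Ioo_subset_Icc_self).aestronglyMeasurable measurableSet_Ioo) C ?_
  filter_upwards [ae_restrict_mem measurableSet_Ioo] with t ht
  exact hC t (Ioo_subset_Icc_self ht)

theorem IsState.forwardOp_ae_eq (hlt : umin < umax) {a : SobolevH 2 umin umax}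
    (ha : a ∈ domF B umin umax) {p u : ℝ → SobolevH 1 0 1} (h : IsState T c g₀ g₁ a p u) :
    forwardOp T c g₀ g₁ a =ᵐ[volume.restrict (Ioo 0 T)] pressureDrop p := by
  have hex : ∃ y : (ℝ → SobolevH 1 0 1) × (ℝ → SobolevH 1 0 1),
      IsState T c g₀ g₁ a y.1 y.2 ∧ MemLp (pressureDrop y.1) 2 (volume.restrict (Ioo 0 T)) :=
    ⟨(p, u), h, memLp_of_continuousOn_Icc h.1.continuousOn_pressureDrop⟩
  rw [forwardOp, dif_pos hex]
  -- Uniqueness makes the pressure drop independent of the state selected in the definition of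
  -- `forwardOp`.
  have heq := (hex.choose_spec.1.eqOn hlt ha h).1
  filter_upwards [hex.choose_spec.2.coeFn_toLp, ae_restrict_mem measurableSet_Ioo] with t ht hm
  rw [ht, pressureDrop, pressureDrop, heq (Ioo_subset_Icc_self hm)]

theorem forwardOpWellDefinedAt (hT : 0 < T) (hg₀ : AdmissibleDatum T g₀)
    (hg₁ : AdmissibleDatum T g₁) (hB : AreStateBounds B T c g₀ g₁ umin umax)
    {a : SobolevH 2 umin umax} (ha : a ∈ domF B umin umax) :
    ForwardOpWellDefinedAt T c g₀ g₁ a := by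
  obtain ⟨p, u, h⟩ := exists_isState hT hg₀ hg₁ hB ha
  exact ⟨p, u, h, fun q w h' => h'.eqOn hB.1 ha h,
    memLp_of_continuousOn_Icc h.1.continuousOn_pressureDrop, h.forwardOp_ae_eq hB.1 ha⟩

theorem norm_forwardOp_sub_sq_le (hT : 0 < T) (hg₀ : AdmissibleDatum T g₀)
    (hg₁ : AdmissibleDatum T g₁) (hB : AreStateBounds B T c g₀ g₁ umin umax)
    {a b : SobolevH 2 umin umax} (ha : a ∈ domF B umin umax) (hb : b ∈ domF B umin umax) {δ : ℝ}
    (h : ∀ y ∈ Icc umin umax, |pointVal a y - pointVal b y| ≤ δ) :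
    ‖forwardOp T c g₀ g₁ a - forwardOp T c g₀ g₁ b‖ ^ 2 ≤ stabilityConst T B.a₁ * δ ^ 2 := by
  obtain ⟨p, u, hp⟩ := exists_isState hT hg₀ hg₁ hB ha
  obtain ⟨q, v, hq⟩ := exists_isState hT hg₀ hg₁ hB hb
  rw [← L2.integral_sq]
  refine le_trans (le_of_eq ?_) (integral_sq_pressureDrop_sub_le hT
    (stabilityCondition_pointVal hB.1 ha h) hp.1 hq.1 hp.2 hq.2)
  refine integral_congr_ae ?_
  filter_upwards [Lp.coeFn_sub (forwardOp T c g₀ g₁ a) (forwardOp T c g₀ g₁ b),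
    hp.forwardOp_ae_eq hB.1 ha, hq.forwardOp_ae_eq hB.1 hb] with t h1 h2 h3
  rw [h1, Pi.sub_apply, h2, h3]

end

/-! ### The Lipschitz estimate. -/

theorem mainTheorem3 (B : ParamBounds) (T : ℝ) (hT : 0 < T) (c : ℝ) (g₀ g₁ : ℝ → ℝ)
    (hg₀ : AdmissibleDatum T g₀) (hg₁ : AdmissibleDatum T g₁) :
    (∃ umin umax : ℝ, AreStateBounds B T c g₀ g₁ umin umax) ∧
    ∀ umin umax : ℝ, AreStateBounds B T c g₀ g₁ umin umax →
      (∀ a ∈ domF B umin umax, ForwardOpWellDefinedAt T c g₀ g₁ a) ∧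
      ∃ C : ℝ≥0, LipschitzOnWith C (forwardOp T c g₀ g₁) (domF B umin umax) := by
  refine ⟨exists_areStateBounds B hT c hg₀.smooth.continuousOn hg₁.smooth.continuousOn,
    fun umin umax hB => ⟨fun a ha => forwardOpWellDefinedAt hT hg₀ hg₁ hB ha, ?_⟩⟩
  -- The stability estimate sees only the uniform distance of the parameters, which this embedding
  -- constant compares with the `H²` norm.
  obtain ⟨K, hK, hKv⟩ := exists_abs_pointVal_le 1 hB.1
  refine ⟨(√(stabilityConst T B.a₁) * K).toNNReal,
    LipschitzOnWith.of_dist_le_mul fun a ha b hb => ?_⟩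
  rw [Real.coe_toNNReal _ (by positivity), dist_eq_norm, dist_eq_norm]
  have key := norm_forwardOp_sub_sq_le hT hg₀ hg₁ hB ha hb (δ := K * ‖a - b‖) fun y hy => by
    have e : pointVal (a - b) y = pointVal a y - pointVal b y := pointVal_sub hB.1 a b hy
    rw [← e]
    exact hKv (a - b) y hy
  calc ‖forwardOp T c g₀ g₁ a - forwardOp T c g₀ g₁ b‖
      ≤ √(stabilityConst T B.a₁ * (K * ‖a - b‖) ^ 2) := Real.le_sqrt_of_sq_le key
    _ = √(stabilityConst T B.a₁) * K * ‖a - b‖ := by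
        rw [Real.sqrt_mul' _ (sq_nonneg _), Real.sqrt_sq (by positivity), mul_assoc]
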